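/- Let $k\ge 0$ be an integer and $\tau\in\mathbb C$. Let $\mathcal M_\tau$ be the set of quadruples $(A,B,i,j)$ with $A,B\in M_{k,k}(\mathbb C)$, $i=(i_1,i_2)\in M_{k,2}(\mathbb C)$, $j=\binom{j_1}{j_2}\in M_{2,k}(\mathbb C)$ and $[A,B]-ij=\tau\cdot 1$. The group $GL(k,\mathbb C)$ acts on it by $L\cdot(A,B,i,j)=(LAL^{-1},LBL^{-1},Li,jL^{-1})$; for $\tau\ne0$ let $N_{k,\tau}=\mathcal M_\tau/GL(k,\mathbb C)$. To a point of $\mathcal M_\tau\times\mathbb C^2$ (on which $GL(k,\mathbb C)$ acts, trivially on $\mathbb C^2\ni(z_1,z_2)$) assign the $(k+1)\times(k+1)$-matrices $$\widehat A=\begin{pmatrix}A&i_1\\ j_2&z_1\end{pmatrix},\qquad \widehat B=\begin{pmatrix}B&i_2\\ -j_1&z_2\end{pmatrix}.$$ Let $GL(k,\mathbb C)\subset GL(k+1,\mathbb C)$ be embedded as $L\mapsto\operatorname{diag}(L,1)$, acting by conjugation. The matrix $\widehat A$ is called *strongly semisimple* if its $GL(k,\mathbb C)$-orbit has maximal dimension,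 if $\widehat A\binom v0\neq\lambda\binom v0$ whenever $v\ne0$ and $Av=\lambda v$, and if $A$ and $\widehat A$ are both diagonalisable with distinct eigenvalues. Let $\tilde N^{\rm reg}_{k,\tau}$ be the space of $GL(k,\mathbb C)$-orbits in $\mathcal M_\tau\times\mathbb C^2$ consisting of points with $\widehat A$ strongly semisimple, with its structure of geometric quotient (regular functions are the invariant regular functions upstairs) and with the symplectic form induced by $\operatorname{tr}dA\wedge dB+\operatorname{tr}dj\wedge di+dz_1\wedge dz_2=\operatorname{tr}d\widehat A\wedge d\widehat B$. Let $\mathfrak h_n^{\rm reg}\subset\mathbb C^n$ be the set of vectors with pairwise distinct entries, and give $T^*\mathfrak h_k^{\rm reg}\times T^*\mathfrak h_{k+1}^{\rm reg}$, with coordinates $(\lambda_i,\mu_i;\widehat\lambda_j,\widehat\mu_j)$, $1\le i\le k$, $1\le j\le k+1$, the form $\sum_i d\lambda_i\wedge d\mu_i+\sum_j d\widehat\lambda_j\wedge d\widehat\mu_j$, which descends to the quotient by the free action of $S_k\times S_{k+1}$. Then $\tilde N^{\rm reg}_{k,\tau}$ is Zariski-open in the orbit space $(\mathcal M_\tau\times\mathbb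 C^2)/GL(k,\mathbb C)$ (which is $N_{k,\tau}\times\mathbb C^2$ for $\tau\neq0$), and there is a well-defined map $$\pi:\tilde N^{\rm reg}_{k,\tau}\longrightarrow\bigl(T^*\mathfrak h_k^{\rm reg}\times T^*\mathfrak h_{k+1}^{\rm reg}\bigr)/(S_k\times S_{k+1})$$ which sends the orbit of $(\widehat A,\widehat B)$ to the class of $(\lambda_i,\mu_i;\widehat\lambda_j,\widehat\mu_j)$ exactly when $\widehat B$ can be written as $\widehat B=\left(\begin{smallmatrix}B_1&0\\0&0\end{smallmatrix}\right)+B_2$ with $[A,B_1]=0$, with $[\widehat A,B_2]-\operatorname{diag}(\tau,\dots,\tau,-k\tau)$ zero outside the first $k$ entries of the last column, and such that $(\lambda_i,\mu_i)$ are the simultaneous eigenvalues of $(A,B_1)$ (that is, $A$ and $B_1$ are taken to $\operatorname{diag}(\lambda_i)$ and $\operatorname{diag}(\mu_i)$ by a common conjugation), while for some $g\in GL(k+1,\mathbb C)$ one has $g\widehat Ag^{-1}=\operatorname{diag}(\widehat\lambda_1,\dots,\widehat\lambda_{k+1})$ and $gB_2g^{-1}$ has diagonal entries $\widehat\mu_1,\dots,\widehat\mu_{k+1}$.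 The map $\pi$ is an isomorphism of algebraic varieties and identifies the symplectic forms. In other words, $\lambda_i,\mu_i,\widehat\lambda_j,\widehat\mu_j$ are algebraic Darboux coordinates. Moreover, an orbit in $\tilde N^{\rm reg}_{k,\tau}$ is closed in the vector space of all $(A,B,i,j,z_1,z_2)$ if and only if $\tau\neq0$ or $\lambda_i\neq\widehat\lambda_j$ for all $i,j$. (So for $\tau=0$, where the affine quotient $N_{k,0}$ consists of the closed orbits only, the points of $\tilde N^{\rm reg}_{k,0}$ which are points of $N_{k,0}\times\mathbb C^2$ are precisely those with no common eigenvalue of $A$ and $\widehat A$.) -/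

import Mathlib

open Matrix Topology

attribute [local instance] Matrix.normedAddCommGroup Matrix.normedSpace

noncomputable section

/-! ## Quotients of subvarieties of affine space, as spaces with functions -/

namespace QuotVar

/-- The algebra of polynomial functions on a complex vector space. -/
def polyFun (V : Type*) [AddCommGroup V] [Module ℂ V] : Subalgebra ℂ (V → ℂ) :=
  Algebra.adjoin ℂ (Set.range fun φ : Module.Dual ℂ V => (φ : V → ℂ))

/-- The Zariski topology of a vector space: generated by the principal open sets. -/
@[reducible] def zariski (V : Type*) [AddCommGroup V] [Module ℂ V] : TopologicalSpace V :=
  TopologicalSpace.generateFrom {U | ∃ p ∈ polyFun V, U = {v | p v ≠ 0}}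

/-- The Zariski topology of a quotient of a subset `X` of a vector space. -/
@[reducible] def zariskiQuot {V : Type*} [AddCommGroup V] [Module ℂ V] {X : Set V} (r : Setoid X) :
    TopologicalSpace (Quotient r) :=
  TopologicalSpace.coinduced (Quotient.mk r)
    (TopologicalSpace.induced (Subtype.val : X → V) (zariski V))

/-- `f` is a regular function on the open subset `U` of the quotient of `X` by `r`: its pullback
to the preimage of `U` in `X` is locally a quotient of two polynomials. -/
def IsRegularOn {V : Type*} [AddCommGroup V] [Module ℂ V] {X : Set V} (r : Setoid X)
    (U : Set (Quotient r)) (f : Quotient r → ℂ) : Prop :=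
  ∀ x : X, Quotient.mk r x ∈ U → ∃ p ∈ polyFun V, ∃ q ∈ polyFun V, q x ≠ 0 ∧
    ∀ x' : X, Quotient.mk r x' ∈ U → q x' ≠ 0 → f (Quotient.mk r x') = p x' / q x'

/-- Isomorphism of algebraic varieties: a bijection that is a homeomorphism for the Zariski
topologies and identifies the regular functions on every open set. -/
structure IsAlgIso {V W : Type*} [AddCommGroup V] [Module ℂ V] [AddCommGroup W] [Module ℂ W]
    {X : Set V} {Y : Set W} (r : Setoid X) (s : Setoid Y) (π : Quotient r → Quotient s) :
    Prop where
  bijective : Function.Bijective π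
  isOpen_iff : ∀ U : Set (Quotient s), IsOpen[zariskiQuot s] U ↔ IsOpen[zariskiQuot r] (π ⁻¹' U)
  regular_iff : ∀ U : Set (Quotient s), IsOpen[zariskiQuot s] U → ∀ f : Quotient s → ℂ,
    (IsRegularOn s U f ↔ IsRegularOn r (π ⁻¹' U) (f ∘ π))

/-- Symplectic isomorphism between two quotients. Here `ωV`, `ωW` are constant two-forms on the
ambient vector spaces; the form on the quotient of `X` is the one whose pullback to `X` is the
restriction of `ωV`, and likewise for `Y`, which is meant to be open in `W` with `s` the orbit
relation of a free finite group, so that `Y` is étale over its quotient.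
That `π` identifies the two forms is expressed on local holomorphic lifts: near any `y` lying
over `π ⟦x⟧`, the map `y' ↦ π⁻¹ ⟦y'⟧` lifts to a holomorphic map `H` into `X` with `H y = x`, and
`H` pulls `ωV` back to `ωW` at `y`. -/
structure IsSymplecticIso {V W : Type*} [NormedAddCommGroup V] [NormedSpace ℂ V]
    [NormedAddCommGroup W] [NormedSpace ℂ W] {X : Set V} {Y : Set W}
    (r : Setoid X) (s : Setoid Y) (ωV : V → V → ℂ) (ωW : W → W → ℂ)
    (π : Quotient r → Quotient s) : Prop where
  algIso : IsAlgIso r s π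
  symplectic : ∀ (x : X) (y : Y), π (Quotient.mk r x) = Quotient.mk s y →
    ∃ H : W → V, AnalyticAt ℂ H y ∧ H y = x ∧
      (∀ᶠ y' in 𝓝 (y : W), ∃ (hX : H y' ∈ X) (hY : y' ∈ Y),
        π (Quotient.mk r ⟨H y', hX⟩) = Quotient.mk s ⟨y', hY⟩) ∧
      ∀ w w' : W, ωV (fderiv ℂ H y w) (fderiv ℂ H y w') = ωW w w'

end QuotVar

namespace Instanton

/-! ## Strongly semisimple matrices -/

/-- Index set of the rows and columns of `(k+1) × (k+1)` matrices, with the last index split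
off. -/
abbrev Idx (k : ℕ) : Type := Fin k ⊕ Unit

/-- Regular semisimple: diagonalisable with distinct eigenvalues. -/
def IsRegularSemisimple {n : Type*} [Fintype n] [DecidableEq n] (M : Matrix n n ℂ) : Prop :=
  ∃ (g : GL n ℂ) (d : n → ℂ), Function.Injective d ∧ g.val * M * g⁻¹.val = diagonal d

/-- The inclusion of `gl(k)` into `gl(k+1)` as upper-left block. -/
def incl {k : ℕ} (X : Matrix (Fin k) (Fin k) ℂ) : Matrix (Idx k) (Idx k) ℂ := fromBlocks X 0 0 0

/-- The dimension of the orbit of `M` under conjugation by the subgroup `GL(k)` of `GL(k+1)`,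
i.e. of its tangent space `{[X, M] : X ∈ gl(k)}`. -/
def orbitDim {k : ℕ} (M : Matrix (Idx k) (Idx k) ℂ) : ℕ :=
  Module.finrank ℂ (Submodule.span ℂ
    (Set.range fun X : Matrix (Fin k) (Fin k) ℂ => incl X * M - M * incl X))

/-- `G`-regular: the orbit under `G = GL(k)` has maximal dimension. -/
def IsGRegular {k : ℕ} (M : Matrix (Idx k) (Idx k) ℂ) : Prop :=
  ∀ M' : Matrix (Idx k) (Idx k) ℂ, orbitDim M' ≤ orbitDim M

/-- `M` is `G`-regular, and no eigenvector `v` of its upper-left `k × k` block gives an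
eigenvector `(v, 0)` of `M` with the same eigenvalue. -/
def IsGZero {k : ℕ} (M : Matrix (Idx k) (Idx k) ℂ) : Prop :=
  IsGRegular M ∧ ∀ (c : ℂ) (v : Fin k → ℂ), v ≠ 0 → M.toBlocks₁₁ *ᵥ v = c • v →
    M *ᵥ (Sum.elim v 0) ≠ c • (Sum.elim v 0 : Idx k → ℂ)

/-- Strongly semisimple matrices. -/
def IsStronglySemisimple {k : ℕ} (M : Matrix (Idx k) (Idx k) ℂ) : Prop :=
  IsGZero M ∧ IsRegularSemisimple M.toBlocks₁₁ ∧ IsRegularSemisimple M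

/-! ## The instanton side -/

/-- The vector space `T^*R_k` of quadruples `(A, B, i, j)`. -/
abbrev Quad (k : ℕ) : Type :=
  Matrix (Fin k) (Fin k) ℂ × Matrix (Fin k) (Fin k) ℂ ×
    Matrix (Fin k) (Fin 2) ℂ × Matrix (Fin 2) (Fin k) ℂ

/-- The vector space `T^*R_k × ℂ²`. -/
abbrev Ambient (k : ℕ) : Type := Quad k × (ℂ × ℂ)

variable {k : ℕ}

abbrev matA (x : Ambient k) : Matrix (Fin k) (Fin k) ℂ := x.1.1
abbrev matB (x : Ambient k) : Matrix (Fin k) (Fin k) ℂ := x.1.2.1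
abbrev matI (x : Ambient k) : Matrix (Fin k) (Fin 2) ℂ := x.1.2.2.1
abbrev matJ (x : Ambient k) : Matrix (Fin 2) (Fin k) ℂ := x.1.2.2.2

/-- The matrix with rows `(A, i₁)` and `(j₂, z₁)`. -/
def hatA (x : Ambient k) : Matrix (Idx k) (Idx k) ℂ :=
  fromBlocks (matA x) (of fun a _ => matI x a 0) (of fun _ b => matJ x 1 b) (of fun _ _ => x.2.1)

/-- The matrix with rows `(B, i₂)` and `(-j₁, z₂)`. -/
def hatB (x : Ambient k) : Matrix (Idx k) (Idx k) ℂ :=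
  fromBlocks (matB x) (of fun a _ => matI x a 1) (of fun _ b => -matJ x 0 b)
    (of fun _ _ => x.2.2)

/-- The symplectic form `tr dA ∧ dB + tr dj ∧ di + dz₁ ∧ dz₂`. -/
def omega (v w : Ambient k) : ℂ :=
  (trace (matA v * matB w) - trace (matA w * matB v)) +
    (trace (matJ v * matI w) - trace (matJ w * matI v)) + (v.2.1 * w.2.2 - w.2.1 * v.2.2)

/-- The action of `GL(k)`, trivial on `ℂ²`. -/
def act (L : GL (Fin k) ℂ) (x : Ambient k) : Ambient k :=
  ((L.val * matA x * L⁻¹.val, L.val * matB x * L⁻¹.val, L.val * matI x, matJ x * L⁻¹.val), x.2)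

theorem act_one (x : Ambient k) : act 1 x = x := by
  simp [act]

theorem act_mul (L M : GL (Fin k) ℂ) (x : Ambient k) : act (L * M) x = act L (act M x) := by
  simp [act, matA, matB, matJ, Matrix.mul_assoc, _root_.mul_inv_rev]

/-- Lying in the same `GL(k)`-orbit, for points of a subset `X`. -/
def orbitRel (X : Set (Ambient k)) : Setoid X where
  r x x' := ∃ L : GL (Fin k) ℂ, act L x = x'
  iseqv :=
    { refl := fun x => ⟨1, act_one _⟩
      symm := by
        rintro x x' ⟨L, h⟩
        exact ⟨L⁻¹, by rw [← h, ← act_mul, inv_mul_cancel, act_one]⟩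
      trans := by
        rintro x x' x'' ⟨L, h⟩ ⟨M, h'⟩
        exact ⟨M * L, by rw [act_mul, h, h']⟩ }

variable (k)

/-- `μ⁻¹(τ · 1) × ℂ²`, where `μ(A, B, i, j) = [A, B] - i j`. -/
def level (τ : ℂ) : Set (Ambient k) :=
  {x | matA x * matB x - matB x * matA x - matI x * matJ x = τ • (1 : Matrix (Fin k) (Fin k) ℂ)}

/-- The points of `μ⁻¹(τ · 1) × ℂ²` with strongly semisimple `hatA`. -/
def regLevel (τ : ℂ) : Set (Ambient k) := {x | x ∈ level k τ ∧ IsStronglySemisimple (hatA x)}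

/-- The space of `GL(k)`-orbits in `μ⁻¹(τ · 1) × ℂ²` with strongly semisimple `hatA`. -/
abbrev NReg (τ : ℂ) : Type := Quotient (orbitRel (regLevel k τ))

/-! ## The coordinate side -/

/-- `T^*𝔥_k × T^*𝔥_{k+1}`, with coordinates `((λ, μ), (λ̂, μ̂))`. -/
abbrev CoordSpace : Type := ((Fin k → ℂ) × (Fin k → ℂ)) × ((Idx k → ℂ) × (Idx k → ℂ))

variable {k}

abbrev lam (y : CoordSpace k) : Fin k → ℂ := y.1.1
abbrev mu (y : CoordSpace k) : Fin k → ℂ := y.1.2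
abbrev lamHat (y : CoordSpace k) : Idx k → ℂ := y.2.1
abbrev muHat (y : CoordSpace k) : Idx k → ℂ := y.2.2

/-- The symplectic form `∑ dλᵢ ∧ dμᵢ + ∑ dλ̂ⱼ ∧ dμ̂ⱼ`. -/
def omegaCoord (v w : CoordSpace k) : ℂ :=
  (∑ a, (lam v a * mu w a - lam w a * mu v a)) +
    ∑ b, (lamHat v b * muHat w b - lamHat w b * muHat v b)

variable (k)

/-- `T^*𝔥_k^reg × T^*𝔥_{k+1}^reg`: the `λᵢ` are distinct, and the `λ̂ⱼ` are distinct. -/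
def coordReg : Set (CoordSpace k) :=
  {y | Function.Injective (lam y) ∧ Function.Injective (lamHat y)}

/-- The orbit relation of `S_k × S_{k+1}`. -/
def permRel : Setoid (coordReg k) where
  r y y' := ∃ (σ : Equiv.Perm (Fin k)) (ρ : Equiv.Perm (Idx k)),
    (((lam y.1 ∘ σ, mu y.1 ∘ σ), (lamHat y.1 ∘ ρ, muHat y.1 ∘ ρ)) : CoordSpace k) = y'.1
  iseqv :=
    { refl := fun y => ⟨1, 1, rfl⟩
      symm := by
        rintro ⟨y, hy⟩ ⟨y', hy'⟩ ⟨σ, ρ, rfl⟩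
        refine ⟨σ⁻¹, ρ⁻¹, ?_⟩
        ext <;> simp [lam, mu, lamHat, muHat]
      trans := by
        rintro ⟨y, hy⟩ ⟨y', hy'⟩ ⟨y'', hy''⟩ ⟨σ, ρ, rfl⟩ ⟨σ', ρ', rfl⟩
        exact ⟨σ * σ', ρ * ρ', rfl⟩ }

/-- `(T^*𝔥_k^reg × T^*𝔥_{k+1}^reg) / (S_k × S_{k+1})`. -/
abbrev CoordQuot : Type := Quotient (permRel k)

/-- The matrix `diag(τ, …, τ, -kτ)`. -/
def tauHat (τ : ℂ) : Matrix (Idx k) (Idx k) ℂ :=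
  diagonal (Sum.elim (fun _ => τ) (fun _ => -((k : ℂ) * τ)))

variable {k}

/-- `y = (λ, μ, λ̂, μ̂)` are the coordinates of `x`, for some ordering of the eigenvalues:
`hatB = B₁ + B₂` with `B₁ ∈ gl(k)`, `[A, B₁] = 0`, and `[hatA, B₂]` equal to `tauHat` up to the
first `k` entries of the last column; the `λᵢ` and `μᵢ` are the simultaneous eigenvalues of `A`
and `B₁`, the `λ̂ⱼ` are the eigenvalues of `hatA`, and the `μ̂ⱼ` are the diagonal entries of `B₂`
in an eigenbasis of `hatA`. -/
def IsCoord (τ : ℂ) (x : Ambient k) (y : CoordSpace k) : Prop :=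
  ∃ (B₁ : Matrix (Fin k) (Fin k) ℂ) (B₂ : Matrix (Idx k) (Idx k) ℂ)
    (u : Matrix (Fin k) Unit ℂ) (h : GL (Fin k) ℂ) (g : GL (Idx k) ℂ),
    hatB x = incl B₁ + B₂ ∧
    matA x * B₁ - B₁ * matA x = 0 ∧
    hatA x * B₂ - B₂ * hatA x = tauHat k τ + fromBlocks 0 u 0 0 ∧
    h.val * matA x * h⁻¹.val = diagonal (lam y) ∧
    h.val * B₁ * h⁻¹.val = diagonal (mu y) ∧
    g.val * hatA x * g⁻¹.val = diagonal (lamHat y) ∧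
    ∀ b, (g.val * B₂ * g⁻¹.val) b b = muHat y b

end Instanton

end

/-!
The coordinates are inverted explicitly by a normal form.

Strong semisimplicity of `hatA` means that `A` and `hatA` have distinct eigenvalues and that the row
`j₂` vanishes on no eigenvector of `A` (`isStronglySemisimple_hatA_iff`). The eigenvectors of `A`
can therefore be scaled so that `A = diag(λ)` and `j₂ = (1, …, 1)`, which uses up the freedom in
`GL(k)` except for the order of the `λᵢ`.
The eigenvectors of such a `hatA` have nonzero last entry; normalising it to `1`, Lagrange
interpolation gives the matrix `P` of eigenvectors and its inverse as rational functions of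
`λ` and `λ̂` (`eigP`, `eigG`, `eigG_mul_eigP`), and so `hatA = P diag(λ̂) P⁻¹`. The commutator
`C = [hatA, B₂]` is `diag(τ, …, τ, -kτ)` up to its last column, and as it has zero diagonal in an
eigenbasis of `hatA`, the last column is determined. Then `B₂` is determined by its diagonal `μ̂` in
the eigenbasis, and `hatB = diag(μ) + B₂`. This is the normal form `sec`; every point with given
coordinates lies in its orbit (`IsCoord.exists_act_sec`), every point has coordinates
(`exists_isCoord`), and they are unique up to permutations (`IsCoord.unique`). Hence the map `π`
exists and is bijective (`exists_coordMap`).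

For the isomorphism of varieties, `sec` is regular, and what remains is that polynomials in the
coordinates invariant under `S_k × S_{k+1}` are regular functions of the point
(`IsAlgIso.of_section`, where a local quotient of polynomials is made invariant by averaging).
Invariant polynomials are averages of monomials, and these are polynomials in the power sums
`∑ λᵢ^m μᵢ^n` and `∑ λ̂ⱼ^m μ̂ⱼ^n` (`sum_embedding_mem`). The power sums are the traces of
`A^m B₁^n` and of `hatA^m D^n`, where `D` is the part of `B₂` that is diagonal in the eigenbasis of
`hatA`. Both `B₁` and `D` are polynomials in `A` and `hatA` with coefficients that depend rationally
on the point (`matB₁`, `diagB₂`).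

The symplectic form is `tr d(hatA) ∧ d(hatB)`. On the normal form the summand `diag(μ)` of `hatB`
contributes `∑ dλᵢ ∧ dμᵢ`. For the summand `B₂` one writes `d(hatA) = P diag(dλ̂) P⁻¹ + [ψ, hatA]`
and likewise for `B₂`, with `ψ = dP P⁻¹`; the result is `∑ dλ̂ⱼ ∧ dμ̂ⱼ` up to traces of `ψ` against
`C` and `dC` (`trace_symplectic`). These vanish, because the last row of `P` is constant, so that
the last row of `ψ` is zero, while `C` is a scalar matrix up to its last column.

If a point lies in the closure of an orbit, the limit of suitably rescaled group elements gives a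
nonzero intertwiner to that point (`exists_intertwiner`), and looking at its kernel and image shows
that the orbit is closed unless `τ = 0` and `A`, `hatA` share an eigenvalue (`isClosed_orbit`). In
the remaining case a one-parameter subgroup has a limit outside the orbit
(`not_isClosed_orbit_sec`).
-/

noncomputable section

/-! ### Polynomial functions, the Zariski topology and globally regular functions -/

namespace QuotVar

variable {V W : Type*} [AddCommGroup V] [Module ℂ V] [AddCommGroup W] [Module ℂ W]

theorem dual_mem_polyFun (φ : Module.Dual ℂ V) : (φ : V → ℂ) ∈ polyFun V :=
  Algebra.subset_adjoin ⟨φ, rfl⟩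

theorem comp_linearMap_mem_polyFun (T : V →ₗ[ℂ] W) {p : W → ℂ} (hp : p ∈ polyFun W) :
    p ∘ T ∈ polyFun V := by
  induction hp using Algebra.adjoin_induction with
  | mem p h => obtain ⟨φ, rfl⟩ := h; exact dual_mem_polyFun (φ ∘ₗ T)
  | algebraMap c => exact (polyFun V).algebraMap_mem c
  | add p q _ _ hp hq => exact (polyFun V).add_mem hp hq
  | mul p q _ _ hp hq => exact (polyFun V).mul_mem hp hq

/-- A set is Zariski-open if it contains a principal open neighbourhood of each of its points: the
principal open sets are a basis, being stable under intersection. -/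
theorem isOpen_zariski_iff {U : Set V} :
    IsOpen[zariski V] U ↔ ∀ v ∈ U, ∃ p ∈ polyFun V, p v ≠ 0 ∧ ∀ w, p w ≠ 0 → w ∈ U := by
  have basis : @TopologicalSpace.IsTopologicalBasis V (zariski V)
      {U | ∃ p ∈ polyFun V, U = {v : V | p v ≠ 0}} :=
    letI := zariski V
    { exists_subset_inter := by
        rintro _ ⟨p, hp, rfl⟩ _ ⟨q, hq, rfl⟩ v ⟨hpv, hqv⟩
        refine ⟨_, ⟨p * q, mul_mem hp hq, rfl⟩, mul_ne_zero hpv hqv, fun w hw => ?_⟩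
        exact mul_ne_zero_iff.1 hw
      sUnion_eq := Set.eq_univ_of_forall fun v =>
        ⟨_, ⟨1, one_mem _, rfl⟩, by simp⟩
      eq_generateFrom := rfl }
  constructor
  · intro h v hv
    obtain ⟨_, ⟨p, hp, rfl⟩, hpv, hs⟩ :=
      (@TopologicalSpace.IsTopologicalBasis.isOpen_iff _ (zariski V) _ _ basis).1 h v hv
    exact ⟨p, hp, hpv, fun w hw => hs hw⟩
  · intro h
    refine (@TopologicalSpace.IsTopologicalBasis.isOpen_iff _ (zariski V) _ _ basis).2
      fun v hv => ?_
    obtain ⟨p, hp, hpv, hs⟩ := h v hv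
    exact ⟨_, ⟨p, hp, rfl⟩, hpv, fun w hw => hs w hw⟩

theorem isOpen_zariskiQuot_iff {X : Set V} (r : Setoid X) {U : Set (Quotient r)} :
    IsOpen[zariskiQuot r] U ↔ ∀ x : X, Quotient.mk r x ∈ U →
      ∃ p ∈ polyFun V, p x ≠ 0 ∧ ∀ x' : X, p x' ≠ 0 → Quotient.mk r x' ∈ U := by
  change IsOpen[TopologicalSpace.induced (Subtype.val : X → V) (zariski V)]
    (Quotient.mk r ⁻¹' U) ↔ _
  rw [@isOpen_induced_iff _ _ (zariski V)]
  constructor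
  · rintro ⟨O, hO, hU⟩ x hx
    have hx' : (x : V) ∈ O := by
      rw [← Set.mem_preimage, hU]; exact hx
    obtain ⟨p, hp, hpx, h⟩ := isOpen_zariski_iff.1 hO x hx'
    refine ⟨p, hp, hpx, fun x' hx' => ?_⟩
    have : x' ∈ Subtype.val ⁻¹' O := h _ hx'
    rw [hU] at this
    exact this
  · intro h
    refine ⟨{v | ∃ p ∈ polyFun V, p v ≠ 0 ∧ ∀ x' : X, p x' ≠ 0 → Quotient.mk r x' ∈ U}, ?_, ?_⟩
    · rw [isOpen_zariski_iff]
      rintro v ⟨p, hp, hpv, hpU⟩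
      exact ⟨p, hp, hpv, fun w hw => ⟨p, hp, hw, hpU⟩⟩
    · ext x
      exact ⟨fun ⟨p, hp, hpx, hpU⟩ => hpU x hpx, fun hx => h x hx⟩

/-- A polynomial function separating a point from a finite set not containing it. -/
theorem exists_polyFun_separating (F : Finset V) (v : V) (hv : v ∉ F) :
    ∃ p ∈ polyFun V, p v = 1 ∧ ∀ w ∈ F, p w = 0 := by
  have key : ∀ w ∈ F, ∃ p ∈ polyFun V, p v = 1 ∧ p w = 0 := by
    intro w hw
    have hne : v - w ≠ 0 := sub_ne_zero.2 fun h => hv (h ▸ hw)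
    obtain ⟨φ, hφ⟩ : ∃ φ : Module.Dual ℂ V, φ (v - w) ≠ 0 := by
      by_contra! h
      exact hne ((Module.forall_dual_apply_eq_zero_iff ℂ _).1 h)
    refine ⟨algebraMap ℂ (V → ℂ) (φ (v - w))⁻¹ * (φ - algebraMap ℂ (V → ℂ) (φ w)),
      mul_mem ((polyFun V).algebraMap_mem _) (sub_mem (dual_mem_polyFun φ)
        ((polyFun V).algebraMap_mem _)), ?_, ?_⟩
    · simp only [Pi.mul_apply, Pi.sub_apply, Pi.algebraMap_apply, Algebra.algebraMap_self,
        RingHom.id_apply]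
      rw [← map_sub, inv_mul_cancel₀ hφ]
    · simp
  choose! p hp h1 h0 using key
  refine ⟨∏ w ∈ F, p w, prod_mem hp, ?_, fun w hw => ?_⟩
  · rw [Finset.prod_apply]; exact Finset.prod_eq_one h1
  · rw [Finset.prod_apply]; exact Finset.prod_eq_zero hw (h0 w hw)

/-- The functions on `X` that are globally a quotient of two polynomials, the denominator having
no zero on `X`. -/
def regFun (X : Set V) : Subalgebra ℂ (X → ℂ) where
  carrier := {f | ∃ p ∈ polyFun V, ∃ q ∈ polyFun V, ∀ x : X, q x ≠ 0 ∧ f x = p x / q x}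
  mul_mem' := by
    rintro f g ⟨p, hp, q, hq, h⟩ ⟨p', hp', q', hq', h'⟩
    refine ⟨p * p', mul_mem hp hp', q * q', mul_mem hq hq', fun x => ?_⟩
    refine ⟨mul_ne_zero (h x).1 (h' x).1, ?_⟩
    simp [(h x).2, (h' x).2, div_mul_div_comm]
  add_mem' := by
    rintro f g ⟨p, hp, q, hq, h⟩ ⟨p', hp', q', hq', h'⟩
    refine ⟨p * q' + q * p', add_mem (mul_mem hp hq') (mul_mem hq hp'), q * q', mul_mem hq hq',
      fun x => ⟨mul_ne_zero (h x).1 (h' x).1, ?_⟩⟩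
    simp [(h x).2, (h' x).2, div_add_div _ _ (h x).1 (h' x).1]
  algebraMap_mem' c :=
    ⟨_, (polyFun V).algebraMap_mem c, 1, one_mem _, fun x => by simp⟩

variable {X : Set V} {Y : Set W}

theorem restrict_mem_regFun {p : V → ℂ} (hp : p ∈ polyFun V) : (fun x : X => p x) ∈ regFun X :=
  ⟨p, hp, 1, one_mem _, fun x => by simp⟩

theorem linear_mem_regFun (φ : V →ₗ[ℂ] ℂ) : (fun x : X => φ x) ∈ regFun X :=
  restrict_mem_regFun (dual_mem_polyFun φ)

theorem const_mem_regFun (c : ℂ) : (fun _ : X => c) ∈ regFun X := (regFun X).algebraMap_mem c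

theorem inv_mem_regFun {f : X → ℂ} (hf : f ∈ regFun X) (h0 : ∀ x, f x ≠ 0) :
    (fun x => (f x)⁻¹) ∈ regFun X := by
  obtain ⟨p, hp, q, hq, h⟩ := hf
  refine ⟨q, hq, p, hp, fun x => ⟨fun hpx => h0 x ?_, ?_⟩⟩
  · rw [(h x).2, hpx, zero_div]
  · simp [(h x).2]

theorem div_mem_regFun {f g : X → ℂ} (hf : f ∈ regFun X) (hg : g ∈ regFun X)
    (h0 : ∀ x, g x ≠ 0) : (fun x => f x / g x) ∈ regFun X := by
  simp only [div_eq_mul_inv]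
  exact mul_mem hf (inv_mem_regFun hg h0)

theorem prod_mem_regFun {ι : Type*} (s : Finset ι) {f : ι → X → ℂ}
    (hf : ∀ i ∈ s, f i ∈ regFun X) : (fun x => ∏ i ∈ s, f i x) ∈ regFun X := by
  simpa [← Finset.prod_apply] using prod_mem hf

/-- Polynomials pull back to regular functions along a map with regular components. -/
theorem comp_mem_regFun {s : Y → V} (hs : ∀ φ : Module.Dual ℂ V, (fun y => φ (s y)) ∈ regFun Y)
    {p : V → ℂ} (hp : p ∈ polyFun V) : (fun y => p (s y)) ∈ regFun Y := by
  induction hp using Algebra.adjoin_induction with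
  | mem p h => obtain ⟨φ, rfl⟩ := h; exact hs φ
  | algebraMap c => exact (regFun Y).algebraMap_mem c
  | add p q _ _ hp hq => exact (regFun Y).add_mem hp hq
  | mul p q _ _ hp hq => exact (regFun Y).mul_mem hp hq

/-- Localised averaging over a finite group of linear maps `T γ`: multiply by a polynomial that is
`1` at `y₀` and `0` at the other points of its orbit, then sum over the group. The result is
invariant, does not vanish at `y₀` if the given function does not, and the operation is linear over
invariant functions. -/
theorem exists_averaging {Γ : Type*} [Fintype Γ] [Group Γ] (T : Γ → W →ₗ[ℂ] W)
    (hone : T 1 = LinearMap.id) (hmul : ∀ a b, T (a * b) = T b ∘ₗ T a) (y₀ : W) :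
    ∃ Av : (W → ℂ) → W → ℂ, (∀ p ∈ polyFun W, Av p ∈ polyFun W) ∧
      (∀ p γ y, Av p (T γ y) = Av p y) ∧ (∀ p, p y₀ ≠ 0 → Av p y₀ ≠ 0) ∧
      ∀ D : Set W, (∀ γ, ∀ y ∈ D, T γ y ∈ D) → ∀ f : W → ℂ,
        (∀ γ, ∀ y ∈ D, f (T γ y) = f y) → ∀ p q : W → ℂ, (∀ y ∈ D, f y * q y = p y) →
          ∀ y ∈ D, f y * Av q y = Av p y := by
  classical
  obtain ⟨t, ht, ht1, ht0⟩ := exists_polyFun_separating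
    ((Finset.univ.image fun γ => T γ y₀).erase y₀) y₀ (by simp)
  refine ⟨fun p => ∑ γ, (t * p) ∘ T γ, fun p hp =>
    sum_mem fun γ _ => comp_linearMap_mem_polyFun _ (mul_mem ht hp), ?_, ?_, ?_⟩
  · intro u γ y
    simp only [Finset.sum_apply, Function.comp_apply]
    refine Fintype.sum_equiv (Equiv.mulLeft γ) _ _ fun δ => ?_
    simp [hmul]
  · intro q hq₀
    have : ∀ γ, ((t * q) ∘ T γ) y₀ = if T γ y₀ = y₀ then q y₀ else 0 := by
      intro γ
      split_ifs with h
      · simp [h, ht1]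
      · have := ht0 (T γ y₀) (by simp [h])
        simp [this]
    simp only [Finset.sum_apply]
    rw [Finset.sum_congr rfl fun γ _ => this γ, ← Finset.sum_filter,
      Finset.sum_const, nsmul_eq_mul]
    refine mul_ne_zero (Nat.cast_ne_zero.2 (Finset.card_ne_zero_of_mem (a := 1) ?_)) hq₀
    simp [hone]
  · intro D hD f hf p q hpq y hy
    simp only [Finset.sum_apply, Function.comp_apply, Finset.mul_sum, Pi.mul_apply]
    refine Finset.sum_congr rfl fun γ _ => ?_
    rw [← hpq _ (hD γ y hy), hf γ y hy]
    ring

/-- Criterion for an isomorphism onto the quotient of `Y` by a finite group: a bijection `π` with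
a section that has regular components, along which invariant polynomials pull back to regular
functions. -/
theorem IsAlgIso.of_section {Γ : Type*} [Fintype Γ] [Group Γ] (T : Γ → W →ₗ[ℂ] W)
    (hone : T 1 = LinearMap.id) (hmul : ∀ a b, T (a * b) = T b ∘ₗ T a)
    (r : Setoid X) (s : Setoid Y) (hTY : ∀ γ, ∀ y ∈ Y, T γ y ∈ Y)
    (hs : ∀ y y' : Y, s y y' ↔ ∃ γ, T γ y = y')
    {π : Quotient r → Quotient s} (hπ : Function.Bijective π) (σ : Y → X)
    (hσ : ∀ y, π (Quotient.mk r (σ y)) = Quotient.mk s y)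
    (hreg : ∀ φ : Module.Dual ℂ V, (fun y => φ (σ y)) ∈ regFun Y)
    (hinv : ∀ P ∈ polyFun W, (∀ γ y, P (T γ y) = P y) → ∃ R ∈ regFun X, ∀ (x : X) (y : Y),
      π (Quotient.mk r x) = Quotient.mk s y → R x = P y) :
    IsAlgIso r s π := by
  have lift : ∀ x : X, ∃ y : Y, π (Quotient.mk r x) = Quotient.mk s y := fun x =>
    ⟨_, (Quotient.out_eq _).symm⟩
  have hTs : ∀ γ (y : Y), Quotient.mk s ⟨T γ y, hTY γ y y.2⟩ = Quotient.mk s y := fun γ y =>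
    (Quotient.sound ((hs _ _).2 ⟨γ, rfl⟩)).symm
  refine ⟨hπ, fun U => ?_, fun U hU f => ?_⟩
  · rw [isOpen_zariskiQuot_iff, isOpen_zariskiQuot_iff]
    constructor
    · intro h x hx
      obtain ⟨y, hy⟩ := lift x
      rw [Set.mem_preimage, hy] at hx
      obtain ⟨q, hq, hqy, hqU⟩ := h y hx
      obtain ⟨Av, hpoly, hAinv, hA0, hAD⟩ := exists_averaging T hone hmul (y : W)
      obtain ⟨R, ⟨a, ha, b, hb, hR⟩, hRP⟩ := hinv _ (hpoly q hq) (hAinv q)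
      refine ⟨a, ha, ?_, fun x' hx' => ?_⟩
      · have h1 := hRP x y hy
        rw [(hR x).2] at h1
        intro h0
        rw [h0, zero_div] at h1
        exact hA0 q hqy h1.symm
      · obtain ⟨y', hy'⟩ := lift x'
        rw [Set.mem_preimage, hy']
        by_contra hU
        -- The average of `q` vanishes wherever `q` vanishes on an invariant set.
        have h1 := hAD {z | ∃ h : z ∈ Y, Quotient.mk s ⟨z, h⟩ ∉ U}
          (by rintro γ z ⟨h1, h2⟩; exact ⟨hTY γ z h1, by rwa [hTs γ ⟨z, h1⟩]⟩)
          (fun _ => 0) (fun _ _ _ => rfl) q 0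
          (by
            rintro z ⟨h1, h2⟩
            by_contra hne
            exact h2 (hqU ⟨z, h1⟩ fun h0 => hne (by simp [h0])))
          y' ⟨y'.2, hU⟩
        have h2 := hRP x' y' hy'
        rw [(hR x').2, ← h1, zero_mul, div_eq_zero_iff] at h2
        exact h2.elim hx' (hR x').1
    · intro h y hy
      obtain ⟨p, hp, hpy, hpU⟩ := h (σ y) (by rwa [Set.mem_preimage, hσ])
      obtain ⟨a, ha, b, hb, hab⟩ := comp_mem_regFun hreg hp
      replace hab : ∀ y : Y, b y ≠ 0 ∧ p (σ y) = a y / b y := hab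
      refine ⟨a, ha, fun h0 => hpy ?_, fun y' hy' => ?_⟩
      · rw [(hab y).2, h0, zero_div]
      · have := hpU (σ y') (by rw [(hab y').2]; exact div_ne_zero hy' (hab y').1)
        rwa [Set.mem_preimage, hσ] at this
  · constructor
    · intro h x hx
      obtain ⟨y, hy⟩ := lift x
      rw [Set.mem_preimage, hy] at hx
      obtain ⟨p, hp, q, hq, hqy, hpq⟩ := h y hx
      obtain ⟨Av, hpoly, hAinv, hA0, hAD⟩ := exists_averaging T hone hmul (y : W)
      obtain ⟨R, ⟨a, ha, b, hb, hR⟩, hRP⟩ := hinv _ (hpoly _ (mul_mem hp hq)) (hAinv _)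
      obtain ⟨R', ⟨a', ha', b', hb', hR'⟩, hRQ⟩ := hinv _ (hpoly _ (mul_mem hq hq)) (hAinv _)
      classical
      -- The relation `f * q ^ 2 = p * q` also holds where `q` vanishes.
      have key := hAD {z | ∃ h : z ∈ Y, Quotient.mk s ⟨z, h⟩ ∈ U}
        (by rintro γ z ⟨h1, h2⟩; exact ⟨hTY γ z h1, by rwa [hTs γ ⟨z, h1⟩]⟩)
        (fun z => if hz : z ∈ Y then f (Quotient.mk s ⟨z, hz⟩) else 0)
        (by
          rintro γ z ⟨h1, h2⟩
          simp only [h1, hTY γ z h1, dif_pos]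
          rw [hTs γ ⟨z, h1⟩])
        (p * q) (q * q)
        (by
          rintro z ⟨h1, h2⟩
          simp only [h1, dif_pos, Pi.mul_apply]
          by_cases h0 : q z = 0
          · simp [h0]
          · rw [hpq ⟨z, h1⟩ h2 h0]
            field_simp)
      refine ⟨a * b', mul_mem ha hb', a' * b, mul_mem ha' hb, ?_, fun x' hx' hne => ?_⟩
      · refine mul_ne_zero (fun h0 => ?_) (hR x).1
        have h1 := hRQ x y hy
        rw [(hR' x).2, h0, zero_div] at h1
        exact hA0 _ (mul_ne_zero hqy hqy) h1.symm
      · obtain ⟨y', hy'⟩ := lift x'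
        rw [Set.mem_preimage, hy'] at hx'
        have h1 := key y' ⟨y'.2, hx'⟩
        simp only [y'.2, dif_pos] at h1
        rw [← hRP x' y' hy', ← hRQ x' y' hy', (hR x').2, (hR' x').2] at h1
        have hb := (hR x').1
        have hb' := (hR' x').1
        have ha' := left_ne_zero_of_mul hne
        rw [Function.comp_apply, hy']
        simp only [Pi.mul_apply]
        field_simp at h1 ⊢
        linear_combination h1
    · intro h y hy
      obtain ⟨p, hp, q, hq, hqy, hpq⟩ := h (σ y) (by rwa [Set.mem_preimage, hσ])
      obtain ⟨a, ha, b, hb, hab⟩ := comp_mem_regFun hreg hp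
      replace hab : ∀ y : Y, b y ≠ 0 ∧ p (σ y) = a y / b y := hab
      obtain ⟨a', ha', b', hb', hab'⟩ := comp_mem_regFun hreg hq
      replace hab' : ∀ y : Y, b' y ≠ 0 ∧ q (σ y) = a' y / b' y := hab'
      refine ⟨a * b', mul_mem ha hb', a' * b, mul_mem ha' hb, ?_, fun y' hy' hne => ?_⟩
      · refine mul_ne_zero (fun h0 => hqy ?_) (hab y).1
        rw [(hab' y).2, h0, zero_div]
      · have h1 := hpq (σ y') (by rwa [Set.mem_preimage, hσ])
          (by
            rw [(hab' y').2]
            exact div_ne_zero (left_ne_zero_of_mul hne) (hab' y').1)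
        rw [Function.comp_apply, hσ, (hab y').2, (hab' y').2] at h1
        rw [h1, div_div_div_eq]
        simp only [Pi.mul_apply, mul_comm]

end QuotVar

/-! ### Matrices with entries in an algebra of functions -/

namespace QuotVar

variable {X : Type*} {S : Subalgebra ℂ (X → ℂ)}

/-- All entries of the matrix-valued function `F` lie in the algebra of functions `S`. -/
def EntriesIn {m n : Type*} (S : Subalgebra ℂ (X → ℂ)) (F : X → Matrix m n ℂ) : Prop :=
  ∀ i j, (fun x => F x i j) ∈ S

theorem EntriesIn.mul {l m n : Type*} [Fintype m] {F : X → Matrix l m ℂ}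
    {G : X → Matrix m n ℂ} (hF : EntriesIn S F)
    (hG : EntriesIn S G) : EntriesIn S fun x => F x * G x := by
  intro i j
  have := sum_mem (t := Finset.univ) (S := S) fun a _ => S.mul_mem (hF i a) (hG a j)
  convert this using 1
  ext x
  simp [Matrix.mul_apply]

theorem EntriesIn.pow {n : Type*} [Fintype n] [DecidableEq n] {F : X → Matrix n n ℂ}
    (hF : EntriesIn S F) (r : ℕ) :
    EntriesIn S fun x => F x ^ r := by
  induction r with
  | zero =>
    intro i j
    simp only [pow_zero]
    exact S.algebraMap_mem _
  | succ r ih => simpa only [pow_succ] using ih.mul hF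

theorem EntriesIn.trace {n : Type*} [Fintype n] {F : X → Matrix n n ℂ} (hF : EntriesIn S F) :
    (fun x => (F x).trace) ∈ S := by
  have := sum_mem (t := Finset.univ) (S := S) fun a _ => hF a a
  convert this using 1
  ext x
  simp [Matrix.trace]

theorem EntriesIn.det {n : Type*} [Fintype n] [DecidableEq n] {F : X → Matrix n n ℂ}
    (hF : EntriesIn S F) :
    (fun x => (F x).det) ∈ S := by
  have := sum_mem (t := Finset.univ) (S := S) fun (σ : Equiv.Perm n) _ =>
    S.mul_mem (S.algebraMap_mem ((σ.sign : ℤ) : ℂ)) (prod_mem (t := Finset.univ) (S := S)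
      fun i _ => hF (σ i) i)
  convert this using 1
  ext x
  simp [Matrix.det_apply', Finset.sum_apply]

theorem EntriesIn.inv {n : Type*} [Fintype n] [DecidableEq n] {V : Type*} [AddCommGroup V]
    [Module ℂ V] {Y : Set V} {F : Y → Matrix n n ℂ}
    (hF : EntriesIn (regFun Y) F) (h0 : ∀ x, (F x).det ≠ 0) :
    EntriesIn (regFun Y) fun x => (F x)⁻¹ := by
  intro i j
  simp only [Matrix.inv_def, Ring.inverse_eq_inv, Matrix.smul_apply, smul_eq_mul]
  refine mul_mem (inv_mem_regFun hF.det h0) ?_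
  simp only [Matrix.adjugate_apply]
  refine EntriesIn.det (F := fun x => (F x).updateRow j (Pi.single i 1)) fun a b => ?_
  by_cases h : a = j
  · subst h
    simpa using const_mem_regFun (X := Y) _
  · simpa [h] using hF a b

end QuotVar

/-! ### Regular semisimple matrices -/

namespace Instanton
open QuotVar

section
variable {n : Type*} [Fintype n] [DecidableEq n]

theorem IsRegularSemisimple.of_eigenbasis {M P : Matrix n n ℂ} {d : n → ℂ}
    (hd : Function.Injective d) (hP : P.det ≠ 0) (h : M * P = P * diagonal d) :
    IsRegularSemisimple M := by
  refine ⟨(GeneralLinearGroup.mkOfDetNeZero P hP)⁻¹, d, hd, ?_⟩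
  have h1 : P⁻¹ * P = 1 := nonsing_inv_mul _ (isUnit_iff_ne_zero.2 hP)
  simp only [inv_inv]
  rw [coe_units_inv]
  change P⁻¹ * M * P = _
  rw [Matrix.mul_assoc, h, ← Matrix.mul_assoc, h1, Matrix.one_mul]

theorem pow_of_conj {M : Matrix n n ℂ} {d : n → ℂ} {g : GL n ℂ}
    (h : g.val * M * g⁻¹.val = diagonal d) (r : ℕ) :
    M ^ r = g⁻¹.val * diagonal (d ^ r) * g.val := by
  have h1 : M * g⁻¹.val = g⁻¹.val * diagonal d := by
    rw [← h]; simp [← Matrix.mul_assoc]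
  have : M ^ r * g⁻¹.val = g⁻¹.val * diagonal d ^ r := by
    induction r with
    | zero => simp
    | succ r ih => rw [pow_succ, Matrix.mul_assoc, h1, ← Matrix.mul_assoc, ih, pow_succ,
        Matrix.mul_assoc]
  rw [← diagonal_pow, ← this, Matrix.mul_assoc]
  simp

theorem trace_pow_of_conj {M N : Matrix n n ℂ} {d : n → ℂ} {e : n → ℂ} {g : GL n ℂ}
    (h : g.val * M * g⁻¹.val = diagonal d) (h' : ∀ b, (g.val * N * g⁻¹.val) b b = e b) (r : ℕ) :
    (N * M ^ r).trace = ∑ a, e a * d a ^ r := by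
  rw [pow_of_conj h, ← Matrix.mul_assoc, trace_mul_comm, ← Matrix.mul_assoc, ← Matrix.mul_assoc]
  simp only [trace, diag, mul_diagonal, h', Pi.pow_apply]

/-- The Gram matrix `tr M ^ (i + j)` of the trace form on powers of `M`; its determinant is the
discriminant of the characteristic polynomial. -/
def traceForm (M : Matrix n n ℂ) : Matrix (Fin (Fintype.card n)) (Fin (Fintype.card n)) ℂ :=
  of fun i j => (M ^ ((i : ℕ) + j)).trace

theorem traceForm_eq {M : Matrix n n ℂ} {d : n → ℂ} {g : GL n ℂ}
    (h : g.val * M * g⁻¹.val = diagonal d) :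
    traceForm M = (vandermonde (d ∘ (Fintype.equivFin n).symm))ᵀ *
      vandermonde (d ∘ (Fintype.equivFin n).symm) := by
  ext i j
  have := trace_pow_of_conj (N := 1) (e := fun _ => 1) h (by simp) (i + j)
  rw [traceForm, of_apply, ← Matrix.one_mul (M ^ _), this, Matrix.mul_apply,
    ← (Fintype.equivFin n).symm.sum_comp]
  simp [vandermonde_apply, pow_add]

/-- A matrix is regular semisimple if and only if the trace form is nondegenerate on its first
powers. If it is nondegenerate, a polynomial of degree less than `n` with nilpotent value at `M`
must vanish, so there are `n` distinct eigenvalues. -/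
theorem isRegularSemisimple_iff {M : Matrix n n ℂ} :
    IsRegularSemisimple M ↔ (traceForm M).det ≠ 0 := by
  constructor
  · rintro ⟨g, d, hd, h⟩
    rw [traceForm_eq h, det_mul, det_transpose]
    have : (vandermonde (d ∘ (Fintype.equivFin n).symm)).det ≠ 0 :=
      det_vandermonde_ne_zero_iff.2 (hd.comp (Equiv.injective _))
    exact mul_ne_zero this this
  · intro h
    set p : Polynomial ℂ := ∏ r ∈ M.charpoly.roots.toFinset, (Polynomial.X - Polynomial.C r) with hp
    have hmonic : p.Monic :=
      Polynomial.monic_prod_of_monic _ _ fun r _ => Polynomial.monic_X_sub_C r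
    have hdeg : p.natDegree = M.charpoly.roots.toFinset.card := by
      rw [hp, Polynomial.natDegree_prod_of_monic _ _ fun r _ => Polynomial.monic_X_sub_C r]
      simp
    have hdvd : M.charpoly ∣ p ^ Fintype.card n := by
      rw [(IsAlgClosed.splits M.charpoly).eq_prod_roots_of_monic M.charpoly_monic,
        Finset.prod_multiset_map_count, hp, ← Finset.prod_pow]
      refine Finset.prod_dvd_prod_of_dvd _ _ fun r _ => pow_dvd_pow _ ?_
      exact (Multiset.count_le_card _ _).trans
        ((Polynomial.card_roots' _).trans M.charpoly_natDegree_eq_dim.le)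
    have hnil : IsNilpotent (Polynomial.aeval M p) := by
      refine ⟨Fintype.card n, ?_⟩
      obtain ⟨c, hc⟩ := hdvd
      rw [← map_pow, hc, map_mul, aeval_self_charpoly, zero_mul]
    have hcard : Fintype.card n ≤ M.charpoly.roots.toFinset.card := by
      by_contra! hlt
      have hzero : (fun i : Fin (Fintype.card n) => p.coeff i) = 0 := by
        apply Matrix.eq_zero_of_mulVec_eq_zero h
        ext i
        have h1 : IsNilpotent (Polynomial.aeval M p * M ^ (i : ℕ)) :=
          (Commute.pow_right (by
            have := Polynomial.aeval_X (R := ℂ) M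
            conv_rhs => rw [← this]
            exact Commute.map (Commute.all p Polynomial.X)
              (Polynomial.aeval M)) _).isNilpotent_mul_right hnil
        have h2 := (Matrix.isNilpotent_trace_of_isNilpotent h1).eq_zero
        rw [Polynomial.aeval_eq_sum_range' (n := Fintype.card n) (by omega), Finset.sum_mul,
          trace_sum, Finset.sum_range] at h2
        rw [Pi.zero_apply, ← h2]
        simp only [mulVec, dotProduct, traceForm, of_apply]
        refine Finset.sum_congr rfl fun j _ => ?_
        rw [smul_mul_assoc, trace_smul, smul_eq_mul, ← pow_add, mul_comm, add_comm]
      have h3 : p.coeff p.natDegree = 1 := hmonic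
      have h4 := congrFun hzero ⟨p.natDegree, by omega⟩
      simp [h3] at h4
    obtain ⟨e⟩ : Nonempty (n ↪ M.charpoly.roots.toFinset) := by
      apply Function.Embedding.nonempty_of_card_le
      simpa using hcard
    have hev : ∀ a, ∃ v : n → ℂ, v ≠ 0 ∧ M *ᵥ v = (e a : ℂ) • v := by
      intro a
      have hr : M.charpoly.IsRoot (e a) := by
        have := (e a).2
        rw [Multiset.mem_toFinset, Polynomial.mem_roots'] at this
        exact this.2
      rw [Polynomial.IsRoot, eval_charpoly] at hr
      obtain ⟨v, hv, hv'⟩ := exists_mulVec_eq_zero_iff.2 hr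
      refine ⟨v, hv, ?_⟩
      rw [sub_mulVec, sub_eq_zero] at hv'
      rw [← hv']
      simp [← smul_one_eq_diagonal, smul_mulVec]
    choose v hv hv' using hev
    have hinj : Function.Injective fun a => (e a : ℂ) := Subtype.val_injective.comp e.injective
    have hli : LinearIndependent ℂ v := by
      refine Module.End.eigenvectors_linearIndependent' (Matrix.toLin' M) (fun a => (e a : ℂ))
        hinj v fun a => ?_
      rw [Module.End.hasEigenvector_iff, Module.End.mem_eigenspace_iff]
      exact ⟨by rw [toLin'_apply, hv'], hv a⟩
    refine IsRegularSemisimple.of_eigenbasis (P := (of v)ᵀ) hinj ?_ ?_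
    · rw [det_transpose]
      exact (Matrix.isUnit_iff_isUnit_det _).1 (linearIndependent_rows_iff_isUnit.1 hli) |>.ne_zero
    · ext i a
      have := congrFun (hv' a) i
      rw [mul_diagonal, transpose_apply, of_apply]
      rw [Pi.smul_apply, smul_eq_mul] at this
      rw [mul_comm, ← this]
      rfl

end

/-! ### Strongly semisimple matrices in terms of eigenvectors -/

/-- The covector `q` vanishes on no eigenvector of `A`. -/
def NoEig {n : Type*} [Fintype n] (A : Matrix n n ℂ) (q : n → ℂ) : Prop :=
  ∀ (c : ℂ) (v : n → ℂ), v ≠ 0 → A *ᵥ v = c • v → q ⬝ᵥ v ≠ 0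

theorem exists_eigenvector_mem {n : Type*} [Fintype n] [DecidableEq n] (A : Matrix n n ℂ)
    (S : Submodule ℂ (n → ℂ)) (hS : S ≠ ⊥) (hA : ∀ v ∈ S, A *ᵥ v ∈ S) :
    ∃ (c : ℂ) (v : n → ℂ), v ∈ S ∧ v ≠ 0 ∧ A *ᵥ v = c • v := by
  have : Nontrivial S := Submodule.nontrivial_iff_ne_bot.2 hS
  obtain ⟨c, hc⟩ := Module.End.exists_eigenvalue ((Matrix.toLin' A).restrict (p := S) (q := S) hA)
  obtain ⟨v, hv⟩ := hc.exists_hasEigenvector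
  refine ⟨c, v, v.2, fun h => hv.2 (Subtype.ext h), ?_⟩
  exact congrArg Subtype.val hv.apply_eq_smul

/-- If `X ≠ 0` intertwines `A` with another matrix, then `q * X = 0` exhibits an eigenvector of `A`
killed by `q`. -/
theorem NoEig.eq_zero_of_intertwines {m n : Type*} [Fintype n] [DecidableEq n] [Fintype m]
    [DecidableEq m]
    {A : Matrix n n ℂ} {q : n → ℂ} (h : NoEig A q) {X : Matrix n m ℂ} {A' : Matrix m m ℂ}
    (hX : A * X = X * A') (hq : q ᵥ* X = 0) : X = 0 := by
  by_contra hne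
  obtain ⟨c, v, ⟨w, rfl⟩, hv, hev⟩ := exists_eigenvector_mem A (LinearMap.range X.mulVecLin)
    (by
      rw [Ne, LinearMap.range_eq_bot]
      intro h0
      exact hne (Matrix.ext_of_mulVec_single fun i => by
        have h1 := LinearMap.congr_fun h0 (Pi.single i 1)
        rw [mulVecLin_apply] at h1
        rw [h1, zero_mulVec, LinearMap.zero_apply]))
    (by
      rintro _ ⟨w, rfl⟩
      exact ⟨A' *ᵥ w, by simp [hX]⟩)
  refine h c _ hv hev ?_
  rw [mulVecLin_apply, dotProduct_mulVec, hq, zero_dotProduct]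

/-- In an eigenbasis of `A`, the covector has no zero entry. -/
theorem noEig_iff {n : Type*} [Fintype n] [DecidableEq n] {A : Matrix n n ℂ} {q d : n → ℂ}
    {h : GL n ℂ} (hd : Function.Injective d) (hA : h.val * A * h⁻¹.val = diagonal d) :
    NoEig A q ↔ ∀ a, (q ᵥ* h⁻¹.val) a ≠ 0 := by
  have hA1 : A * h⁻¹.val = h⁻¹.val * diagonal d := by
    rw [← hA]; simp [← Matrix.mul_assoc]
  have hA2 : h.val * A = diagonal d * h.val := by
    rw [← hA]; simp [Matrix.mul_assoc]
  constructor
  · intro hN a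
    have := hN (d a) (h⁻¹.val *ᵥ Pi.single a 1) ?_ ?_
    · rwa [dotProduct_mulVec, dotProduct_single, mul_one] at this
    · intro h0
      have := congrArg (fun v => h.val *ᵥ v) h0
      simp only [mulVec_mulVec, Units.mul_inv, one_mulVec, mulVec_zero] at this
      simpa using congrFun this a
    · rw [mulVec_mulVec, hA1, ← mulVec_mulVec, diagonal_mulVec_single, mul_one, ← mulVec_smul]
      congr 1
      ext b
      simp [Pi.single_apply]
  · intro hq c v hv hev
    set w := h.val *ᵥ v with hw
    have hvw : v = h⁻¹.val *ᵥ w := by simp [hw]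
    have hdw : ∀ b, d b * w b = c * w b := by
      have : diagonal d *ᵥ w = c • w := by
        rw [hw, mulVec_mulVec, ← hA2, ← mulVec_mulVec, hev, mulVec_smul]
      intro b
      simpa [mulVec_diagonal] using congrFun this b
    obtain ⟨a, ha⟩ : ∃ a, w a ≠ 0 := by
      by_contra! h0
      apply hv
      rw [hvw, show w = 0 from funext h0, mulVec_zero]
    have hz : ∀ b, b ≠ a → w b = 0 := by
      intro b hb
      by_contra hwb
      exact hb (hd ((mul_right_cancel₀ hwb (hdw b)).trans (mul_right_cancel₀ ha (hdw a)).symm))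
    rw [hvw, dotProduct_mulVec, dotProduct, Finset.sum_eq_single a]
    · exact mul_ne_zero (hq a) ha
    · intro b _ hb; rw [hz b hb, mul_zero]
    · simp

variable {k : ℕ}

/-- The matrix with rows `q, q A, …, q A ^ (k - 1)`. -/
def krylov (A : Matrix (Fin k) (Fin k) ℂ) (q : Fin k → ℂ) : Matrix (Fin k) (Fin k) ℂ :=
  of fun r => q ᵥ* A ^ (r : ℕ)

theorem vecMul_pow_of_conj {n : Type*} [Fintype n] [DecidableEq n] {A : Matrix n n ℂ} {d : n → ℂ}
    {h : GL n ℂ} (hA : h.val * A * h⁻¹.val = diagonal d) (q : n → ℂ) (r : ℕ) (b : n) :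
    (q ᵥ* A ^ r) b = ∑ a, d a ^ r * (q ᵥ* h⁻¹.val) a * h.val a b := by
  rw [pow_of_conj hA, ← vecMul_vecMul, ← vecMul_vecMul]
  rw [vecMul, dotProduct]
  simp only [vecMul_diagonal, Pi.pow_apply]
  exact Finset.sum_congr rfl fun a _ => by ring

theorem krylov_eq {A : Matrix (Fin k) (Fin k) ℂ} {q d : Fin k → ℂ}
    {h : GL (Fin k) ℂ} (hA : h.val * A * h⁻¹.val = diagonal d) :
    krylov A q = (vandermonde d)ᵀ * diagonal (q ᵥ* h⁻¹.val) * h.val := by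
  ext r b
  rw [krylov, of_apply, vecMul_pow_of_conj hA, Matrix.mul_apply]
  simp [mul_diagonal, vandermonde_apply]

/-- For regular semisimple `A`, the nonvanishing on eigenvectors is the condition that `q` is a
cyclic covector, which is an open one. -/
theorem noEig_iff_det_krylov {A : Matrix (Fin k) (Fin k) ℂ} {q : Fin k → ℂ}
    (hA : IsRegularSemisimple A) : NoEig A q ↔ (krylov A q).det ≠ 0 := by
  obtain ⟨h, d, hd, hA⟩ := hA
  rw [noEig_iff hd hA, krylov_eq hA, det_mul, det_mul, det_transpose, det_diagonal]
  have h1 : (vandermonde d).det ≠ 0 := det_vandermonde_ne_zero_iff.2 hd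
  have h2 : h.val.det ≠ 0 := h.isUnit.map (detMonoidHom) |>.ne_zero
  simp [h1, h2, Finset.prod_eq_zero_iff]

/-! ### The pair of matrices `hatA`, `hatB` -/

/-- The quadruple with given matrices `hatA` and `hatB`. -/
def ofHat (M N : Matrix (Idx k) (Idx k) ℂ) : Ambient k :=
  ((M.toBlocks₁₁, N.toBlocks₁₁,
    of fun a c => if c = 0 then M (Sum.inl a) (Sum.inr ()) else N (Sum.inl a) (Sum.inr ()),
    of fun c b => if c = 0 then -N (Sum.inr ()) (Sum.inl b) else M (Sum.inr ()) (Sum.inl b)),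
    (M (Sum.inr ()) (Sum.inr ()), N (Sum.inr ()) (Sum.inr ())))

@[simp] theorem hatA_ofHat (M N : Matrix (Idx k) (Idx k) ℂ) : hatA (ofHat M N) = M := by
  ext (i | i) (j | j) <;> simp [hatA, ofHat, matA, matI, matJ, toBlocks₁₁]

@[simp] theorem hatB_ofHat (M N : Matrix (Idx k) (Idx k) ℂ) : hatB (ofHat M N) = N := by
  ext (i | i) (j | j) <;> simp [hatB, ofHat, matB, matI, matJ, toBlocks₁₁]

@[simp] theorem ofHat_hat (x : Ambient k) : ofHat (hatA x) (hatB x) = x := by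
  obtain ⟨⟨A, B, i, j⟩, z⟩ := x
  refine Prod.ext (Prod.ext ?_ (Prod.ext ?_ (Prod.ext ?_ ?_))) rfl
  · ext a b; rfl
  · ext a b; rfl
  · ext a c; fin_cases c <;> simp [hatA, hatB, ofHat, matI]
  · ext c b; fin_cases c <;> simp [hatA, hatB, ofHat, matJ]

theorem ext_hat {x x' : Ambient k} (hA : hatA x = hatA x') (hB : hatB x = hatB x') : x = x' := by
  rw [← ofHat_hat x, hA, hB, ofHat_hat]

/-- `hatA` as a linear map. -/
def hatALin (k : ℕ) : Ambient k →ₗ[ℂ] Matrix (Idx k) (Idx k) ℂ where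
  toFun := hatA
  map_add' x y := by ext (i | i) (j | j) <;> rfl
  map_smul' c x := by ext (i | i) (j | j) <;> rfl

/-- `hatB` as a linear map. -/
def hatBLin (k : ℕ) : Ambient k →ₗ[ℂ] Matrix (Idx k) (Idx k) ℂ where
  toFun := hatB
  map_add' x y := by ext (i | i) (j | j) <;> simp [hatB, matB, matI, matJ, add_comm]
  map_smul' c x := by ext (i | i) (j | j) <;> simp [hatB, matB, matI, matJ]

/-- The linear isomorphism sending a quadruple to its two matrices `hatA`, `hatB`. -/
def hatEquiv (k : ℕ) :
    Ambient k ≃ₗ[ℂ] Matrix (Idx k) (Idx k) ℂ × Matrix (Idx k) (Idx k) ℂ where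
  __ := (hatALin k).prod (hatBLin k)
  invFun p := ofHat p.1 p.2
  left_inv := ofHat_hat
  right_inv _ := Prod.ext (hatA_ofHat _ _) (hatB_ofHat _ _)

/-- Evaluation at an entry, as a linear functional. -/
def entryLin (m n : Type*) (i : m) (j : n) : Matrix m n ℂ →ₗ[ℂ] ℂ where
  toFun M := M i j
  map_add' _ _ := rfl
  map_smul' _ _ := rfl

/-- The symplectic form is `tr d(hatA) ∧ d(hatB)`. -/
theorem omega_eq (v w : Ambient k) :
    omega v w = (hatA v * hatB w).trace - (hatA w * hatB v).trace := by
  simp only [omega, hatA, hatB, trace, diag, Fintype.sum_sum_type,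
    fromBlocks_apply₁₁, fromBlocks_apply₂₂, fromBlocks_apply₁₂, fromBlocks_apply₂₁,
    Matrix.mul_apply, of_apply, Fin.sum_univ_two,
    Finset.sum_add_distrib, Finset.univ_unique, Finset.sum_singleton, mul_neg,
    Finset.sum_neg_distrib]
  have h1 : ∀ v w : Ambient k, ∑ a, matJ v 0 a * matI w a 0 = ∑ a, matI w a 0 * matJ v 0 a :=
    fun v w => Finset.sum_congr rfl fun a _ => mul_comm _ _
  have h2 : ∀ v w : Ambient k, ∑ a, matJ v 1 a * matI w a 1 = ∑ a, matI w a 1 * matJ v 1 a :=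
    fun v w => Finset.sum_congr rfl fun a _ => mul_comm _ _
  simp only [h1, h2]
  ring

/-- The embedding of `GL(k)` into `GL(k+1)`. -/
def blockGL (L : GL (Fin k) ℂ) : GL (Idx k) ℂ where
  val := fromBlocks L.val 0 0 1
  inv := fromBlocks L⁻¹.val 0 0 1
  val_inv := by simp [fromBlocks_multiply]
  inv_val := by simp [fromBlocks_multiply]

theorem blockGL_val (L : GL (Fin k) ℂ) : (blockGL L).val = fromBlocks L.val 0 0 1 := rfl

theorem blockGL_inv_val (L : GL (Fin k) ℂ) :
    (blockGL L)⁻¹.val = fromBlocks L⁻¹.val 0 0 1 := rfl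

/-- The action of `GL(k)` becomes conjugation on `hatA`. -/
theorem hatA_act (L : GL (Fin k) ℂ) (x : Ambient k) :
    hatA (act L x) = (blockGL L).val * hatA x * (blockGL L)⁻¹.val := by
  rw [blockGL_val, blockGL_inv_val]
  ext (i | i) (j | j) <;> simp [hatA, act, fromBlocks_multiply, matA, matI, matJ, mul_apply]

theorem hatB_act (L : GL (Fin k) ℂ) (x : Ambient k) :
    hatB (act L x) = (blockGL L).val * hatB x * (blockGL L)⁻¹.val := by
  rw [blockGL_val, blockGL_inv_val]
  ext (i | i) (j | j) <;> simp [hatB, act, fromBlocks_multiply, matB, matI, matJ, mul_apply]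

theorem incl_conj (L : GL (Fin k) ℂ) (X : Matrix (Fin k) (Fin k) ℂ) :
    incl (L.val * X * L⁻¹.val) = (blockGL L).val * incl X * (blockGL L)⁻¹.val := by
  rw [blockGL_val, blockGL_inv_val]
  simp [incl, fromBlocks_multiply]

theorem conj_tauHat (τ : ℂ) (L : GL (Fin k) ℂ) (u : Matrix (Fin k) Unit ℂ) :
    (blockGL L).val * (tauHat k τ + fromBlocks 0 u 0 0) * (blockGL L)⁻¹.val =
      tauHat k τ + fromBlocks 0 (L.val * u) 0 0 := by
  have : tauHat k τ = fromBlocks (τ • 1) 0 0 (of fun _ _ => -(k * τ)) := by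
    ext (i | i) (j | j) <;> simp [tauHat, diagonal_apply, one_apply]
  rw [blockGL_val, blockGL_inv_val, this]
  simp [fromBlocks_multiply, fromBlocks_add]

theorem omega_act (L : GL (Fin k) ℂ) (v w : Ambient k) : omega (act L v) (act L w) = omega v w := by
  have key : ∀ M N : Matrix (Idx k) (Idx k) ℂ, (((blockGL L).val * M * (blockGL L)⁻¹.val) *
      ((blockGL L).val * N * (blockGL L)⁻¹.val)).trace = (M * N).trace := by
    intro M N
    have : ((blockGL L).val * M * (blockGL L)⁻¹.val) * ((blockGL L).val * N * (blockGL L)⁻¹.val) =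
        (blockGL L).val * (M * N) * (blockGL L)⁻¹.val := by
      have h : (blockGL L)⁻¹.val * ((blockGL L).val * N * (blockGL L)⁻¹.val) =
        N * (blockGL L)⁻¹.val := by simp [← Matrix.mul_assoc]
      rw [Matrix.mul_assoc _ _ (_ * _ * _), h]
      simp [Matrix.mul_assoc]
    rw [this, trace_mul_comm, ← Matrix.mul_assoc]
    simp
  rw [omega_eq, omega_eq, hatA_act, hatA_act, hatB_act, hatB_act, key, key]

theorem comm_toBlocks (x : Ambient k) : (hatA x * hatB x - hatB x * hatA x).toBlocks₁₁ =
    matA x * matB x - matB x * matA x - matI x * matJ x := by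
  ext a b
  simp only [toBlocks₁₁, of_apply, Matrix.sub_apply, hatA, hatB, Matrix.mul_apply,
    Fintype.sum_sum_type, fromBlocks_apply₁₁, fromBlocks_apply₁₂, fromBlocks_apply₂₁,
    Finset.univ_unique, Finset.sum_singleton, Fin.sum_univ_two]
  ring

theorem mem_level_iff {τ : ℂ} {x : Ambient k} :
    x ∈ level k τ ↔ (hatA x * hatB x - hatB x * hatA x).toBlocks₁₁ = τ • 1 := by
  rw [comm_toBlocks]; rfl

theorem act_mem_level {τ : ℂ} {x : Ambient k} (hx : x ∈ level k τ) (L : GL (Fin k) ℂ) :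
    act L x ∈ level k τ := by
  have h : matA x * matB x - matB x * matA x - matI x * matJ x = τ • 1 := hx
  have := congrArg (fun M => L.val * M * L⁻¹.val) h
  simp only [Matrix.mul_sub, Matrix.sub_mul] at this
  change L.val * matA x * L⁻¹.val * (L.val * matB x * L⁻¹.val) -
    L.val * matB x * L⁻¹.val * (L.val * matA x * L⁻¹.val) - L.val * matI x * (matJ x * L⁻¹.val) = _
  have e : ∀ M : Matrix (Fin k) (Fin k) ℂ, L⁻¹.val * (L.val * M) = M := fun M => by
    simp [← Matrix.mul_assoc]
  simp only [Matrix.mul_assoc, e] at this ⊢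
  rw [this]
  simp

/-- On the level set, the commutator of `hatA` and `hatB` is `tauHat` up to the off-diagonal
blocks. -/
theorem comm_eq_of_mem_level {τ : ℂ} {x : Ambient k} (hx : x ∈ level k τ) :
    ∃ (u : Matrix (Fin k) Unit ℂ) (w : Matrix Unit (Fin k) ℂ),
      hatA x * hatB x - hatB x * hatA x = tauHat k τ + fromBlocks 0 u w 0 := by
  set C := hatA x * hatB x - hatB x * hatA x with hC
  have htr : C.trace = 0 := by rw [hC, trace_sub, trace_mul_comm, sub_self]
  have h11 := mem_level_iff.1 hx
  rw [← hC] at h11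
  have h11' : ∀ a b, C (Sum.inl a) (Sum.inl b) = (τ • (1 : Matrix (Fin k) (Fin k) ℂ)) a b :=
    fun a b => congrFun (congrFun h11 a) b
  refine ⟨C.toBlocks₁₂, C.toBlocks₂₁, ?_⟩
  ext (i | i) (j | j)
  · simp [h11', tauHat, diagonal_apply, one_apply]
  · simp [tauHat, toBlocks₁₂]
  · simp [tauHat, toBlocks₂₁]
  · simp only [trace, diag, Fintype.sum_sum_type, h11', Matrix.smul_apply, one_apply_eq,
      smul_eq_mul, mul_one, Finset.sum_const, Finset.card_univ, Fintype.card_fin, nsmul_eq_mul,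
      Finset.univ_unique, Finset.sum_singleton] at htr
    simp only [tauHat, Matrix.add_apply, diagonal_apply_eq, Sum.elim_inr, fromBlocks_apply₂₂,
      Matrix.zero_apply, add_zero]
    exact eq_neg_of_add_eq_zero_right htr

theorem hatA_mulVec (x : Ambient k) (v : Fin k → ℂ) :
    hatA x *ᵥ Sum.elim v 0 = Sum.elim (matA x *ᵥ v) fun _ => matJ x 1 ⬝ᵥ v := by
  rw [hatA, fromBlocks_mulVec]
  simp only [Function.comp_def, Sum.elim_inl, Sum.elim_inr]
  congr 1
  · simp [← Pi.zero_def]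
  · ext; simp [mulVec, dotProduct]

/-- The infinitesimal action of `gl(k)` at `M`. -/
def orbitMap (M : Matrix (Idx k) (Idx k) ℂ) :
    Matrix (Fin k) (Fin k) ℂ →ₗ[ℂ] Matrix (Idx k) (Idx k) ℂ where
  toFun X := incl X * M - M * incl X
  map_add' X Y := by
    have : incl (X + Y) = incl X + incl Y := by simp [incl, fromBlocks_add]
    rw [this, Matrix.add_mul, Matrix.mul_add]; abel
  map_smul' c X := by
    have : incl (c • X) = c • incl X := by simp [incl, fromBlocks_smul]
    rw [this, Matrix.smul_mul, Matrix.mul_smul, smul_sub, RingHom.id_apply]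

theorem orbitDim_eq (M : Matrix (Idx k) (Idx k) ℂ) :
    orbitDim M = Module.finrank ℂ (LinearMap.range (orbitMap M)) := by
  have : Set.range (fun X : Matrix (Fin k) (Fin k) ℂ => incl X * M - M * incl X) =
      (LinearMap.range (orbitMap M) : Set _) := rfl
  rw [orbitDim, this, Submodule.span_eq]

theorem orbitDim_le (M : Matrix (Idx k) (Idx k) ℂ) : orbitDim M ≤ k * k := by
  rw [orbitDim_eq]
  refine (LinearMap.finrank_range_le _).trans ?_
  simp [Module.finrank_matrix]

/-- The stabiliser in `gl(k)` is trivial: its elements intertwine `A` with itself and are killed by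
`j₂`. -/
theorem orbitDim_eq_of_noEig {x : Ambient k} (h : NoEig (matA x) (matJ x 1)) :
    orbitDim (hatA x) = k * k := by
  rw [orbitDim_eq, LinearMap.finrank_range_of_inj]
  · simp [Module.finrank_matrix]
  · rw [← LinearMap.ker_eq_bot, LinearMap.ker_eq_bot']
    intro X hX
    have hX' : incl X * hatA x = hatA x * incl X := sub_eq_zero.1 hX
    rw [incl, hatA, fromBlocks_multiply, fromBlocks_multiply, fromBlocks_inj] at hX'
    simp only [Matrix.zero_mul, Matrix.mul_zero, add_zero] at hX'
    refine h.eq_zero_of_intertwines hX'.1.symm ?_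
    ext b
    have := congrFun (congrFun hX'.2.2.1 ()) b
    simpa [Matrix.mul_apply, vecMul, dotProduct] using this.symm

/-- The condition on eigenvectors says that `j₂` vanishes on no eigenvector of `A`, and it already
implies that the orbit has the maximal dimension `k ^ 2`. -/
theorem isStronglySemisimple_hatA_iff {x : Ambient k} :
    IsStronglySemisimple (hatA x) ↔ NoEig (matA x) (matJ x 1) ∧
      IsRegularSemisimple (matA x) ∧ IsRegularSemisimple (hatA x) := by
  have h11 : (hatA x).toBlocks₁₁ = matA x := toBlocks_fromBlocks₁₁ _ _ _ _
  rw [IsStronglySemisimple, h11]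
  refine and_congr_left fun _ => ?_
  rw [IsGZero, h11]
  have key : ∀ (c : ℂ) (v : Fin k → ℂ), matA x *ᵥ v = c • v →
      (hatA x *ᵥ (Sum.elim v 0) ≠ c • (Sum.elim v 0 : Idx k → ℂ) ↔ matJ x 1 ⬝ᵥ v ≠ 0) := by
    intro c v hv
    rw [hatA_mulVec, hv, not_iff_not]
    constructor
    · intro h
      simpa using congrFun h (Sum.inr ())
    · intro h
      ext (i | i) <;> simp [h]
  constructor
  · rintro ⟨-, h⟩ c v hv hev
    exact (key c v hev).1 (h c v hv hev)
  · intro h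
    refine ⟨fun M' => ?_, fun c v hv hev => (key c v hev).2 (h c v hv hev)⟩
    rw [orbitDim_eq_of_noEig h]
    exact orbitDim_le M'

theorem IsRegularSemisimple.conj {n : Type*} [Fintype n] [DecidableEq n] {M : Matrix n n ℂ}
    (h : IsRegularSemisimple M) (L : GL n ℂ) : IsRegularSemisimple (L.val * M * L⁻¹.val) := by
  obtain ⟨g, d, hd, hg⟩ := h
  refine ⟨g * L⁻¹, d, hd, ?_⟩
  rw [← hg]
  have e : ∀ M : Matrix n n ℂ, L⁻¹.val * (L.val * M) = M := fun M => by
    simp [← Matrix.mul_assoc]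
  simp only [_root_.mul_inv_rev, inv_inv, Units.val_mul, Matrix.mul_assoc, e]

theorem IsStronglySemisimple.act {x : Ambient k} (hx : IsStronglySemisimple (hatA x))
    (L : GL (Fin k) ℂ) : IsStronglySemisimple (hatA (act L x)) := by
  rw [isStronglySemisimple_hatA_iff] at hx ⊢
  refine ⟨fun c v hv hev => ?_, hx.2.1.conj L, by rw [hatA_act]; exact hx.2.2.conj _⟩
  have h1 := hx.1 c (L⁻¹.val *ᵥ v) ?_ ?_
  · change ((matJ x * L⁻¹.val) 1) ⬝ᵥ v ≠ 0
    rwa [mul_apply_eq_vecMul, ← dotProduct_mulVec]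
  · intro h0
    have := congrArg (fun v => L.val *ᵥ v) h0
    simp only [mulVec_mulVec, Units.mul_inv, one_mulVec, mulVec_zero] at this
    exact hv this
  · have h2 := congrArg (fun v => L⁻¹.val *ᵥ v) hev
    change L⁻¹.val *ᵥ ((L.val * matA x * L⁻¹.val) *ᵥ v) = L⁻¹.val *ᵥ (c • v) at h2
    rw [← mulVec_smul, ← h2, mulVec_mulVec, mulVec_mulVec]
    simp [← Matrix.mul_assoc]

/-- Strong semisimplicity of `hatA` is the nonvanishing of one polynomial: a Krylov determinant
times the discriminants of `A` and `hatA`. -/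
theorem isOpen_stronglySemisimple (k : ℕ) (τ : ℂ) :
    IsOpen[zariskiQuot (orbitRel (level k τ))]
      {q | ∃ x : level k τ, IsStronglySemisimple (hatA x.1) ∧ Quotient.mk _ x = q} := by
  rw [isOpen_zariskiQuot_iff]
  have hhat : EntriesIn (polyFun (Ambient k)) hatA := fun i j =>
    dual_mem_polyFun (entryLin _ _ i j ∘ₗ hatALin k)
  have hA : EntriesIn (polyFun (Ambient k)) fun x => matA x := fun i j =>
    hhat (Sum.inl i) (Sum.inl j)
  have hj : EntriesIn (polyFun (Ambient k)) fun x => of fun (_ : Unit) b => matJ x 1 b :=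
    fun i j => hhat (Sum.inr ()) (Sum.inl j)
  have hkry : EntriesIn (polyFun (Ambient k)) fun x => krylov (matA x) (matJ x 1) := fun r b => by
    have := (hj.mul (hA.pow r)) () b
    exact this
  have htf : ∀ {n : Type} [Fintype n] [DecidableEq n] {F : Ambient k → Matrix n n ℂ},
      EntriesIn (polyFun (Ambient k)) F →
      EntriesIn (polyFun (Ambient k)) fun x => traceForm (F x) := fun hF i j =>
    (hF.pow _).trace
  rintro x ⟨x₀, hx₀, h⟩
  have hss : ∀ x : Ambient k, IsStronglySemisimple (hatA x) ↔ (krylov (matA x) (matJ x 1)).det *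
      ((traceForm (matA x)).det * (traceForm (hatA x)).det) ≠ 0 := by
    intro x
    rw [isStronglySemisimple_hatA_iff, mul_ne_zero_iff, mul_ne_zero_iff, ← isRegularSemisimple_iff,
      ← isRegularSemisimple_iff]
    exact ⟨fun h => ⟨(noEig_iff_det_krylov h.2.1).1 h.1, h.2⟩,
      fun h => ⟨(noEig_iff_det_krylov h.2.1).2 h.1, h.2⟩⟩
  obtain ⟨L, hL⟩ := Quotient.exact h
  refine ⟨_, mul_mem hkry.det (mul_mem (htf hA).det (htf hhat).det),
    (hss x).1 (hL ▸ hx₀.act L), fun x' hx' => ⟨x', (hss x').2 hx', rfl⟩⟩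

/-! ### The normal form attached to given coordinates -/

/-- Lagrange interpolation of a monic polynomial of degree `k` at `k` points. -/
theorem eval_eq_prod_add_interpolation {l : Fin k → ℂ} (hl : Function.Injective l)
    {f : Polynomial ℂ} (hf : f.Monic) (hdeg : f.natDegree = k) (t : ℂ) :
    f.eval t = ∏ a, (t - l a) + ∑ a, (∏ a' ∈ Finset.univ.erase a, (t - l a')) *
      (f.eval (l a) / ∏ a' ∈ Finset.univ.erase a, (l a - l a')) := by
  set p : Polynomial ℂ := ∏ a, (Polynomial.X - Polynomial.C (l a)) with hp
  have hpm : p.Monic := Polynomial.monic_prod_of_monic _ _ fun r _ => Polynomial.monic_X_sub_C _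
  have hpd : p.natDegree = k := by
    rw [hp, Polynomial.natDegree_prod_of_monic _ _ fun r _ => Polynomial.monic_X_sub_C _]
    simp
  have hpe : ∀ t, p.eval t = ∏ a, (t - l a) := fun t => by simp [hp, Polynomial.eval_prod]
  have hlt : (f - p).degree < (Finset.univ : Finset (Fin k)).card := by
    rw [Finset.card_univ, Fintype.card_fin]
    have hfd : f.degree = k := by rw [Polynomial.degree_eq_natDegree hf.ne_zero, hdeg]
    rw [← hfd]
    refine Polynomial.degree_sub_lt_left ?_ hf.ne_zero ?_
    · rw [hfd, Polynomial.degree_eq_natDegree hpm.ne_zero, hpd]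
    · rw [hf.leadingCoeff, hpm.leadingCoeff]
  have h := congrArg (Polynomial.eval t)
    (Lagrange.eq_interpolate (v := l) hl.injOn hlt)
  rw [Polynomial.eval_sub, hpe, sub_eq_iff_eq_add'] at h
  rw [h, Lagrange.interpolate_apply, Polynomial.eval_finsetSum]
  congr 1
  refine Finset.sum_congr rfl fun a _ => ?_
  have h0 : p.eval (l a) = 0 := by
    rw [hpe]; exact Finset.prod_eq_zero (Finset.mem_univ a) (sub_self _)
  rw [Polynomial.eval_mul, Polynomial.eval_C, Polynomial.eval_sub, h0, sub_zero, Lagrange.basis,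
    Polynomial.eval_prod]
  simp only [Lagrange.basisDivisor, Polynomial.eval_mul, Polynomial.eval_C, Polynomial.eval_sub,
    Polynomial.eval_X, Finset.prod_mul_distrib, Finset.prod_inv_distrib]
  ring

/-- The columns are the eigenvectors of the normal form of `hatA`, normalised to have last entry
`1`. -/
def eigP (y : CoordSpace k) : Matrix (Idx k) (Idx k) ℂ :=
  of fun i b => Sum.elim (fun a => (∏ c ∈ Finset.univ.erase b, (lam y a - lamHat y c)) /
    ∏ a' ∈ Finset.univ.erase a, (lam y a - lam y a')) (fun _ => 1) i

/-- The inverse of `eigP`: its rows are left eigenvectors of the normal form of `hatA`. -/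
def eigG (y : CoordSpace k) : Matrix (Idx k) (Idx k) ℂ :=
  of fun b i => Sum.elim (fun a => ∏ a' ∈ Finset.univ.erase a, (lamHat y b - lam y a'))
    (fun _ => ∏ a, (lamHat y b - lam y a)) i / ∏ c ∈ Finset.univ.erase b, (lamHat y b - lamHat y c)

theorem prod_erase_sub_ne_zero {n : Type*} [Fintype n] [DecidableEq n] {d : n → ℂ}
    (hd : Function.Injective d) (b : n) : ∏ c ∈ Finset.univ.erase b, (d b - d c) ≠ 0 :=
  Finset.prod_ne_zero_iff.2 fun _ hc =>
    sub_ne_zero.2 fun h => (Finset.ne_of_mem_erase hc) (hd h.symm)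

/-- The entries of the product are the values of Lagrange interpolation, at `k` points `lam y a`, of
the monic polynomials of degree `k` with roots all but one of the `lamHat y b`. -/
theorem eigG_mul_eigP {y : CoordSpace k} (hy : y ∈ coordReg k) : eigG y * eigP y = 1 := by
  ext c b
  set f : Polynomial ℂ := ∏ c ∈ Finset.univ.erase b, (Polynomial.X - Polynomial.C (lamHat y c))
  have hfm : f.Monic := Polynomial.monic_prod_of_monic _ _ fun r _ => Polynomial.monic_X_sub_C _
  have hfd : f.natDegree = k := by
    rw [Polynomial.natDegree_prod_of_monic _ _ fun r _ => Polynomial.monic_X_sub_C _]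
    simp [Finset.card_erase_of_mem]
  have hfe : ∀ t, f.eval t = ∏ c ∈ Finset.univ.erase b, (t - lamHat y c) := fun t => by
    simp [f, Polynomial.eval_prod]
  have h := eval_eq_prod_add_interpolation hy.1 hfm hfd (lamHat y c)
  have h2 : (eigG y * eigP y) c b = f.eval (lamHat y c) /
      ∏ c' ∈ Finset.univ.erase c, (lamHat y c - lamHat y c') := by
    rw [h, Matrix.mul_apply, Fintype.sum_sum_type]
    simp only [eigG, eigP, of_apply, Sum.elim_inl, Sum.elim_inr, hfe, Finset.univ_unique,
      Finset.sum_singleton, mul_one, add_div, Finset.sum_div]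
    rw [add_comm]
    congr 1
    exact Finset.sum_congr rfl fun a _ => by rw [div_mul_eq_mul_div]
  rw [h2, hfe]
  by_cases hcb : c = b
  · subst hcb
    rw [div_self (prod_erase_sub_ne_zero hy.2 c), one_apply_eq]
  · rw [one_apply_ne hcb, Finset.prod_eq_zero (Finset.mem_erase.2 ⟨hcb, Finset.mem_univ c⟩)
      (sub_self _), zero_div]

theorem eigP_mul_eigG {y : CoordSpace k} (hy : y ∈ coordReg k) : eigP y * eigG y = 1 :=
  mul_eq_one_comm.1 (eigG_mul_eigP hy)

theorem eigP_inr (y : CoordSpace k) (u : Unit) (b : Idx k) : eigP y (Sum.inr u) b = 1 := rfl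

/-- The rows of `eigG y` are left eigenvectors of any matrix with first `k` columns
`(diag (lam y); 1, …, 1)`. -/
theorem eigG_eigen (y : CoordSpace k) (b : Idx k) (a : Fin k) :
    eigG y b (Sum.inl a) * lam y a + eigG y b (Sum.inr ()) =
      lamHat y b * eigG y b (Sum.inl a) := by
  simp only [eigG, of_apply, Sum.elim_inl, Sum.elim_inr]
  rw [← Finset.mul_prod_erase _ _ (Finset.mem_univ a)]
  ring

/-- The matrix with last column `v` and all other columns zero. -/
def lastCol (v : Idx k → ℂ) : Matrix (Idx k) (Idx k) ℂ := vecMulVec v (Pi.single (Sum.inr ()) 1)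

theorem lastCol_eq (u : Matrix (Fin k) Unit ℂ) :
    (fromBlocks 0 u 0 0 : Matrix (Idx k) (Idx k) ℂ) = lastCol (Sum.elim (fun a => u a ()) 0) := by
  ext (i | i) (j | j) <;> simp [lastCol, vecMulVec_apply]

theorem lastCol_eq_fromBlocks {v : Idx k → ℂ} (hv : v (Sum.inr ()) = 0) :
    lastCol v = fromBlocks 0 (of fun a _ => v (Sum.inl a)) 0 0 := by
  ext (i | i) (j | j) <;> simp [lastCol, vecMulVec_apply, hv]

/-- If the last row of `P` is `(1, …, 1)`, then all columns of `G * lastCol v * P` are `G v`. -/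
theorem conj_lastCol (G P : Matrix (Idx k) (Idx k) ℂ) (hP : ∀ b, P (Sum.inr ()) b = 1)
    (v : Idx k → ℂ) (b c : Idx k) : (G * lastCol v * P) b c = (G *ᵥ v) b := by
  rw [lastCol, mul_vecMulVec, vecMulVec_mul, vecMulVec_apply, single_one_vecMul, row_apply, hP,
    mul_one]

/-- The normal form of `hatA`. -/
def secA (y : CoordSpace k) : Matrix (Idx k) (Idx k) ℂ :=
  eigP y * diagonal (lamHat y) * eigG y

theorem eigG_mul_secA {y : CoordSpace k} (hy : y ∈ coordReg k) :
    eigG y * secA y = diagonal (lamHat y) * eigG y := by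
  rw [secA, ← Matrix.mul_assoc, ← Matrix.mul_assoc, eigG_mul_eigP hy, Matrix.one_mul]

theorem secA_mul_eigP {y : CoordSpace k} (hy : y ∈ coordReg k) :
    secA y * eigP y = eigP y * diagonal (lamHat y) := by
  rw [secA, Matrix.mul_assoc, eigG_mul_eigP hy, Matrix.mul_one]

/-- A matrix with left eigenvectors `eigG y` is determined to be `secA y`. -/
theorem eq_secA {y : CoordSpace k} (hy : y ∈ coordReg k) {M : Matrix (Idx k) (Idx k) ℂ}
    (h : eigG y * M = diagonal (lamHat y) * eigG y) : M = secA y := by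
  rw [secA, Matrix.mul_assoc, ← h, ← Matrix.mul_assoc, eigP_mul_eigG hy, Matrix.one_mul]

/-- The first `k` columns of `secA` are `(diag (lam y); 1, …, 1)`. -/
theorem secA_inl {y : CoordSpace k} (hy : y ∈ coordReg k) (i : Idx k) (a : Fin k) :
    secA y i (Sum.inl a) = Sum.elim (fun a' => diagonal (lam y) a' a) (fun _ => 1) i := by
  have h := eq_secA hy (M := fromBlocks (diagonal (lam y)) (secA y).toBlocks₁₂ (of fun _ _ => 1)
    (secA y).toBlocks₂₂) ?_
  · rw [← h]
    rcases i with i | i <;> simp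
  · ext b (j | j)
    · have := eigG_eigen y b j
      rw [Matrix.mul_apply, Fintype.sum_sum_type]
      simpa [diagonal_apply, Matrix.mul_apply] using this
    · rw [← eigG_mul_secA hy, Matrix.mul_apply, Matrix.mul_apply]
      refine Finset.sum_congr rfl fun i _ => ?_
      rcases i with i | i <;> rfl

/-- The last column of `secA`: its entry at `a` vanishes if `lam y a` is one of the `lamHat y b`. -/
theorem secA_inr {y : CoordSpace k} (hy : y ∈ coordReg k) (a : Fin k) (b : Idx k) :
    secA y (Sum.inl a) (Sum.inr ()) = (lamHat y b - lam y a) * eigP y (Sum.inl a) b := by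
  have h := congrFun (congrFun (secA_mul_eigP hy) (Sum.inl a)) b
  rw [Matrix.mul_apply, Fintype.sum_sum_type, mul_diagonal] at h
  simp only [secA_inl hy, Sum.elim_inl, diagonal_apply, ite_mul, zero_mul, Finset.sum_ite_eq,
    Finset.mem_univ, if_true, Finset.univ_unique, Finset.sum_singleton, eigP_inr] at h
  linear_combination h

/-- The last column of `[hatA, B₂] - tauHat` in the normal form; it is determined by the vanishing
of the diagonal of `[hatA, B₂]` in an eigenbasis of `hatA`. -/
def secU (τ : ℂ) (y : CoordSpace k) : Idx k → ℂ :=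
  -(eigP y *ᵥ fun b => (eigG y * tauHat k τ * eigP y) b b)

theorem trace_tauHat (τ : ℂ) : (tauHat k τ).trace = 0 := by
  simp [tauHat, trace]

/-- The last entry is minus the trace of `tauHat`, since the last row of `eigP` is `(1, …, 1)`. -/
theorem secU_inr {y : CoordSpace k} (hy : y ∈ coordReg k) (τ : ℂ) :
    secU τ y (Sum.inr ()) = 0 := by
  have : secU τ y (Sum.inr ()) = -(eigG y * tauHat k τ * eigP y).trace := by
    simp [secU, mulVec, dotProduct, eigP_inr, trace]
  rw [this, trace_mul_comm, ← Matrix.mul_assoc, eigP_mul_eigG hy, Matrix.one_mul, trace_tauHat,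
    neg_zero]

/-- The commutator of `hatA` and `B₂` in the normal form. -/
def secC (τ : ℂ) (y : CoordSpace k) : Matrix (Idx k) (Idx k) ℂ := tauHat k τ + lastCol (secU τ y)

theorem secC_diag {y : CoordSpace k} (hy : y ∈ coordReg k) (τ : ℂ) (b : Idx k) :
    (eigG y * secC τ y * eigP y) b b = 0 := by
  rw [secC, Matrix.mul_add, Matrix.add_mul, Matrix.add_apply, conj_lastCol _ _ (eigP_inr y ()),
    secU, mulVec_neg, mulVec_mulVec, eigG_mul_eigP hy, one_mulVec, Pi.neg_apply, add_neg_cancel]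

/-- The matrix `B₂` of the normal form in the eigenbasis of `hatA`. -/
def secN (τ : ℂ) (y : CoordSpace k) : Matrix (Idx k) (Idx k) ℂ :=
  of fun b c => if b = c then muHat y b else
    (eigG y * secC τ y * eigP y) b c / (lamHat y b - lamHat y c)

/-- The matrix `B₂` in the normal form. -/
def secB₂ (τ : ℂ) (y : CoordSpace k) : Matrix (Idx k) (Idx k) ℂ := eigP y * secN τ y * eigG y

/-- The diagonal of `N` together with the commutator with a regular diagonal matrix determine
`N`. -/
theorem eq_secN_iff {y : CoordSpace k} (hy : y ∈ coordReg k) (τ : ℂ)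
    {N : Matrix (Idx k) (Idx k) ℂ} : N = secN τ y ↔ (∀ b, N b b = muHat y b) ∧
      diagonal (lamHat y) * N - N * diagonal (lamHat y) = eigG y * secC τ y * eigP y := by
  constructor
  · rintro rfl
    refine ⟨fun b => by simp [secN], ?_⟩
    ext b c
    rw [Matrix.sub_apply, diagonal_mul, mul_diagonal]
    by_cases h : b = c
    · subst h; rw [secC_diag hy]; ring
    · have : lamHat y b - lamHat y c ≠ 0 := sub_ne_zero.2 fun h' => h (hy.2 h')
      simp only [secN, of_apply, if_neg h]
      field_simp
  · rintro ⟨h1, h2⟩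
    ext b c
    by_cases h : b = c
    · subst h; simp [secN, h1]
    · have : lamHat y b - lamHat y c ≠ 0 := sub_ne_zero.2 fun h' => h (hy.2 h')
      have h3 := congrFun (congrFun h2 b) c
      rw [Matrix.sub_apply, diagonal_mul, mul_diagonal] at h3
      simp only [secN, of_apply, if_neg h]
      rw [← h3]
      field_simp

theorem secA_comm_secB₂ {y : CoordSpace k} (hy : y ∈ coordReg k) (τ : ℂ) :
    secA y * secB₂ τ y - secB₂ τ y * secA y = secC τ y := by
  have h := ((eq_secN_iff hy τ).1 rfl).2
  have h1 : eigP y * (diagonal (lamHat y) * secN τ y - secN τ y * diagonal (lamHat y)) * eigG y =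
      eigP y * eigG y * secC τ y * (eigP y * eigG y) := by
    rw [h]; simp only [Matrix.mul_assoc]
  rw [eigP_mul_eigG hy, Matrix.one_mul, Matrix.mul_one] at h1
  have e : ∀ M, eigG y * (eigP y * M) = M := fun M => by
    rw [← Matrix.mul_assoc, eigG_mul_eigP hy, Matrix.one_mul]
  rw [← h1, secA, secB₂]
  simp only [Matrix.mul_sub, Matrix.sub_mul, Matrix.mul_assoc, e]

/-- The normal form: a point of the level set with prescribed coordinates. -/
def sec (τ : ℂ) (y : CoordSpace k) : Ambient k :=
  ofHat (secA y) (incl (diagonal (mu y)) + secB₂ τ y)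

theorem hatA_sec (τ : ℂ) (y : CoordSpace k) : hatA (sec τ y) = secA y := hatA_ofHat _ _

theorem hatB_sec (τ : ℂ) (y : CoordSpace k) :
    hatB (sec τ y) = incl (diagonal (mu y)) + secB₂ τ y := hatB_ofHat _ _

theorem matA_sec {y : CoordSpace k} (hy : y ∈ coordReg k) (τ : ℂ) :
    matA (sec τ y) = diagonal (lam y) := by
  ext a b
  exact secA_inl hy (Sum.inl a) b

theorem matJ_sec {y : CoordSpace k} (hy : y ∈ coordReg k) (τ : ℂ) (b : Fin k) :
    matJ (sec τ y) 1 b = 1 := secA_inl hy (Sum.inr ()) b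

/-- `eigG` as an invertible matrix; conjugation by it takes the normal form of `hatA` to its
diagonal form. -/
def eigGL {y : CoordSpace k} (hy : y ∈ coordReg k) : GL (Idx k) ℂ :=
  ⟨eigG y, eigP y, eigG_mul_eigP hy, eigP_mul_eigG hy⟩

theorem isCoord_sec {y : CoordSpace k} (hy : y ∈ coordReg k) (τ : ℂ) :
    IsCoord τ (sec τ y) y := by
  refine ⟨diagonal (mu y), secB₂ τ y, of fun a _ => secU τ y (Sum.inl a), 1, eigGL hy,
    hatB_sec τ y, ?_, ?_, ?_, ?_, ?_, fun b => ?_⟩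
  · rw [matA_sec hy, diagonal_mul_diagonal, diagonal_mul_diagonal, sub_eq_zero]
    simp only [mul_comm]
  · rw [hatA_sec, secA_comm_secB₂ hy, secC, lastCol_eq_fromBlocks (secU_inr hy τ)]
  · simp [matA_sec hy]
  · simp
  · rw [hatA_sec]
    change eigG y * secA y * eigP y = _
    rw [eigG_mul_secA hy, Matrix.mul_assoc, eigG_mul_eigP hy, Matrix.mul_one]
  · change (eigG y * secB₂ τ y * eigP y) b b = _
    have : eigG y * secB₂ τ y * eigP y = secN τ y := by
      rw [secB₂, ← Matrix.mul_assoc, ← Matrix.mul_assoc, eigG_mul_eigP hy, Matrix.one_mul,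
        Matrix.mul_assoc, eigG_mul_eigP hy, Matrix.mul_one]
    rw [this]
    exact ((eq_secN_iff hy τ).1 rfl).1 b

theorem fromBlocks_sub_fromBlocks {l m n o : Type*} (A A' : Matrix n l ℂ) (B B' : Matrix n m ℂ)
    (C C' : Matrix o l ℂ) (D D' : Matrix o m ℂ) : fromBlocks A B C D - fromBlocks A' B' C' D' =
      fromBlocks (A - A') (B - B') (C - C') (D - D') := by
  ext (i | i) (j | j) <;> rfl

theorem comm_incl (x : Ambient k) (X : Matrix (Fin k) (Fin k) ℂ) :
    hatA x * incl X - incl X * hatA x = fromBlocks (matA x * X - X * matA x)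
      (-(X * of fun a _ => matI x a 0)) ((of fun _ b => matJ x 1 b) * X) 0 := by
  rw [hatA, incl, fromBlocks_multiply, fromBlocks_multiply, fromBlocks_sub_fromBlocks]
  simp

theorem IsCoord.mem_level {τ : ℂ} {x : Ambient k} {y : CoordSpace k} (h : IsCoord τ x y) :
    x ∈ level k τ := by
  obtain ⟨B₁, B₂, u, -, -, hB, h1, h2, -⟩ := h
  rw [mem_level_iff, hB, Matrix.mul_add, Matrix.add_mul, add_sub_add_comm, h2, comm_incl, h1]
  ext a b
  simp [toBlocks₁₁, tauHat, diagonal_apply, one_apply]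

theorem sec_mem_regLevel {y : CoordSpace k} (hy : y ∈ coordReg k) (τ : ℂ) :
    sec τ y ∈ regLevel k τ := by
  refine ⟨(isCoord_sec hy τ).mem_level, isStronglySemisimple_hatA_iff.2 ⟨?_, ?_, ?_⟩⟩
  · rw [noEig_iff (h := 1) hy.1 (by simp [matA_sec hy])]
    intro a
    simp [matJ_sec hy]
  · exact ⟨1, lam y, hy.1, by simp [matA_sec hy]⟩
  · rw [hatA_sec]
    refine IsRegularSemisimple.of_eigenbasis hy.2 ?_ (secA_mul_eigP hy)
    exact fun h0 => by simpa [h0] using congrArg det (eigP_mul_eigG hy)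

/-! ### Existence and uniqueness of the coordinates -/

theorem IsCoord.act {τ : ℂ} {x : Ambient k} {y : CoordSpace k} (h : IsCoord τ x y)
    (L : GL (Fin k) ℂ) : IsCoord τ (act L x) y := by
  obtain ⟨B₁, B₂, u, h, g, hB, h1, h2, h3, h4, h5, h6⟩ := h
  have e : ∀ {n : Type} [Fintype n] [DecidableEq n] (L : GL n ℂ) (M : Matrix n n ℂ),
      L⁻¹.val * (L.val * M) = M := fun L M => by simp [← Matrix.mul_assoc]
  have cj : ∀ {n : Type} [Fintype n] [DecidableEq n] (h L : GL n ℂ) (M : Matrix n n ℂ),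
      (h * L⁻¹).val * (L.val * M * L⁻¹.val) * (h * L⁻¹)⁻¹.val = h.val * M * h⁻¹.val := by
    intro n _ _ h L M
    simp only [_root_.mul_inv_rev, inv_inv, Units.val_mul, Matrix.mul_assoc, e]
  refine ⟨L.val * B₁ * L⁻¹.val, (blockGL L).val * B₂ * (blockGL L)⁻¹.val, L.val * u, h * L⁻¹,
    g * (blockGL L)⁻¹, ?_, ?_, ?_, ?_, ?_, ?_, ?_⟩
  · rw [hatB_act, hB, incl_conj, Matrix.mul_add, Matrix.add_mul]
  · have : L.val * (matA x * B₁ - B₁ * matA x) * L⁻¹.val = 0 := by simp [h1]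
    change L.val * matA x * L⁻¹.val * _ - _ * (L.val * matA x * L⁻¹.val) = 0
    rw [← this]
    simp only [Matrix.mul_sub, Matrix.sub_mul, Matrix.mul_assoc, e]
  · rw [← conj_tauHat, ← h2, hatA_act]
    simp only [Matrix.mul_sub, Matrix.sub_mul, Matrix.mul_assoc, e]
  · rw [← h3]; exact cj _ _ _
  · rw [← h4]; exact cj _ _ _
  · rw [← h5, hatA_act]; exact cj _ _ _
  · intro b; rw [← h6, cj]

/-- The permutation of the rows of an invertible matrix. -/
def permRows {n : Type*} [Fintype n] [DecidableEq n] (h : GL n ℂ) (σ : Equiv.Perm n) : GL n ℂ where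
  val := h.val.submatrix σ id
  inv := h⁻¹.val.submatrix id σ
  val_inv := by
    rw [← submatrix_mul _ _ _ _ _ Function.bijective_id, Units.mul_inv, submatrix_one_equiv]
  inv_val := by
    rw [← submatrix_mul _ _ _ _ _ σ.bijective, Units.inv_mul, submatrix_id_id]

theorem permRows_conj {n : Type*} [Fintype n] [DecidableEq n] (h : GL n ℂ) (σ : Equiv.Perm n)
    (M : Matrix n n ℂ) : (permRows h σ).val * M * (permRows h σ)⁻¹.val =
      (h.val * M * h⁻¹.val).submatrix σ σ := by
  change h.val.submatrix σ id * M * h⁻¹.val.submatrix id σ = _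
  ext i j
  simp [Matrix.mul_apply, submatrix_apply]

theorem IsCoord.perm {τ : ℂ} {x : Ambient k} {y : CoordSpace k} (h : IsCoord τ x y)
    (σ : Equiv.Perm (Fin k)) (ρ : Equiv.Perm (Idx k)) :
    IsCoord τ x ((lam y ∘ σ, mu y ∘ σ), (lamHat y ∘ ρ, muHat y ∘ ρ)) := by
  obtain ⟨B₁, B₂, u, h, g, hB, h1, h2, h3, h4, h5, h6⟩ := h
  refine ⟨B₁, B₂, u, permRows h σ, permRows g ρ, hB, h1, h2, ?_, ?_, ?_, fun b => ?_⟩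
  · rw [permRows_conj, h3, submatrix_diagonal_equiv]
  · rw [permRows_conj, h4, submatrix_diagonal_equiv]
  · rw [permRows_conj, h5, submatrix_diagonal_equiv]
  · rw [permRows_conj, submatrix_apply, h6]; rfl

/-- Vandermonde: the weights `e` are determined by the moments `∑ e a * d a ^ r`. Applied to traces
against powers of a diagonalised matrix, this makes diagonal entries independent of the
eigenbasis. -/
theorem eq_of_sum_mul_pow_eq {n : Type*} [Fintype n] {d e e' : n → ℂ} (hd : Function.Injective d)
    (h : ∀ r < Fintype.card n, ∑ a, e a * d a ^ r = ∑ a, e' a * d a ^ r) : e = e' := by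
  set ε := (Fintype.equivFin n).symm
  have := eq_zero_of_forall_pow_sum_mul_pow_eq_zero (f := d ∘ ε) (v := (e - e') ∘ ε)
    (hd.comp ε.injective) fun i => by
      have h1 := h i i.2
      rw [← ε.sum_comp, ← ε.sum_comp (fun a => e' a * d a ^ (i : ℕ))] at h1
      simp [sub_mul, h1]
  ext a
  have h2 := congrFun this (ε.symm a)
  simpa [sub_eq_zero] using h2

theorem exists_perm_of_conj {n : Type*} [Fintype n] [DecidableEq n] {M : Matrix n n ℂ}
    {d d' : n → ℂ} (hd' : Function.Injective d') {g g' : GL n ℂ}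
    (h : g.val * M * g⁻¹.val = diagonal d) (h' : g'.val * M * g'⁻¹.val = diagonal d') :
    ∃ σ : Equiv.Perm n, d ∘ σ = d' := by
  have hc : (diagonal d).charpoly = (diagonal d').charpoly := by
    rw [← h, ← h', coe_units_inv, coe_units_inv, charpoly_units_conj, charpoly_units_conj]
  have hex : ∀ a, ∃ b, d b = d' a := by
    intro a
    have h1 := congrArg (Polynomial.eval (d' a)) hc
    rw [charpoly_diagonal, charpoly_diagonal, Polynomial.eval_prod, Polynomial.eval_prod,
      Finset.prod_eq_zero (s := Finset.univ) (i := a)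
        (f := fun b => Polynomial.eval (d' a) (Polynomial.X - Polynomial.C (d' b)))
        (Finset.mem_univ a) (by simp), Finset.prod_eq_zero_iff] at h1
    obtain ⟨b, -, hb⟩ := h1
    exact ⟨b, (sub_eq_zero.1 (by simpa using hb)).symm⟩
  choose σ hσ using hex
  have hinj : Function.Injective σ := fun a b hab => hd' (by rw [← hσ a, ← hσ b, hab])
  exact ⟨Equiv.ofBijective σ (Finite.injective_iff_bijective.1 hinj), funext hσ⟩

/-- The decomposition `hatB = B₁ + B₂` is unique: the difference of two choices of `B₁` commutes
with `A` and is killed by `j₂`. Hence `μ` and `μ̂` are determined once the eigenvalues are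
ordered. -/
theorem IsCoord.eq_of_lam_eq {τ : ℂ} {x : Ambient k} {y y' : CoordSpace k} (hx : x ∈ regLevel k τ)
    (hy : y ∈ coordReg k) (h : IsCoord τ x y) (h' : IsCoord τ x y') (hl : lam y' = lam y)
    (hl' : lamHat y' = lamHat y) : y' = y := by
  obtain ⟨B₁, B₂, u, h, g, hB, h1, h2, h3, h4, h5, h6⟩ := h
  obtain ⟨B₁', B₂', u', h', g', hB', h1', h2', h3', h4', h5', h6'⟩ := h'
  have hN := (isStronglySemisimple_hatA_iff.1 hx.2).1
  have hBB : incl B₁ - incl B₁' = B₂' - B₂ := by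
    rw [sub_eq_sub_iff_add_eq_add, ← hB, hB', add_comm]
  have hincl : incl (B₁ - B₁') = incl B₁ - incl B₁' := by
    rw [incl, incl, incl, fromBlocks_sub_fromBlocks]; simp
  have hc : hatA x * incl (B₁ - B₁') - incl (B₁ - B₁') * hatA x = fromBlocks 0 (u' - u) 0 0 := by
    rw [hincl, hBB, Matrix.mul_sub, Matrix.sub_mul, sub_sub_sub_comm, h2, h2',
      add_sub_add_left_eq_sub, fromBlocks_sub_fromBlocks]
    simp
  rw [comm_incl, fromBlocks_inj] at hc
  have hz : B₁ - B₁' = 0 := by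
    refine hN.eq_zero_of_intertwines (sub_eq_zero.1 hc.1) ?_
    ext b
    exact congrFun (congrFun hc.2.2.1 ()) b
  have e1 : B₁' = B₁ := (sub_eq_zero.1 hz).symm
  have e2 : B₂' = B₂ := by
    rw [← sub_eq_zero, ← hBB, ← hincl, hz]; simp [incl]
  subst e1 e2
  rw [hl] at h3'
  rw [hl'] at h5'
  have hmu : mu y' = mu y := eq_of_sum_mul_pow_eq hy.1 fun r _ => by
    rw [← trace_pow_of_conj h3' (fun b => by rw [h4', diagonal_apply_eq]),
      ← trace_pow_of_conj h3 (fun b => by rw [h4, diagonal_apply_eq])]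
  have hmu' : muHat y' = muHat y := eq_of_sum_mul_pow_eq hy.2 fun r _ => by
    rw [← trace_pow_of_conj h5' h6', ← trace_pow_of_conj h5 h6]
  exact Prod.ext (Prod.ext hl hmu) (Prod.ext hl' hmu')

theorem IsCoord.unique {τ : ℂ} {x : Ambient k} {y y' : CoordSpace k} (hx : x ∈ regLevel k τ)
    (hy' : y' ∈ coordReg k) (h : IsCoord τ x y) (h' : IsCoord τ x y') :
    ∃ (σ : Equiv.Perm (Fin k)) (ρ : Equiv.Perm (Idx k)),
      (((lam y ∘ σ, mu y ∘ σ), (lamHat y ∘ ρ, muHat y ∘ ρ)) : CoordSpace k) = y' := by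
  obtain ⟨σ, hσ⟩ : ∃ σ : Equiv.Perm (Fin k), lam y ∘ σ = lam y' := by
    obtain ⟨_, _, _, h, _, _, _, _, h3, -⟩ := h
    obtain ⟨_, _, _, h', _, _, _, _, h3', -⟩ := h'
    exact exists_perm_of_conj hy'.1 h3 h3'
  obtain ⟨ρ, hρ⟩ : ∃ ρ : Equiv.Perm (Idx k), lamHat y ∘ ρ = lamHat y' := by
    obtain ⟨_, _, _, _, g, _, _, _, _, _, h5, -⟩ := h
    obtain ⟨_, _, _, _, g', _, _, _, _, _, h5', -⟩ := h'
    exact exists_perm_of_conj hy'.2 h5 h5'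
  exact ⟨σ, ρ, IsCoord.eq_of_lam_eq hx hy' h' (h.perm σ ρ) hσ hρ⟩

/-- `B₁` is the matrix commuting with `A` such that `j₂ * B₁` is the lower-left block of
`[hatA, hatB]`; in an eigenbasis of `A` this means a division by the entries of `j₂`. -/
theorem exists_isCoord {τ : ℂ} {x : Ambient k} (hx : x ∈ regLevel k τ) :
    ∃ y ∈ coordReg k, IsCoord τ x y := by
  obtain ⟨hN, ⟨h, l, hl, hA⟩, ⟨g, l', hl', hA'⟩⟩ := isStronglySemisimple_hatA_iff.1 hx.2
  have hq := (noEig_iff hl hA).1 hN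
  obtain ⟨u, w, hC⟩ := comm_eq_of_mem_level hx.1
  set m : Fin k → ℂ := fun a => (w () ᵥ* h⁻¹.val) a / (matJ x 1 ᵥ* h⁻¹.val) a with hm
  set B₁ := h⁻¹.val * diagonal m * h.val with hB₁
  have hB₁' : h.val * B₁ * h⁻¹.val = diagonal m := by
    rw [hB₁]
    simp [← Matrix.mul_assoc]
  have hAe : matA x = h⁻¹.val * diagonal l * h.val := by
    have := pow_of_conj hA 1
    simpa using this
  have hcomm : matA x * B₁ - B₁ * matA x = 0 := by
    have e : ∀ M : Matrix (Fin k) (Fin k) ℂ, h.val * (h⁻¹.val * M) = M := fun M => by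
      simp [← Matrix.mul_assoc]
    have e2 : ∀ M : Matrix (Fin k) (Fin k) ℂ, diagonal l * (diagonal m * M) =
        diagonal m * (diagonal l * M) := fun M => by
      rw [← Matrix.mul_assoc, ← Matrix.mul_assoc, diagonal_mul_diagonal, diagonal_mul_diagonal]
      simp only [mul_comm]
    rw [hAe, hB₁, sub_eq_zero]
    simp only [Matrix.mul_assoc, e, e2]
  have hw : (of fun (_ : Unit) b => matJ x 1 b) * B₁ = w := by
    have h1 : matJ x 1 ᵥ* B₁ = w () := by
      rw [hB₁, ← vecMul_vecMul, ← vecMul_vecMul]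
      have : (matJ x 1 ᵥ* h⁻¹.val) ᵥ* diagonal m = w () ᵥ* h⁻¹.val := by
        ext a
        rw [vecMul_diagonal, hm, mul_div_cancel₀ _ (hq a)]
      rw [this, vecMul_vecMul, Units.inv_mul, vecMul_one]
    ext i b
    exact congrFun h1 b
  refine ⟨((l, m), (l', fun b => (g.val * (hatB x - incl B₁) * g⁻¹.val) b b)), ⟨hl, hl'⟩,
    B₁, hatB x - incl B₁, u + B₁ * of fun a _ => matI x a 0, h, g, by abel, hcomm, ?_, hA, hB₁',
    hA', fun b => rfl⟩
  rw [Matrix.mul_sub, Matrix.sub_mul, sub_sub_sub_comm, hC, comm_incl, hcomm, hw, add_sub_assoc,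
    fromBlocks_sub_fromBlocks]
  simp

/-- Left eigenvectors of the block matrix with upper-left block `diag l` and lower-left block
`(1, …, 1)` are unique up to scale. -/
theorem exists_left_eigenvector_eq_smul {l : Fin k → ℂ} (hl : Function.Injective l) {c : ℂ}
    {r : Fin k → ℂ} {s : ℂ} (h : ∀ a, r a * l a + s = c * r a) :
    ∃ κ : ℂ, (∀ a, r a = κ * ∏ a' ∈ Finset.univ.erase a, (c - l a')) ∧ s = κ * ∏ a, (c - l a) := by
  have hs : ∀ a, s = r a * (c - l a) := fun a => by linear_combination h a
  by_cases hc : ∃ a₀, c = l a₀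
  · obtain ⟨a₀, rfl⟩ := hc
    have hs0 : s = 0 := by rw [hs a₀, sub_self, mul_zero]
    refine ⟨r a₀ / ∏ a' ∈ Finset.univ.erase a₀, (l a₀ - l a'), fun a => ?_, ?_⟩
    · by_cases ha : a = a₀
      · subst ha
        rw [div_mul_cancel₀ _ (prod_erase_sub_ne_zero hl a)]
      · have h1 : r a = 0 := by
          have := hs a
          rw [hs0] at this
          refine (mul_eq_zero.1 this.symm).resolve_right (sub_ne_zero.2 fun h => ha (hl h.symm))
        rw [h1, Finset.prod_eq_zero (Finset.mem_erase.2 ⟨fun h => ha h.symm, Finset.mem_univ a₀⟩)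
          (sub_self _), mul_zero]
    · rw [hs0, Finset.prod_eq_zero (Finset.mem_univ a₀) (sub_self _), mul_zero]
  · push Not at hc
    have hne : ∀ a, c - l a ≠ 0 := fun a => sub_ne_zero.2 (hc a)
    have hp : ∏ a, (c - l a) ≠ 0 := Finset.prod_ne_zero_iff.2 fun a _ => hne a
    refine ⟨s / ∏ a, (c - l a), fun a => ?_, by rw [div_mul_cancel₀ _ hp]⟩
    rw [← Finset.mul_prod_erase _ _ (Finset.mem_univ a)] at hp ⊢
    have := hne a
    have h2 := right_ne_zero_of_mul hp
    rw [hs a]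
    field_simp

/-- A point with `A = diag(λ)` and last row of `hatA` equal to `(1, …, 1, *)` is the normal
form. -/
theorem IsCoord.eq_sec {τ : ℂ} {x : Ambient k} {y : CoordSpace k} (hy : y ∈ coordReg k)
    (h : IsCoord τ x y) (hA : matA x = diagonal (lam y)) (hq : ∀ b, matJ x 1 b = 1) :
    x = sec τ y := by
  obtain ⟨B₁, B₂, u, h, g, hB, h1, h2, h3, h4, h5, h6⟩ := h
  have h5' : g.val * hatA x = diagonal (lamHat y) * g.val := by
    rw [← h5]; simp [Matrix.mul_assoc]
  -- The rows of `g` are proportional to those of `eigG y`.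
  have hrow : ∀ b, ∃ κ : ℂ, ∀ i, g.val b i = κ * eigG y b i := by
    intro b
    obtain ⟨κ, hκ, hκ'⟩ := exists_left_eigenvector_eq_smul hy.1 (c := lamHat y b)
      (r := fun a => g.val b (Sum.inl a)) (s := g.val b (Sum.inr ())) fun a => by
        have h := congrFun (congrFun h5' b) (Sum.inl a)
        rw [diagonal_mul, Matrix.mul_apply, Fintype.sum_sum_type] at h
        simpa [hatA, hA, hq, diagonal_apply] using h
    have hne := prod_erase_sub_ne_zero hy.2 b
    refine ⟨κ * ∏ c ∈ Finset.univ.erase b, (lamHat y b - lamHat y c), fun i => ?_⟩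
    rcases i with a | i
    · rw [hκ a, eigG, of_apply, Sum.elim_inl]; field_simp
    · rw [hκ', eigG, of_apply, Sum.elim_inr]; field_simp
  choose κ hκ using hrow
  have hgG : g.val = diagonal κ * eigG y := by
    ext b i; rw [diagonal_mul, hκ]
  have hκ0 : ∀ b, κ b ≠ 0 := by
    intro b h0
    have := congrFun (congrFun (Units.mul_inv g) b) b
    rw [Matrix.mul_apply] at this
    simp [hκ, h0] at this
  have hdiag : diagonal κ⁻¹ * diagonal κ = (1 : Matrix (Idx k) (Idx k) ℂ) := by
    rw [diagonal_mul_diagonal, ← diagonal_one]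
    congr 1; ext b; simp [hκ0 b]
  have hG : eigG y = diagonal κ⁻¹ * g.val := by
    rw [hgG, ← Matrix.mul_assoc, hdiag, Matrix.one_mul]
  have hP : eigP y = g⁻¹.val * diagonal κ := by
    have e1 : eigG y * (g⁻¹.val * diagonal κ) = 1 := by
      rw [hG, Matrix.mul_assoc, ← Matrix.mul_assoc g.val, Units.mul_inv, Matrix.one_mul, hdiag]
    rw [← Matrix.one_mul (g⁻¹.val * diagonal κ), ← eigP_mul_eigG hy, Matrix.mul_assoc, e1,
      Matrix.mul_one]
  have hAsec : hatA x = secA y := by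
    refine eq_secA hy ?_
    rw [hG, Matrix.mul_assoc, h5', ← Matrix.mul_assoc, ← Matrix.mul_assoc, diagonal_mul_diagonal,
      diagonal_mul_diagonal]
    simp only [mul_comm]
  have hB₁ : B₁ = diagonal (mu y) := by
    have hoff : ∀ a b, a ≠ b → B₁ a b = 0 := by
      intro a b hab
      have := congrFun (congrFun h1 a) b
      rw [hA, Matrix.sub_apply, diagonal_mul, mul_diagonal, Matrix.zero_apply] at this
      have h' : lam y a - lam y b ≠ 0 := sub_ne_zero.2 fun h => hab (hy.1 h)
      refine (mul_eq_zero.1 (?_ : (lam y a - lam y b) * B₁ a b = 0)).resolve_left h'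
      linear_combination this
    have hdg : (fun a => B₁ a a) = mu y := eq_of_sum_mul_pow_eq hy.1 fun r _ => by
      rw [← trace_pow_of_conj (e := mu y) h3 (fun b => by rw [h4, diagonal_apply_eq]),
        ← trace_pow_of_conj (M := matA x) (N := B₁) (e := fun a => B₁ a a) (g := 1)
          (d := lam y) (by simp [hA]) (fun b => by simp)]
    ext a b
    by_cases hab : a = b
    · subst hab; rw [diagonal_apply_eq, ← hdg]
    · rw [diagonal_apply_ne _ hab, hoff a b hab]
  have hB₂ : B₂ = secB₂ τ y := by
    rw [lastCol_eq, hAsec] at h2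
    set v : Idx k → ℂ := Sum.elim (fun a => u a ()) 0
    set N := eigG y * B₂ * eigP y with hN
    have hdN : ∀ b, N b b = muHat y b := by
      intro b
      rw [← h6 b, hN, hG, hP, ← Matrix.mul_assoc, mul_diagonal, Matrix.mul_assoc,
        Matrix.mul_assoc, diagonal_mul, ← Matrix.mul_assoc]
      have := hκ0 b
      simp only [Pi.inv_apply]
      field_simp
    have hNc : diagonal (lamHat y) * N - N * diagonal (lamHat y) =
        eigG y * (tauHat k τ + lastCol v) * eigP y := by
      rw [← h2, hN, Matrix.mul_sub, Matrix.sub_mul, ← Matrix.mul_assoc (eigG y) (secA y),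
        eigG_mul_secA hy, Matrix.mul_assoc (eigG y) (B₂ * secA y), Matrix.mul_assoc B₂,
        secA_mul_eigP hy]
      simp only [Matrix.mul_assoc]
    have hv : v = secU τ y := by
      have h7 : eigG y *ᵥ v = -fun b => (eigG y * tauHat k τ * eigP y) b b := by
        ext b
        have := congrFun (congrFun hNc b) b
        rw [Matrix.sub_apply, diagonal_mul, mul_diagonal, Matrix.mul_add, Matrix.add_mul,
          Matrix.add_apply, conj_lastCol _ _ (eigP_inr y ())] at this
        rw [Pi.neg_apply]
        linear_combination -this
      rw [secU, ← mulVec_neg, ← h7, mulVec_mulVec, eigP_mul_eigG hy, one_mulVec]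
    have hNs : N = secN τ y := (eq_secN_iff hy τ).2 ⟨hdN, by rw [hNc, hv, secC]⟩
    rw [secB₂, ← hNs, hN, Matrix.mul_assoc, Matrix.mul_assoc, eigP_mul_eigG hy, Matrix.mul_one,
      ← Matrix.mul_assoc, eigP_mul_eigG hy, Matrix.one_mul]
  exact ext_hat (by rw [hAsec, hatA_sec]) (by rw [hB, hatB_sec, hB₁, hB₂])

/-- Every point with coordinates `y` lies in the orbit of the normal form. -/
theorem IsCoord.exists_act_sec {τ : ℂ} {x : Ambient k} {y : CoordSpace k} (hx : x ∈ regLevel k τ)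
    (hy : y ∈ coordReg k) (h : IsCoord τ x y) :
    ∃ L : GL (Fin k) ℂ, Instanton.act L (sec τ y) = x := by
  have hN := (isStronglySemisimple_hatA_iff.1 hx.2).1
  obtain ⟨h₀, hA⟩ : ∃ h : GL (Fin k) ℂ, h.val * matA x * h⁻¹.val = diagonal (lam y) := by
    obtain ⟨_, _, _, h, _, _, _, _, h3, -⟩ := h
    exact ⟨h, h3⟩
  have hq := (noEig_iff hy.1 hA).1 hN
  set q := matJ x 1 ᵥ* h₀⁻¹.val with hqdef
  let D : GL (Fin k) ℂ := ⟨diagonal q, diagonal q⁻¹, by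
    rw [diagonal_mul_diagonal, ← diagonal_one]; congr 1; ext a; simp [hq a], by
    rw [diagonal_mul_diagonal, ← diagonal_one]; congr 1; ext a; simp [hq a]⟩
  have hsec := (h.act (D * h₀)).eq_sec hy ?_ ?_
  · refine ⟨(D * h₀)⁻¹, ?_⟩
    rw [← hsec, ← act_mul, inv_mul_cancel, act_one]
  · rw [act_mul]
    change diagonal q * (h₀.val * matA x * h₀⁻¹.val) * diagonal q⁻¹ = _
    rw [hA, diagonal_mul_diagonal, diagonal_mul_diagonal]
    congr 1; ext a
    rw [Pi.inv_apply, mul_right_comm, mul_inv_cancel₀ (hq a), one_mul]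
  · intro b
    rw [act_mul]
    change (matJ x * h₀⁻¹.val * diagonal q⁻¹) 1 b = 1
    rw [mul_diagonal, mul_apply_eq_vecMul]
    exact mul_inv_cancel₀ (hq b)

/-! ### The coordinate map -/

theorem exists_coordMap (k : ℕ) (τ : ℂ) : ∃ π : NReg k τ → CoordQuot k, Function.Bijective π ∧
    ∀ (x : regLevel k τ) (y : coordReg k),
      π (Quotient.mk _ x) = Quotient.mk _ y ↔ IsCoord τ x.1 y.1 := by
  choose c hc hcx using fun x : regLevel k τ => exists_isCoord x.2
  have hperm : ∀ (x : Ambient k) (y y' : coordReg k), permRel k y y' → IsCoord τ x y →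
      IsCoord τ x y' := by
    rintro x y y' ⟨σ, ρ, h⟩ hx
    rw [← h]
    exact hx.perm σ ρ
  have hsound : ∀ x x' : regLevel k τ, orbitRel (regLevel k τ) x x' →
      Quotient.mk (permRel k) ⟨c x, hc x⟩ = Quotient.mk (permRel k) ⟨c x', hc x'⟩ := by
    rintro x x' ⟨L, h⟩
    have h1 : IsCoord τ x' (c x) := by rw [← h]; exact (hcx x).act L
    exact Quotient.sound (h1.unique x'.2 (hc x') (hcx x'))
  let π : NReg k τ → CoordQuot k := Quotient.lift (fun x => Quotient.mk _ ⟨c x, hc x⟩) hsound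
  have hiff : ∀ (x : regLevel k τ) (y : coordReg k),
      π (Quotient.mk _ x) = Quotient.mk _ y ↔ IsCoord τ x.1 y.1 := by
    intro x y
    constructor
    · intro h
      exact hperm _ _ _ (Quotient.exact h) (hcx x)
    · intro h
      exact Quotient.sound ((hcx x).unique x.2 y.2 h)
  refine ⟨π, ⟨?_, ?_⟩, hiff⟩
  · intro p p' hpp
    induction p using Quotient.inductionOn with | _ x => ?_
    induction p' using Quotient.inductionOn with | _ x' => ?_
    obtain ⟨L, hL⟩ := (hcx x').exists_act_sec x'.2 (hc x')
    have h1 : IsCoord τ x (c x') := (hiff x ⟨c x', hc x'⟩).1 hpp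
    obtain ⟨L', hL'⟩ := h1.exists_act_sec x.2 (hc x')
    refine Quotient.sound ⟨L * L'⁻¹, ?_⟩
    rw [← hL', ← act_mul, inv_mul_cancel_right, hL]
  · intro q
    induction q using Quotient.inductionOn with | _ y => ?_
    exact ⟨Quotient.mk _ ⟨sec τ y, sec_mem_regLevel y.2 τ⟩, (hiff _ _).2 (isCoord_sec y.2 τ)⟩

/-! ### Symmetric functions of several sets of variables -/

/-- Let `F` be a set of functions closed under multiplication and with sums in `S`. Then sums of
products over injective tuples also lie in `S`, by induction on the length of the tuple: extending
an injective tuple by one entry amounts to a sum over all entries minus the sums over the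
coincidences with earlier entries. -/
theorem sum_embedding_mem {R n : Type*} [CommRing R] [Fintype n] [DecidableEq n] (S : Subring R)
    (F : Subsemigroup (n → R)) (hF : ∀ f ∈ F, ∑ a, f a ∈ S) (ι : Type) [Fintype ι] :
    ∀ φ : ι → n → R, (∀ i, φ i ∈ F) → ∑ e : ι ↪ n, ∏ i, φ i (e i) ∈ S := by
  classical
  refine Fintype.induction_empty_option (P := fun ι _ => ∀ φ : ι → n → R, (∀ i, φ i ∈ F) →
    ∑ e : ι ↪ n, ∏ i, φ i (e i) ∈ S) ?_ ?_ ?_ ι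
  · intro α β _ e h φ hφ
    let _ := Fintype.ofEquiv β e.symm
    have := h (φ ∘ e) fun i => hφ _
    rw [← (Equiv.embeddingCongr e (Equiv.refl n)).symm.sum_comp] at this
    convert this using 2 with f
    rw [← e.prod_comp]
    simp
  · intro φ _
    simp
  · intro α _ ih φ hφ
    have key : ∑ e : Option α ↪ n, ∏ i, φ i (e i) =
        (∑ a, φ none a) * ∑ f : α ↪ n, ∏ i, φ (some i) (f i) -
          ∑ j, ∑ f : α ↪ n, ∏ i, Function.update (φ ∘ some) j (φ (some j) * φ none) i (f i) := by
      rw [← (Function.Embedding.optionEmbeddingEquiv α n).symm.sum_comp, Fintype.sum_sigma,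
        Finset.sum_comm (s := Finset.univ (α := α)), Finset.mul_sum, ← Finset.sum_sub_distrib]
      refine Finset.sum_congr rfl fun f _ => ?_
      have h1 : ∀ a : ↥(Set.range f)ᶜ, ∏ i, φ i ((Function.Embedding.optionEmbeddingEquiv α n).symm
          ⟨f, a⟩ i) = φ none a * ∏ i, φ (some i) (f i) := by
        intro a
        rw [Fintype.prod_option]
        rfl
      have h2 : ∀ j, ∏ i, Function.update (φ ∘ some) j (φ (some j) * φ none) i (f i) =
          φ none (f j) * ∏ i, φ (some i) (f i) := by
        intro j
        rw [← Finset.mul_prod_erase _ _ (Finset.mem_univ j),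
          ← Finset.mul_prod_erase _ (fun i => φ (some i) (f i)) (Finset.mem_univ j)]
        rw [Finset.prod_congr rfl fun i hi => by
          rw [Function.update_of_ne (Finset.ne_of_mem_erase hi)]]
        simp
        ring
      simp only [h1, h2, ← Finset.sum_mul, ← sub_mul]
      congr 1
      rw [eq_sub_iff_add_eq, ← Fintype.sum_subtype_add_sum_subtype (· ∈ Set.range f) (φ none),
        add_comm]
      congr 1
      convert (Equiv.ofInjective f f.injective).sum_comp fun a => φ none a
      rfl
    rw [key]
    refine S.sub_mem (S.mul_mem (hF _ (hφ _)) (ih _ fun i => hφ _))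
      (S.sum_mem fun j _ => ih _ fun i => ?_)
    by_cases hij : i = j
    · subst hij; rw [Function.update_self]; exact F.mul_mem (hφ _) (hφ _)
    · rw [Function.update_of_ne hij]; exact hφ _

theorem sum_perm_mem {R n : Type} [CommRing R] [Fintype n] [DecidableEq n] (S : Subring R)
    (F : Subsemigroup (n → R)) (hF : ∀ f ∈ F, ∑ a, f a ∈ S) (φ : n → n → R) (hφ : ∀ i, φ i ∈ F) :
    ∑ σ : Equiv.Perm n, ∏ i, φ i (σ i) ∈ S := by
  have := sum_embedding_mem S F hF n φ hφ
  rwa [← (Equiv.embeddingEquivOfFinite n).symm.sum_comp] at this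

/-! ### Invariant polynomials in the coordinates -/

/-- The action of `S_k × S_{k+1}` on the coordinate space. -/
def permLin (γ : Equiv.Perm (Fin k) × Equiv.Perm (Idx k)) : CoordSpace k →ₗ[ℂ] CoordSpace k where
  toFun y := ((lam y ∘ γ.1, mu y ∘ γ.1), (lamHat y ∘ γ.2, muHat y ∘ γ.2))
  map_add' _ _ := rfl
  map_smul' _ _ := rfl

/-- The functions of the coordinates that define a regular function on `regLevel k τ`. -/
def liftable (k : ℕ) (τ : ℂ) : Subalgebra ℂ (CoordSpace k → ℂ) where
  carrier := {f | ∃ R ∈ regFun (regLevel k τ), ∀ (x : regLevel k τ) (y : CoordSpace k),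
    y ∈ coordReg k → IsCoord τ x.1 y → R x = f y}
  mul_mem' := by
    rintro f g ⟨R, hR, h⟩ ⟨R', hR', h'⟩
    exact ⟨R * R', mul_mem hR hR', fun x y hy hx => by
      rw [Pi.mul_apply, Pi.mul_apply, h x y hy hx, h' x y hy hx]⟩
  add_mem' := by
    rintro f g ⟨R, hR, h⟩ ⟨R', hR', h'⟩
    exact ⟨R + R', add_mem hR hR', fun x y hy hx => by
      rw [Pi.add_apply, Pi.add_apply, h x y hy hx, h' x y hy hx]⟩
  algebraMap_mem' c := ⟨_, (regFun _).algebraMap_mem c, fun _ _ _ _ => rfl⟩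

theorem EntriesIn.of_linear {X V : Type*} [AddCommGroup V] [Module ℂ V] {S : Subalgebra ℂ (X → ℂ)}
    {F : X → V} (hF : ∀ φ : Module.Dual ℂ V, (fun x => φ (F x)) ∈ S) {m n : Type*}
    (T : V →ₗ[ℂ] Matrix m n ℂ) : EntriesIn S fun x => T (F x) :=
  fun i j => hF (entryLin m n i j ∘ₗ T)

theorem linear_comp_mem {X : Type*} {S : Subalgebra ℂ (X → ℂ)} {m n : Type*} [Fintype m] [Fintype n]
    [DecidableEq m] [DecidableEq n] {F : X → Matrix m n ℂ} (hF : EntriesIn S F)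
    (φ : Matrix m n ℂ →ₗ[ℂ] ℂ) : (fun x => φ (F x)) ∈ S := by
  have : (fun x => φ (F x)) = ∑ i, ∑ j, φ (Matrix.single i j 1) • fun x => F x i j := by
    ext x
    conv_lhs => rw [matrix_eq_sum_single (F x)]
    simp only [map_sum, Finset.sum_apply, Pi.smul_apply, smul_eq_mul]
    refine Finset.sum_congr rfl fun i _ => Finset.sum_congr rfl fun j _ => ?_
    rw [← mul_one (F x i j), ← smul_eq_mul, ← smul_single, map_smul, smul_eq_mul, smul_eq_mul,
      mul_one, mul_comm]
  rw [this]
  exact sum_mem fun i _ => sum_mem fun j _ => S.smul_mem (hF i j) _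

theorem entriesIn_hatA (X : Set (Ambient k)) : EntriesIn (regFun X) fun x => hatA x.1 :=
  EntriesIn.of_linear (fun φ => linear_mem_regFun φ) (hatALin k)

theorem entriesIn_hatB (X : Set (Ambient k)) : EntriesIn (regFun X) fun x => hatB x.1 :=
  EntriesIn.of_linear (fun φ => linear_mem_regFun φ) (hatBLin k)

theorem entriesIn_matA (X : Set (Ambient k)) : EntriesIn (regFun X) fun x => matA x.1 :=
  fun i j => entriesIn_hatA X (Sum.inl i) (Sum.inl j)

/-- A linear combination of powers of a matrix-valued function. -/
theorem entriesIn_sum_pow {X : Type*} {S : Subalgebra ℂ (X → ℂ)} {n : Type*} [Fintype n]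
    [DecidableEq n] {F : X → Matrix n n ℂ} (hF : EntriesIn S F) {N : ℕ} {c : X → Fin N → ℂ}
    (hc : ∀ r, (fun x => c x r) ∈ S) : EntriesIn S fun x => ∑ r, c x r • F x ^ (r : ℕ) := by
  intro i j
  have := sum_mem (t := Finset.univ) (S := S) fun r _ => S.mul_mem (hc r) (hF.pow r i j)
  convert this using 1
  ext x
  simp [Matrix.sum_apply]

/-- The matrix `B₁` as a function of the point: the polynomial in `A` that agrees with
`[hatA, hatB]` on the last row. -/
def matB₁ (x : Ambient k) : Matrix (Fin k) (Fin k) ℂ :=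
  ∑ r, (((hatA x * hatB x - hatB x * hatA x).toBlocks₂₁ () ᵥ* (krylov (matA x) (matJ x 1))⁻¹) r) •
    matA x ^ (r : ℕ)

/-- The part of `B₂` that is diagonal in an eigenbasis of `hatA`, as a function of the point: the
polynomial in `hatA` with the same traces against powers of `hatA` as `B₂`. -/
def diagB₂ (x : Ambient k) : Matrix (Idx k) (Idx k) ℂ :=
  ∑ r, (((traceForm (hatA x))⁻¹ *ᵥ fun s =>
    ((hatB x - incl (matB₁ x)) * hatA x ^ (s : ℕ)).trace) r) • hatA x ^ (r : ℕ)

theorem entriesIn_matB₁ (k : ℕ) (τ : ℂ) : EntriesIn (regFun (regLevel k τ)) fun x => matB₁ x.1 := by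
  have hA := entriesIn_matA (regLevel k τ)
  have hj : EntriesIn (regFun (regLevel k τ)) fun x => of fun (_ : Unit) b => matJ x.1 1 b :=
    fun i j => entriesIn_hatA _ (Sum.inr ()) (Sum.inl j)
  have hkry : EntriesIn (regFun (regLevel k τ)) fun x => krylov (matA x.1) (matJ x.1 1) :=
    fun r b => (hj.mul (hA.pow r)) () b
  have hc : EntriesIn (regFun (regLevel k τ)) fun x =>
      (hatA x.1 * hatB x.1 - hatB x.1 * hatA x.1).toBlocks₂₁ := fun i j =>
    sub_mem ((entriesIn_hatA _).mul (entriesIn_hatB _) (Sum.inr i) (Sum.inl j))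
      ((entriesIn_hatB _).mul (entriesIn_hatA _) (Sum.inr i) (Sum.inl j))
  refine entriesIn_sum_pow hA fun r => ?_
  refine (hc.mul (hkry.inv fun x => ?_)) () r
  have := isStronglySemisimple_hatA_iff.1 x.2.2
  exact (noEig_iff_det_krylov this.2.1).1 this.1

theorem entriesIn_diagB₂ (k : ℕ) (τ : ℂ) :
    EntriesIn (regFun (regLevel k τ)) fun x => diagB₂ x.1 := by
  have hA := entriesIn_hatA (regLevel k τ)
  have hB : EntriesIn (regFun (regLevel k τ)) fun x => hatB x.1 - incl (matB₁ x.1) := by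
    rintro (i | i) (j | j)
    · exact sub_mem (entriesIn_hatB _ _ _) (entriesIn_matB₁ k τ i j)
    all_goals exact sub_mem (entriesIn_hatB _ _ _) (zero_mem _)
  have hT : EntriesIn (regFun (regLevel k τ)) fun x => traceForm (hatA x.1) := fun i j =>
    (hA.pow _).trace
  have ht : EntriesIn (regFun (regLevel k τ)) fun x =>
      of fun (s : Fin (Fintype.card (Idx k))) (_ : Unit) =>
        ((hatB x.1 - incl (matB₁ x.1)) * hatA x.1 ^ (s : ℕ)).trace :=
    fun i j => (hB.mul (hA.pow _)).trace
  refine entriesIn_sum_pow hA fun r => ?_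
  refine ((hT.inv fun x => ?_).mul ht) r ()
  exact isRegularSemisimple_iff.1 (isStronglySemisimple_hatA_iff.1 x.2.2).2.2

theorem conj_pow {n : Type*} [Fintype n] [DecidableEq n] {M : Matrix n n ℂ} {d : n → ℂ} {g : GL n ℂ}
    (h : g.val * M * g⁻¹.val = diagonal d) (r : ℕ) :
    g.val * M ^ r * g⁻¹.val = diagonal (d ^ r) := by
  rw [pow_of_conj h]
  simp [← Matrix.mul_assoc]

theorem conj_sum_smul_pow {n : Type*} [Fintype n] [DecidableEq n] {M : Matrix n n ℂ} {d : n → ℂ}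
    {g : GL n ℂ} (h : g.val * M * g⁻¹.val = diagonal d) {N : ℕ} (c : Fin N → ℂ) :
    g.val * (∑ r, c r • M ^ (r : ℕ)) * g⁻¹.val = diagonal fun a => ∑ r, c r * d a ^ (r : ℕ) := by
  simp only [Finset.mul_sum, Finset.sum_mul, Matrix.mul_smul, Matrix.smul_mul, conj_pow h]
  ext i j
  rw [Matrix.sum_apply]
  by_cases hij : i = j
  · subst hij; simp
  · simp [hij]

/-- `matB₁` is the matrix `B₁` of any decomposition of `hatB`. -/
theorem matB₁_eq {τ : ℂ} {x : Ambient k} (hx : x ∈ regLevel k τ)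
    {B₁ : Matrix (Fin k) (Fin k) ℂ} {B₂ : Matrix (Idx k) (Idx k) ℂ} {u : Matrix (Fin k) Unit ℂ}
    (hB : hatB x = incl B₁ + B₂) (h1 : matA x * B₁ - B₁ * matA x = 0)
    (h2 : hatA x * B₂ - B₂ * hatA x = tauHat k τ + fromBlocks 0 u 0 0) : matB₁ x = B₁ := by
  have hss := isStronglySemisimple_hatA_iff.1 hx.2
  have hw : (hatA x * hatB x - hatB x * hatA x).toBlocks₂₁ () = matJ x 1 ᵥ* B₁ := by
    rw [hB, Matrix.mul_add, Matrix.add_mul, add_sub_add_comm, h2, comm_incl]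
    ext b
    simp [toBlocks₂₁, tauHat, Matrix.mul_apply, vecMul, dotProduct]
  have hcomm : Commute (matA x) (matB₁ x) :=
    Commute.sum_right _ _ _ fun r _ => ((Commute.refl _).pow_right _).smul_right _
  rw [← sub_eq_zero]
  refine hss.1.eq_zero_of_intertwines (A' := matA x) ?_ ?_
  · rw [Matrix.mul_sub, Matrix.sub_mul, hcomm.eq, sub_eq_zero.1 h1]
  · rw [vecMul_sub, sub_eq_zero]
    have : matJ x 1 ᵥ* matB₁ x =
        ((hatA x * hatB x - hatB x * hatA x).toBlocks₂₁ () ᵥ* (krylov (matA x) (matJ x 1))⁻¹) ᵥ*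
          krylov (matA x) (matJ x 1) := by
      ext b
      simp only [matB₁, vecMul, dotProduct, Matrix.sum_apply, Matrix.smul_apply, smul_eq_mul,
        Finset.mul_sum, krylov, of_apply]
      rw [Finset.sum_comm]
      exact Finset.sum_congr rfl fun r _ => Finset.sum_congr rfl fun a _ => by ring
    rw [this, vecMul_vecMul, nonsing_inv_mul _ (isUnit_iff_ne_zero.2
      ((noEig_iff_det_krylov hss.2.1).1 hss.1)), vecMul_one, hw]

theorem IsCoord.conj_matB₁ {τ : ℂ} {x : Ambient k} {y : CoordSpace k} (hx : x ∈ regLevel k τ)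
    (h : IsCoord τ x y) : ∃ h : GL (Fin k) ℂ, h.val * matA x * h⁻¹.val = diagonal (lam y) ∧
      h.val * matB₁ x * h⁻¹.val = diagonal (mu y) := by
  obtain ⟨B₁, B₂, u, h, g, hB, h1, h2, h3, h4, -⟩ := h
  exact ⟨h, h3, by rw [matB₁_eq hx hB h1 h2, h4]⟩

theorem IsCoord.conj_diagB₂ {τ : ℂ} {x : Ambient k} {y : CoordSpace k} (hx : x ∈ regLevel k τ)
    (hy : y ∈ coordReg k) (h : IsCoord τ x y) : ∃ g : GL (Idx k) ℂ,
      g.val * hatA x * g⁻¹.val = diagonal (lamHat y) ∧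
      g.val * diagB₂ x * g⁻¹.val = diagonal (muHat y) := by
  obtain ⟨B₁, B₂, u, h, g, hB, h1, h2, h3, h4, h5, h6⟩ := h
  have hss := isStronglySemisimple_hatA_iff.1 hx.2
  have hB₂ : hatB x - incl (matB₁ x) = B₂ := by
    rw [matB₁_eq hx hB h1 h2, hB, add_sub_cancel_left]
  refine ⟨g, h5, ?_⟩
  have hc := conj_sum_smul_pow h5 ((traceForm (hatA x))⁻¹ *ᵥ fun s =>
    ((hatB x - incl (matB₁ x)) * hatA x ^ (s : ℕ)).trace)
  rw [diagB₂, hc]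
  congr 1
  refine eq_of_sum_mul_pow_eq hy.2 fun r hr => ?_
  rw [← trace_pow_of_conj h5 (fun b => by rw [hc, diagonal_apply_eq]), ← trace_pow_of_conj h5 h6]
  have h7 : traceForm (hatA x) *ᵥ ((traceForm (hatA x))⁻¹ *ᵥ fun s =>
      ((hatB x - incl (matB₁ x)) * hatA x ^ (s : ℕ)).trace) =
      fun s : Fin (Fintype.card (Idx k)) =>
      ((hatB x - incl (matB₁ x)) * hatA x ^ (s : ℕ)).trace := by
    rw [mulVec_mulVec, mul_nonsing_inv _ (isUnit_iff_ne_zero.2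
      (isRegularSemisimple_iff.1 hss.2.2)), one_mulVec]
  have h8 := congrFun h7 ⟨r, hr⟩
  rw [hB₂] at h8 ⊢
  rw [← h8, Finset.sum_mul, trace_sum]
  simp only [mulVec, dotProduct, traceForm, of_apply]
  refine Finset.sum_congr rfl fun j _ => ?_
  rw [smul_mul_assoc, trace_smul, smul_eq_mul, ← pow_add, mul_comm, add_comm]

theorem sum_lam_mem_liftable (τ : ℂ) (m n : ℕ) :
    (fun y : CoordSpace k => ∑ a, lam y a ^ m * mu y a ^ n) ∈ liftable k τ := by
  refine ⟨fun x => (matB₁ x.1 ^ n * matA x.1 ^ m).trace,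
    (((entriesIn_matB₁ k τ).pow n).mul ((entriesIn_matA _).pow m)).trace, fun x y _ h => ?_⟩
  obtain ⟨h, h1, h2⟩ := h.conj_matB₁ x.2
  refine (trace_pow_of_conj h1 (fun b => by rw [conj_pow h2, diagonal_apply_eq]) _).trans ?_
  exact Finset.sum_congr rfl fun a _ => mul_comm _ _

theorem sum_lamHat_mem_liftable (τ : ℂ) (m n : ℕ) :
    (fun y : CoordSpace k => ∑ a, lamHat y a ^ m * muHat y a ^ n) ∈ liftable k τ := by
  refine ⟨fun x => (diagB₂ x.1 ^ n * hatA x.1 ^ m).trace,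
    (((entriesIn_diagB₂ k τ).pow n).mul ((entriesIn_hatA _).pow m)).trace, fun x y hy h => ?_⟩
  obtain ⟨h, h1, h2⟩ := h.conj_diagB₂ x.2 hy
  refine (trace_pow_of_conj h1 (fun b => by rw [conj_pow h2, diagonal_apply_eq]) _).trans ?_
  exact Finset.sum_congr rfl fun a _ => mul_comm _ _

/-- The symmetrisation of a monomial is a product of two sums over permutations. -/
theorem sum_monomial_mem_liftable (τ : ℂ) (m n : Fin k → ℕ) (m' n' : Idx k → ℕ) :
    (∑ γ : Equiv.Perm (Fin k) × Equiv.Perm (Idx k), fun y : CoordSpace k =>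
      (∏ a, lam y (γ.1 a) ^ m a * mu y (γ.1 a) ^ n a) *
        ∏ b, lamHat y (γ.2 b) ^ m' b * muHat y (γ.2 b) ^ n' b) ∈ liftable k τ := by
  have h1 := sum_perm_mem (liftable k τ).toSubring
    { carrier := {f : Fin k → CoordSpace k → ℂ | ∃ m n : ℕ, f = fun a y => lam y a ^ m * mu y a ^ n}
      mul_mem' := by
        rintro _ _ ⟨m, n, rfl⟩ ⟨m', n', rfl⟩
        exact ⟨m + m', n + n', by ext a y; simp only [Pi.mul_apply]; ring⟩ }
    (by
      rintro _ ⟨m, n, rfl⟩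
      have h := sum_lam_mem_liftable (k := k) τ m n
      rw [← Finset.sum_fn] at h
      exact h)
    (fun a b y => lam y b ^ m a * mu y b ^ n a) fun a => ⟨m a, n a, rfl⟩
  have h2 := sum_perm_mem (liftable k τ).toSubring
    { carrier := {f : Idx k → CoordSpace k → ℂ |
        ∃ m n : ℕ, f = fun a y => lamHat y a ^ m * muHat y a ^ n}
      mul_mem' := by
        rintro _ _ ⟨m, n, rfl⟩ ⟨m', n', rfl⟩
        exact ⟨m + m', n + n', by ext a y; simp only [Pi.mul_apply]; ring⟩ }
    (by
      rintro _ ⟨m, n, rfl⟩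
      have h := sum_lamHat_mem_liftable (k := k) τ m n
      rw [← Finset.sum_fn] at h
      exact h)
    (fun a b y => lamHat y b ^ m' a * muHat y b ^ n' a) fun a => ⟨m' a, n' a, rfl⟩
  convert (liftable k τ).mul_mem h1 h2 using 1
  rw [Fintype.sum_prod_type, Finset.sum_mul_sum]
  refine Finset.sum_congr rfl fun σ _ => Finset.sum_congr rfl fun ρ _ => ?_
  ext y
  simp

/-- The coordinate functions. -/
def coordFuns (k : ℕ) : Set (CoordSpace k → ℂ) :=
  {f | (∃ a, f = fun y => lam y a) ∨ (∃ a, f = fun y => mu y a) ∨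
    (∃ b, f = fun y => lamHat y b) ∨ ∃ b, f = fun y => muHat y b}

theorem polyFun_le_adjoin_coordFuns : polyFun (CoordSpace k) ≤ Algebra.adjoin ℂ (coordFuns k) := by
  refine Algebra.adjoin_le ?_
  rintro _ ⟨φ, rfl⟩
  have h1 : ∀ {n : Type} [Fintype n] (T : (n → ℂ) →ₗ[ℂ] CoordSpace k) (c : CoordSpace k → n → ℂ),
      (∀ a, (fun y => c y a) ∈ coordFuns k) →
      (fun y => φ (T (c y))) ∈ Algebra.adjoin ℂ (coordFuns k) := by
    intro n _ T c hc
    classical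
    have : (fun y => φ (T (c y))) =
        ∑ a, φ (T fun j => if a = j then 1 else 0) • fun y => c y a := by
      ext y
      have := LinearMap.pi_apply_eq_sum_univ (φ ∘ₗ T) (c y)
      rw [LinearMap.comp_apply] at this
      rw [this]
      simp [mul_comm]
    rw [this]
    exact sum_mem fun a _ => Subalgebra.smul_mem _ (Algebra.subset_adjoin (hc a)) _
  have h2 : (φ : CoordSpace k → ℂ) =
      (fun y => φ ((LinearMap.inl ℂ _ _ ∘ₗ LinearMap.inl ℂ _ _) (lam y))) +
      (fun y => φ ((LinearMap.inl ℂ _ _ ∘ₗ LinearMap.inr ℂ _ _) (mu y))) +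
      (fun y => φ ((LinearMap.inr ℂ _ _ ∘ₗ LinearMap.inl ℂ _ _) (lamHat y))) +
      fun y => φ ((LinearMap.inr ℂ _ _ ∘ₗ LinearMap.inr ℂ _ _) (muHat y)) := by
    ext y
    simp only [Pi.add_apply, ← map_add]
    congr 1
    ext <;> simp
  change (φ : CoordSpace k → ℂ) ∈ _
  rw [h2]
  refine add_mem (add_mem (add_mem (h1 _ _ fun a => ?_) (h1 _ _ fun a => ?_)) (h1 _ _ fun a => ?_))
    (h1 _ _ fun a => ?_)
  · exact Or.inl ⟨a, rfl⟩
  · exact Or.inr (Or.inl ⟨a, rfl⟩)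
  · exact Or.inr (Or.inr (Or.inl ⟨a, rfl⟩))
  · exact Or.inr (Or.inr (Or.inr ⟨a, rfl⟩))

theorem exists_monomial_of_mem_closure {f : CoordSpace k → ℂ}
    (hf : f ∈ Submonoid.closure (coordFuns k)) : ∃ (m n : Fin k → ℕ) (m' n' : Idx k → ℕ),
      f = fun y => (∏ a, lam y a ^ m a * mu y a ^ n a) *
        ∏ b, lamHat y b ^ m' b * muHat y b ^ n' b := by
  induction hf using Submonoid.closure_induction with
  | mem f hf =>
    rcases hf with ⟨a, rfl⟩ | ⟨a, rfl⟩ | ⟨a, rfl⟩ | ⟨a, rfl⟩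
    · refine ⟨Pi.single a 1, 0, 0, 0, ?_⟩
      ext y; simp [Pi.single_apply, Finset.prod_ite_eq']
    · refine ⟨0, Pi.single a 1, 0, 0, ?_⟩
      ext y; simp [Pi.single_apply]
    · refine ⟨0, 0, Pi.single a 1, 0, ?_⟩
      ext y; simp [Pi.single_apply]
    · refine ⟨0, 0, 0, Pi.single a 1, ?_⟩
      ext y; simp [Pi.single_apply]
  | one => exact ⟨0, 0, 0, 0, by ext y; simp⟩
  | mul f g _ _ hf hg =>
    obtain ⟨m, n, m', n', rfl⟩ := hf
    obtain ⟨p, q, p', q', rfl⟩ := hg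
    refine ⟨m + p, n + q, m' + p', n' + q', ?_⟩
    ext y
    simp only [Pi.mul_apply, Pi.add_apply, pow_add, Finset.prod_mul_distrib]
    ring

/-- Invariant polynomials in the coordinates are regular functions of the point. -/
theorem invariant_mem_liftable (τ : ℂ) {P : CoordSpace k → ℂ} (hP : P ∈ polyFun (CoordSpace k))
    (hinv : ∀ γ y, P (permLin γ y) = P y) : P ∈ liftable k τ := by
  have hsum : (∑ γ, P ∘ permLin γ) ∈ liftable k τ := by
    have h1 := polyFun_le_adjoin_coordFuns hP
    rw [← Subalgebra.mem_toSubmodule, Algebra.adjoin_eq_span] at h1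
    clear hinv hP
    induction h1 using Submodule.span_induction with
    | mem f hf =>
      obtain ⟨m, n, m', n', rfl⟩ := exists_monomial_of_mem_closure hf
      exact sum_monomial_mem_liftable τ m n m' n'
    | zero => exact sum_mem fun γ _ => zero_mem _
    | add f g _ _ hf hg =>
      have : ∑ γ, (f + g) ∘ permLin γ = (∑ γ, f ∘ permLin γ) + ∑ γ, g ∘ permLin (k := k) γ := by
        rw [← Finset.sum_add_distrib]; rfl
      rw [this]
      exact add_mem hf hg
    | smul c f _ hf =>
      have : ∑ γ, (c • f) ∘ permLin γ = c • ∑ γ, f ∘ permLin (k := k) γ := by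
        rw [Finset.smul_sum]; rfl
      rw [this]
      exact (liftable k τ).smul_mem hf c
  have h2 : P = ((Fintype.card (Equiv.Perm (Fin k) × Equiv.Perm (Idx k)) : ℂ))⁻¹ •
      ∑ γ, P ∘ permLin γ := by
    ext y
    simp only [Pi.smul_apply, Finset.sum_apply, Function.comp_apply, hinv, Finset.sum_const,
      Finset.card_univ, nsmul_eq_mul, smul_eq_mul]
    rw [inv_mul_cancel_left₀]
    exact Nat.cast_ne_zero.2 Fintype.card_ne_zero
  rw [h2]
  exact (liftable k τ).smul_mem hsum _

/-! ### Regularity of the normal form -/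

theorem lam_mem_regFun (Y : Set (CoordSpace k)) (a : Fin k) :
    (fun y : Y => lam y.1 a) ∈ regFun Y :=
  linear_mem_regFun (V := CoordSpace k)
    (LinearMap.proj a ∘ₗ LinearMap.fst ℂ _ _ ∘ₗ LinearMap.fst ℂ _ _)

theorem mu_mem_regFun (Y : Set (CoordSpace k)) (a : Fin k) :
    (fun y : Y => mu y.1 a) ∈ regFun Y :=
  linear_mem_regFun (V := CoordSpace k)
    (LinearMap.proj a ∘ₗ LinearMap.snd ℂ _ _ ∘ₗ LinearMap.fst ℂ _ _)

theorem lamHat_mem_regFun (Y : Set (CoordSpace k)) (b : Idx k) :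
    (fun y : Y => lamHat y.1 b) ∈ regFun Y :=
  linear_mem_regFun (V := CoordSpace k)
    (LinearMap.proj b ∘ₗ LinearMap.fst ℂ _ _ ∘ₗ LinearMap.snd ℂ _ _)

theorem muHat_mem_regFun (Y : Set (CoordSpace k)) (b : Idx k) :
    (fun y : Y => muHat y.1 b) ∈ regFun Y :=
  linear_mem_regFun (V := CoordSpace k)
    (LinearMap.proj b ∘ₗ LinearMap.snd ℂ _ _ ∘ₗ LinearMap.snd ℂ _ _)

theorem entriesIn_eigP : EntriesIn (regFun (coordReg k)) fun y => eigP y.1 := by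
  rintro (a | a) b
  · exact div_mem_regFun
      (prod_mem_regFun _ fun c _ => sub_mem (lam_mem_regFun _ a) (lamHat_mem_regFun _ c))
      (prod_mem_regFun _ fun c _ => sub_mem (lam_mem_regFun _ a) (lam_mem_regFun _ c))
      fun y => prod_erase_sub_ne_zero y.2.1 a
  · exact const_mem_regFun 1

theorem entriesIn_eigG : EntriesIn (regFun (coordReg k)) fun y => eigG y.1 := by
  intro b i
  refine div_mem_regFun ?_
    (prod_mem_regFun _ fun c _ => sub_mem (lamHat_mem_regFun _ b) (lamHat_mem_regFun _ c))
      fun y => prod_erase_sub_ne_zero y.2.2 b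
  rcases i with a | i
  · exact prod_mem_regFun _ fun c _ => sub_mem (lamHat_mem_regFun _ b) (lam_mem_regFun _ c)
  · exact prod_mem_regFun _ fun c _ => sub_mem (lamHat_mem_regFun _ b) (lam_mem_regFun _ c)

theorem entriesIn_diagonal {X : Type*} {S : Subalgebra ℂ (X → ℂ)} {n : Type*} [DecidableEq n]
    {d : X → n → ℂ} (hd : ∀ a, (fun x => d x a) ∈ S) : EntriesIn S fun x => diagonal (d x) := by
  intro i j
  by_cases h : i = j
  · subst h; simpa using hd i
  · simp only [diagonal_apply_ne _ h]; exact S.zero_mem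

theorem entriesIn_secA : EntriesIn (regFun (coordReg k)) fun y => secA y.1 :=
  (entriesIn_eigP.mul (entriesIn_diagonal (lamHat_mem_regFun _))).mul entriesIn_eigG

theorem entriesIn_const {X : Type*} {S : Subalgebra ℂ (X → ℂ)} {m n : Type*} (M : Matrix m n ℂ) :
    EntriesIn S fun _ => M := fun i j => S.algebraMap_mem (M i j)

theorem entriesIn_secC (τ : ℂ) : EntriesIn (regFun (coordReg k)) fun y => secC τ y.1 := by
  have hU : ∀ i, (fun y : coordReg k => secU τ y.1 i) ∈ regFun (coordReg k) := fun i => by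
    have h := (entriesIn_eigG (k := k)).mul (entriesIn_const (tauHat k τ)) |>.mul entriesIn_eigP
    have hcol : EntriesIn (regFun (coordReg k)) fun y => of fun (b : Idx k) (_ : Unit) =>
      (eigG y.1 * tauHat k τ * eigP y.1) b b := fun b _ => h b b
    exact neg_mem ((entriesIn_eigP.mul hcol) i ())
  intro i j
  refine add_mem (const_mem_regFun _) (mul_mem (hU i) (const_mem_regFun _))

theorem entriesIn_secN (τ : ℂ) : EntriesIn (regFun (coordReg k)) fun y => secN τ y.1 := by
  intro b c
  by_cases h : b = c
  · subst h; simpa [secN] using muHat_mem_regFun _ b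
  · simp only [secN, of_apply, if_neg h]
    exact div_mem_regFun (((entriesIn_eigG.mul (entriesIn_secC τ)).mul entriesIn_eigP) b c)
      (sub_mem (lamHat_mem_regFun _ b) (lamHat_mem_regFun _ c))
      fun y => sub_ne_zero.2 fun h' => h (y.2.2 h')

/-- The components of the normal form are rational functions of the coordinates without poles on
`coordReg k`. -/
theorem dual_sec_mem_regFun (τ : ℂ) (φ : Module.Dual ℂ (Ambient k)) :
    (fun y : coordReg k => φ (sec τ y.1)) ∈ regFun (coordReg k) := by
  have hB : EntriesIn (regFun (coordReg k)) fun y => incl (diagonal (mu y.1)) + secB₂ τ y.1 := by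
    have h := (entriesIn_eigP.mul (entriesIn_secN τ)).mul (entriesIn_eigG (k := k))
    have hd := entriesIn_diagonal (mu_mem_regFun (coordReg k))
    rintro (i | i) (j | j)
    · exact add_mem (hd i j) (h _ _)
    all_goals exact add_mem (zero_mem _) (h _ _)
  have h1 := linear_comp_mem (entriesIn_secA (k := k))
    (φ ∘ₗ (hatEquiv k).symm.toLinearMap ∘ₗ LinearMap.inl ℂ _ _)
  have h2 := linear_comp_mem hB (φ ∘ₗ (hatEquiv k).symm.toLinearMap ∘ₗ LinearMap.inr ℂ _ _)
  convert add_mem h1 h2 using 1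
  ext y
  rw [Pi.add_apply]
  simp only [LinearMap.comp_apply, ← map_add, LinearMap.inl_apply, LinearMap.inr_apply,
    Prod.mk_add_mk, add_zero, zero_add]
  rfl

theorem isAlgIso_of_isCoord {τ : ℂ} {π : NReg k τ → CoordQuot k} (hπ : Function.Bijective π)
    (h : ∀ (x : regLevel k τ) (y : coordReg k),
      π (Quotient.mk _ x) = Quotient.mk _ y ↔ IsCoord τ x.1 y.1) :
    IsAlgIso (orbitRel (regLevel k τ)) (permRel k) π := by
  refine IsAlgIso.of_section permLin (by ext <;> simp [permLin]) (fun a b => rfl) _ _ ?_ ?_ hπ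
    (fun y => ⟨sec τ y.1, sec_mem_regLevel y.2 τ⟩)
    (fun y => (h _ y).2 (isCoord_sec y.2 τ)) (dual_sec_mem_regFun τ) ?_
  · rintro ⟨σ, ρ⟩ y hy
    exact ⟨hy.1.comp σ.injective, hy.2.comp ρ.injective⟩
  · rintro y y'
    constructor
    · rintro ⟨σ, ρ, h⟩; exact ⟨(σ, ρ), h⟩
    · rintro ⟨⟨σ, ρ⟩, h⟩; exact ⟨σ, ρ, h⟩
  · intro P hP hinv
    obtain ⟨R, hR, hRP⟩ := invariant_mem_liftable τ hP hinv
    exact ⟨R, hR, fun x y hxy => hRP x y.1 y.2 ((h x y).1 hxy)⟩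

end Instanton

/-! ### Holomorphy of regular functions -/

namespace QuotVar

variable {V W : Type*} [NormedAddCommGroup V] [NormedSpace ℂ V] [FiniteDimensional ℂ V]
  [NormedAddCommGroup W] [NormedSpace ℂ W]

theorem analyticAt_dual [FiniteDimensional ℂ W] (φ : Module.Dual ℂ W) (y : W) :
    AnalyticAt ℂ (φ : W → ℂ) y :=
  (LinearMap.toContinuousLinearMap φ).analyticAt y

theorem analyticAt_of_mem_polyFun [FiniteDimensional ℂ W] {p : W → ℂ} (hp : p ∈ polyFun W)
    (y : W) : AnalyticAt ℂ p y := by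
  induction hp using Algebra.adjoin_induction with
  | mem p h => obtain ⟨φ, rfl⟩ := h; exact analyticAt_dual φ y
  | algebraMap c => exact analyticAt_const
  | add p q _ _ hp hq => exact hp.add hq
  | mul p q _ _ hp hq => exact hp.mul hq

theorem analyticAt_of_mem_regFun [FiniteDimensional ℂ W] {Y : Set W} (hY : IsOpen Y) {f : W → ℂ}
    (hf : (fun y : Y => f y) ∈ regFun Y) {y : W} (hy : y ∈ Y) : AnalyticAt ℂ f y := by
  obtain ⟨p, hp, q, hq, h⟩ := hf
  refine ((analyticAt_of_mem_polyFun hp y).div (analyticAt_of_mem_polyFun hq y)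
    (h ⟨y, hy⟩).1).congr ?_
  filter_upwards [hY.mem_nhds hy] with z hz
  exact (h ⟨z, hz⟩).2.symm

/-- Analyticity into a finite-dimensional space can be tested on linear functionals. -/
theorem analyticAt_of_dual {s : W → V} {y : W}
    (h : ∀ φ : Module.Dual ℂ V, AnalyticAt ℂ (fun z => φ (s z)) y) : AnalyticAt ℂ s y := by
  set b := Module.finBasis ℂ V
  have : s = fun z => ∑ i, b.coord i (s z) • b i := by
    ext z
    exact (b.sum_repr (s z)).symm
  rw [this]
  exact Finset.analyticAt_fun_sum _ fun i _ => (h _).smul analyticAt_const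

end QuotVar

/-! ### Derivatives of matrix-valued functions -/

namespace Instanton
open QuotVar

variable {k : ℕ}

section
variable {W : Type*} [NormedAddCommGroup W] [NormedSpace ℂ W] {l m n : Type*}

/-- The derivative of a matrix-valued function, taken entry by entry. -/
def matDeriv {m n : Type*} (F : W → Matrix m n ℂ) (y v : W) : Matrix m n ℂ :=
  of fun i j => fderiv ℂ (fun z => F z i j) y v

theorem matDeriv_congr {F F' : W → Matrix m n ℂ} {y : W} (h : ∀ᶠ z in 𝓝 y, F z = F' z) (v : W) :
    matDeriv F y v = matDeriv F' y v := by
  ext i j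
  have : (fun z => F z i j) =ᶠ[𝓝 y] fun z => F' z i j := h.mono fun z hz => by simp only [hz]
  simp only [matDeriv, of_apply, this.fderiv_eq]

theorem matDeriv_mul [Fintype m] {F : W → Matrix l m ℂ} {F' : W → Matrix m n ℂ} {y : W}
    (hF : ∀ i j, DifferentiableAt ℂ (fun z => F z i j) y)
    (hF' : ∀ i j, DifferentiableAt ℂ (fun z => F' z i j) y) (v : W) :
    matDeriv (fun z => F z * F' z) y v = matDeriv F y v * F' y + F y * matDeriv F' y v := by
  ext i j
  simp only [matDeriv, of_apply, Matrix.add_apply, Matrix.mul_apply]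
  rw [fderiv_fun_sum (A := fun a z => F z i a * F' z a j) fun a _ => (hF i a).fun_mul (hF' a j),
    ← Finset.sum_add_distrib, _root_.sum_apply]
  refine Finset.sum_congr rfl fun a _ => ?_
  rw [fderiv_fun_mul (hF i a) (hF' a j)]
  simp
  ring

theorem matDeriv_sub {F F' : W → Matrix m n ℂ} {y : W}
    (hF : ∀ i j, DifferentiableAt ℂ (fun z => F z i j) y)
    (hF' : ∀ i j, DifferentiableAt ℂ (fun z => F' z i j) y) (v : W) :
    matDeriv (fun z => F z - F' z) y v = matDeriv F y v - matDeriv F' y v := by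
  ext i j
  simp only [matDeriv, of_apply, Matrix.sub_apply]
  rw [fderiv_fun_sub (hF i j) (hF' i j)]
  rfl

theorem matDeriv_add {F F' : W → Matrix m n ℂ} {y : W}
    (hF : ∀ i j, DifferentiableAt ℂ (fun z => F z i j) y)
    (hF' : ∀ i j, DifferentiableAt ℂ (fun z => F' z i j) y) (v : W) :
    matDeriv (fun z => F z + F' z) y v = matDeriv F y v + matDeriv F' y v := by
  ext i j
  simp only [matDeriv, of_apply, Matrix.add_apply]
  rw [fderiv_fun_add (hF i j) (hF' i j)]
  rfl

end

/-! ### The symplectic form in the eigenbasis -/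

theorem trace_lie_mul {n : Type*} [Fintype n] (A B C : Matrix n n ℂ) :
    (⁅A, B⁆ * C).trace = (A * ⁅B, C⁆).trace := by
  simp only [Ring.lie_def, Matrix.sub_mul, Matrix.mul_sub, trace_sub, Matrix.mul_assoc]
  rw [trace_mul_comm B, Matrix.mul_assoc]

/-- If `δA = X + [ψ, A]`, `δB = Y + [ψ, B]` for two variations `δ`, `δ'`, and `C = [A, B]`, then
`tr δA δ'B - tr δ'A δB` differs from `tr X Y' - tr X' Y` by `tr ψ δ'C - tr ψ' δC - tr [ψ, ψ'] C`. -/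
theorem trace_symplectic {n : Type*} [Fintype n] {A B a a' b b' X X' Y Y' ψ ψ' c c' : Matrix n n ℂ}
    (ha : a = X + ⁅ψ, A⁆) (ha' : a' = X' + ⁅ψ', A⁆) (hb : b = Y + ⁅ψ, B⁆)
    (hb' : b' = Y' + ⁅ψ', B⁆) (hc : ⁅a, B⁆ + ⁅A, b⁆ = c) (hc' : ⁅a', B⁆ + ⁅A, b'⁆ = c')
    (h1 : (ψ * c').trace = 0) (h2 : (ψ' * c).trace = 0) (h3 : (⁅ψ, ψ'⁆ * ⁅A, B⁆).trace = 0) :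
    (a * b').trace - (a' * b).trace = (X * Y').trace - (X' * Y).trace := by
  have e1 : (a * b').trace = (a * Y').trace + (ψ' * ⁅B, a⁆).trace := by
    rw [hb', Matrix.mul_add, trace_add, trace_mul_comm a ⁅ψ', B⁆, trace_lie_mul]
  have e2 : ⁅B, a⁆ = ⁅A, b⁆ - c := by
    rw [← hc]; simp only [Ring.lie_def]; abel
  have e3 : (a' * b).trace = (X' * b).trace + (ψ' * ⁅A, b⁆).trace := by
    rw [ha', Matrix.add_mul, trace_add, trace_lie_mul]
  have e4 : (a * Y').trace = (X * Y').trace + (ψ * ⁅A, Y'⁆).trace := by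
    rw [ha, Matrix.add_mul, trace_add, trace_lie_mul]
  have e5 : (X' * b).trace = (X' * Y).trace + (ψ * ⁅B, X'⁆).trace := by
    rw [hb, Matrix.mul_add, trace_add, trace_mul_comm X' ⁅ψ, B⁆, trace_lie_mul]
  have e6 : ⁅A, Y'⁆ - ⁅B, X'⁆ = c' - ⁅ψ', ⁅A, B⁆⁆ := by
    rw [← hc', ha', hb']
    simp only [Ring.lie_def]
    noncomm_ring
  have e7 : (ψ * ⁅A, Y'⁆).trace - (ψ * ⁅B, X'⁆).trace = 0 := by
    rw [← trace_sub, ← Matrix.mul_sub, e6, Matrix.mul_sub, trace_sub, h1, ← trace_lie_mul, h3,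
      sub_zero]
  rw [e1, e2, e3, e4, e5, Matrix.mul_sub, trace_sub, h2]
  linear_combination e7

theorem trace_mul_lastCol_eq_zero {ψ : Matrix (Idx k) (Idx k) ℂ} (hψ : ∀ j, ψ (Sum.inr ()) j = 0)
    (v : Idx k → ℂ) : (ψ * lastCol v).trace = 0 := by
  rw [lastCol, mul_vecMulVec, trace_vecMulVec, dotProduct_single_one]
  simp [mulVec, dotProduct, hψ]

/-- The commutator of `hatA` and `B₂` is scalar up to its last column. -/
theorem secC_eq (τ : ℂ) (y : CoordSpace k) : ∃ v : Idx k → ℂ, secC τ y = τ • 1 + lastCol v := by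
  refine ⟨secU τ y + Pi.single (Sum.inr ()) (-(k * τ) - τ), ?_⟩
  ext (i | i) (j | j)
  · simp [secC, tauHat, lastCol, vecMulVec_apply, diagonal_apply, one_apply]
  · simp [secC, tauHat, lastCol, vecMulVec_apply]
  · simp [secC, tauHat, lastCol, vecMulVec_apply]
  · simp [secC, tauHat, lastCol, vecMulVec_apply]
    ring

theorem isOpen_coordReg : IsOpen (coordReg k) := by
  have h1 : coordReg k = (⋂ a : Fin k, ⋂ b : Fin k, {y | a ≠ b → lam y a ≠ lam y b}) ∩
      ⋂ a : Idx k, ⋂ b : Idx k, {y | a ≠ b → lamHat y a ≠ lamHat y b} := by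
    ext y
    simp only [coordReg, Set.mem_ofPred_eq, Set.mem_inter_iff, Set.mem_iInter]
    exact and_congr
      ⟨fun h a b hab h' => hab (h h'), fun h a b h' => by_contra fun hab => h a b hab h'⟩
      ⟨fun h a b hab h' => hab (h h'), fun h a b h' => by_contra fun hab => h a b hab h'⟩
  rw [h1]
  refine IsOpen.inter (isOpen_iInter_of_finite fun a => isOpen_iInter_of_finite fun b => ?_)
    (isOpen_iInter_of_finite fun a => isOpen_iInter_of_finite fun b => ?_)
  · by_cases hab : a = b
    · simp [hab]
    · simp only [ne_eq, hab, not_false_eq_true, true_imp_iff]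
      exact isOpen_ne_fun (by fun_prop) (by fun_prop)
  · by_cases hab : a = b
    · simp [hab]
    · simp only [ne_eq, hab, not_false_eq_true, true_imp_iff]
      exact isOpen_ne_fun (by fun_prop) (by fun_prop)

theorem differentiableAt_entries {m n : Type*} {F : CoordSpace k → Matrix m n ℂ}
    (hF : EntriesIn (regFun (coordReg k)) fun y => F y.1) {y : CoordSpace k} (hy : y ∈ coordReg k)
    (i : m) (j : n) : DifferentiableAt ℂ (fun z => F z i j) y :=
  (analyticAt_of_mem_regFun isOpen_coordReg (hF i j) hy).differentiableAt

theorem fderiv_lam (y v : CoordSpace k) (a : Fin k) :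
    fderiv ℂ (fun z => lam z a) y v = lam v a := by
  have := (LinearMap.toContinuousLinearMap (LinearMap.proj a ∘ₗ LinearMap.fst ℂ _ _ ∘ₗ
    LinearMap.fst ℂ _ _ : CoordSpace k →ₗ[ℂ] ℂ)).fderiv (x := y)
  exact congrArg (fun T => T v) this

theorem fderiv_mu (y v : CoordSpace k) (a : Fin k) : fderiv ℂ (fun z => mu z a) y v = mu v a := by
  have := (LinearMap.toContinuousLinearMap (LinearMap.proj a ∘ₗ LinearMap.snd ℂ _ _ ∘ₗ
    LinearMap.fst ℂ _ _ : CoordSpace k →ₗ[ℂ] ℂ)).fderiv (x := y)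
  exact congrArg (fun T => T v) this

theorem fderiv_lamHat (y v : CoordSpace k) (b : Idx k) :
    fderiv ℂ (fun z => lamHat z b) y v = lamHat v b := by
  have := (LinearMap.toContinuousLinearMap (LinearMap.proj b ∘ₗ LinearMap.fst ℂ _ _ ∘ₗ
    LinearMap.snd ℂ _ _ : CoordSpace k →ₗ[ℂ] ℂ)).fderiv (x := y)
  exact congrArg (fun T => T v) this

theorem fderiv_muHat (y v : CoordSpace k) (b : Idx k) :
    fderiv ℂ (fun z => muHat z b) y v = muHat v b := by
  have := (LinearMap.toContinuousLinearMap (LinearMap.proj b ∘ₗ LinearMap.snd ℂ _ _ ∘ₗ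
    LinearMap.snd ℂ _ _ : CoordSpace k →ₗ[ℂ] ℂ)).fderiv (x := y)
  exact congrArg (fun T => T v) this

theorem matDeriv_diagonal {W n : Type*} [NormedAddCommGroup W] [NormedSpace ℂ W] [DecidableEq n]
    {d : W → n → ℂ} {y v : W} : matDeriv (fun z => diagonal (d z)) y v =
      diagonal fun a => fderiv ℂ (fun z => d z a) y v := by
  ext i j
  by_cases h : i = j
  · subst h; simp [matDeriv]
  · simp [matDeriv, h]

theorem entriesIn_secB₂ (τ : ℂ) : EntriesIn (regFun (coordReg k)) fun y => secB₂ τ y.1 :=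
  (entriesIn_eigP.mul (entriesIn_secN τ)).mul entriesIn_eigG

theorem secB₂_mul_eigP {y : CoordSpace k} (hy : y ∈ coordReg k) (τ : ℂ) :
    secB₂ τ y * eigP y = eigP y * secN τ y := by
  rw [secB₂, Matrix.mul_assoc, eigG_mul_eigP hy, Matrix.mul_one]

/-- Differentiating `M P = P N`, with variations `m`, `p`, `q` of `M`, `P`, `N`, gives
`m = P q P⁻¹ + [p P⁻¹, M]`. -/
theorem variation_eq {n : Type*} [Fintype n] [DecidableEq n] {M P G N m p q : Matrix n n ℂ}
    (hPG : P * G = 1) (hM : M * P = P * N) (h : m * P + M * p = p * N + P * q) :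
    m = P * q * G + ⁅p * G, M⁆ := by
  have h1 : m = m * P * G := by rw [Matrix.mul_assoc, hPG, Matrix.mul_one]
  have h2 : m * P = p * N + P * q - M * p := eq_sub_of_add_eq h
  have hGP : G * P = 1 := mul_eq_one_comm.1 hPG
  have h3 : N * G = G * M := by
    have : N = G * (M * P) := by rw [hM, ← Matrix.mul_assoc, hGP, Matrix.one_mul]
    rw [this, Matrix.mul_assoc, Matrix.mul_assoc, hPG, Matrix.mul_one]
  rw [h1, h2, Ring.lie_def, Matrix.sub_mul, Matrix.add_mul, Matrix.mul_assoc p N, h3,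
    Matrix.mul_assoc p G, Matrix.mul_assoc M p]
  abel

theorem trace_conj_mul {n : Type*} [Fintype n] [DecidableEq n] {P G : Matrix n n ℂ}
    (hGP : G * P = 1) (q q' : Matrix n n ℂ) :
    ((P * q * G) * (P * q' * G)).trace = (q * q').trace := by
  have : (P * q * G) * (P * q' * G) = P * (q * q' * G) := by
    simp only [Matrix.mul_assoc]
    rw [← Matrix.mul_assoc G P, hGP, Matrix.one_mul]
  rw [this, trace_mul_comm, Matrix.mul_assoc, hGP, Matrix.mul_one]

/-- The pullback of the symplectic form under the normal form, the part involving `B₂`. -/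
theorem trace_matDeriv_secB₂ (τ : ℂ) {y : CoordSpace k} (hy : y ∈ coordReg k)
    (v w : CoordSpace k) :
    (matDeriv secA y v * matDeriv (secB₂ τ) y w).trace -
      (matDeriv secA y w * matDeriv (secB₂ τ) y v).trace =
      ∑ b, (lamHat v b * muHat w b - lamHat w b * muHat v b) := by
  have hnear : ∀ᶠ z in 𝓝 y, z ∈ coordReg k := isOpen_coordReg.mem_nhds hy
  have dA := fun i j => differentiableAt_entries entriesIn_secA hy i j
  have dB := fun i j => differentiableAt_entries (entriesIn_secB₂ τ) hy i j
  have dP := fun i j => differentiableAt_entries entriesIn_eigP hy i j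
  have dN := fun i j => differentiableAt_entries (entriesIn_secN τ) hy i j
  have dL := fun i j => differentiableAt_entries (F := fun y => diagonal (lamHat y))
    (entriesIn_diagonal (lamHat_mem_regFun _)) hy i j
  have dAB := fun i j => differentiableAt_entries (F := fun y => secA y * secB₂ τ y)
    (entriesIn_secA.mul (entriesIn_secB₂ τ)) hy i j
  have dBA := fun i j => differentiableAt_entries (F := fun y => secB₂ τ y * secA y)
    ((entriesIn_secB₂ τ).mul entriesIn_secA) hy i j
  have hA : ∀ v, matDeriv secA y v = eigP y * diagonal (lamHat v) * eigG y +
      ⁅matDeriv eigP y v * eigG y, secA y⁆ := by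
    intro v
    refine variation_eq (eigP_mul_eigG hy) (secA_mul_eigP hy) ?_
    have h := matDeriv_congr (hnear.mono fun z hz => secA_mul_eigP hz) v
    rw [matDeriv_mul dA dP, matDeriv_mul dP dL, matDeriv_diagonal] at h
    simpa only [fderiv_lamHat] using h
  have hB : ∀ v, matDeriv (secB₂ τ) y v = eigP y * matDeriv (secN τ) y v * eigG y +
      ⁅matDeriv eigP y v * eigG y, secB₂ τ y⁆ := by
    intro v
    refine variation_eq (eigP_mul_eigG hy) (secB₂_mul_eigP hy τ) ?_
    have h := matDeriv_congr (hnear.mono fun z hz => secB₂_mul_eigP hz τ) v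
    rwa [matDeriv_mul dB dP, matDeriv_mul dP dN] at h
  have hC : ∀ v, ⁅matDeriv secA y v, secB₂ τ y⁆ + ⁅secA y, matDeriv (secB₂ τ) y v⁆ =
      matDeriv (secC τ) y v := by
    intro v
    rw [← matDeriv_congr (hnear.mono fun z hz => secA_comm_secB₂ hz τ) v, matDeriv_sub dAB dBA,
      matDeriv_mul dA dB, matDeriv_mul dB dA, Ring.lie_def, Ring.lie_def]
    abel
  -- The last row of `eigP` is constant, so the last row of `dP * P⁻¹` vanishes, while `dC` is
  -- supported in the last column: the correction terms of `trace_symplectic` vanish.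
  have hψ : ∀ v j, (matDeriv eigP y v * eigG y) (Sum.inr ()) j = 0 := by
    intro v j
    have : ∀ b, matDeriv eigP y v (Sum.inr ()) b = 0 := fun b => by
      simp [matDeriv, eigP_inr]
    simp [Matrix.mul_apply, this]
  have hCl : ∀ v, ∃ u, matDeriv (secC τ) y v = lastCol u := by
    intro v
    refine ⟨fun i => matDeriv (secC τ) y v i (Sum.inr ()), ?_⟩
    ext i (j | j)
    · simp [matDeriv, secC, lastCol, vecMulVec_apply]
    · simp [lastCol, vecMulVec_apply]
  have h1 : ∀ v w, ((matDeriv eigP y v * eigG y) * matDeriv (secC τ) y w).trace = 0 := by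
    intro v w
    obtain ⟨u, hu⟩ := hCl w
    rw [hu, trace_mul_lastCol_eq_zero (hψ v)]
  have h3 : (⁅matDeriv eigP y v * eigG y, matDeriv eigP y w * eigG y⁆ *
      ⁅secA y, secB₂ τ y⁆).trace = 0 := by
    obtain ⟨u, hu⟩ := secC_eq τ y
    rw [Ring.lie_def (secA y), secA_comm_secB₂ hy, hu, Matrix.mul_add, trace_add,
      trace_mul_lastCol_eq_zero, add_zero, Matrix.mul_smul, Matrix.mul_one, trace_smul,
      Ring.lie_def, trace_sub, trace_mul_comm, sub_self, smul_zero]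
    intro j
    rw [Ring.lie_def, Matrix.sub_apply, Matrix.mul_apply,
      Matrix.mul_apply (M := _ * _) (N := _ * _)]
    simp [hψ]
  rw [trace_symplectic (hA v) (hA w) (hB v) (hB w) (hC v) (hC w) (h1 v w) (h1 w v) h3,
    trace_conj_mul (eigG_mul_eigP hy), trace_conj_mul (eigG_mul_eigP hy)]
  have hN : ∀ v b, matDeriv (secN τ) y v b b = muHat v b := by
    intro v b
    simp [matDeriv, secN, fderiv_muHat]
  simp [trace, diagonal_mul, hN, Finset.sum_sub_distrib]

theorem matDeriv_eq_of_linear {T : Ambient k →ₗ[ℂ] Matrix (Idx k) (Idx k) ℂ}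
    {H : CoordSpace k → Ambient k} {y : CoordSpace k} (hH : DifferentiableAt ℂ H y)
    (v : CoordSpace k) : matDeriv (fun z => T (H z)) y v = T (fderiv ℂ H y v) := by
  ext i j
  have h := ((LinearMap.toContinuousLinearMap (entryLin _ _ i j ∘ₗ T)).hasFDerivAt.comp y
    hH.hasFDerivAt).fderiv
  exact congrArg (fun S => S v) h

theorem analyticAt_sec (τ : ℂ) {y : CoordSpace k} (hy : y ∈ coordReg k) :
    AnalyticAt ℂ (sec τ) y :=
  analyticAt_of_dual fun φ => analyticAt_of_mem_regFun isOpen_coordReg (dual_sec_mem_regFun τ φ) hy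

/-- The normal form pulls the symplectic form back to the canonical one. -/
theorem omega_fderiv_sec (τ : ℂ) {y : CoordSpace k} (hy : y ∈ coordReg k) (v w : CoordSpace k) :
    omega (fderiv ℂ (sec τ) y v) (fderiv ℂ (sec τ) y w) = omegaCoord v w := by
  have hd := (analyticAt_sec τ hy).differentiableAt
  have hA : ∀ v, hatA (fderiv ℂ (sec τ) y v) = matDeriv secA y v := by
    intro v
    have h := matDeriv_eq_of_linear (T := hatALin k) hd v
    exact h.symm.trans (matDeriv_congr (.of_forall fun z => hatA_sec τ z) v)
  have hB : ∀ v, hatB (fderiv ℂ (sec τ) y v) =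
      incl (diagonal (mu v)) + matDeriv (secB₂ τ) y v := by
    intro v
    have h := matDeriv_eq_of_linear (T := hatBLin k) hd v
    have hi : EntriesIn (regFun (coordReg k)) fun y => incl (diagonal (mu y.1)) := by
      rintro (i | i) (j | j)
      · exact entriesIn_diagonal (mu_mem_regFun (coordReg k)) i j
      all_goals exact zero_mem _
    replace h := h.symm.trans (matDeriv_congr (.of_forall fun z => hatB_sec τ z) v)
    rw [matDeriv_add
      (fun i j => differentiableAt_entries (F := fun z => incl (diagonal (mu z))) hi hy i j)
      (fun i j => differentiableAt_entries (entriesIn_secB₂ τ) hy i j)] at h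
    have h2 : matDeriv (fun z : CoordSpace k => incl (diagonal (mu z))) y v =
        incl (diagonal (mu v)) := by
      ext (i | i) (j | j)
      · have := congrFun (congrFun (matDeriv_diagonal (d := fun z : CoordSpace k => mu z) (y := y)
          (v := v)) i) j
        simp only [fderiv_mu] at this
        exact this
      all_goals simp [matDeriv, incl]
    rw [h2] at h
    exact h
  have hAd : ∀ v (a b : Fin k), matDeriv secA y v (Sum.inl a) (Sum.inl b) =
      diagonal (lam v) a b := by
    intro v a b
    have hnear : ∀ᶠ z in 𝓝 y, z ∈ coordReg k := isOpen_coordReg.mem_nhds hy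
    have h1 : matDeriv (fun z => (secA z).toBlocks₁₁) y v = diagonal fun a => lam v a := by
      rw [matDeriv_congr (F' := fun z => diagonal (lam z)) (hnear.mono fun z hz => by
        ext a b; exact secA_inl hz (Sum.inl a) b), matDeriv_diagonal]
      simp only [fderiv_lam]
    exact congrFun (congrFun h1 a) b
  have hi : ∀ v w, (matDeriv secA y v * incl (diagonal (mu w))).trace = ∑ a, lam v a * mu w a := by
    intro v w
    simp [trace, Matrix.mul_apply, Fintype.sum_sum_type, incl, hAd, diagonal_apply]
  rw [omega_eq, hA, hA, hB, hB, Matrix.mul_add, Matrix.mul_add, trace_add, trace_add, hi, hi,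
    add_sub_add_comm, trace_matDeriv_secB₂ τ hy, omegaCoord, Finset.sum_sub_distrib,
    Finset.sum_sub_distrib]

/-- The action as a linear map. -/
def actLin (L : GL (Fin k) ℂ) : Ambient k →ₗ[ℂ] Ambient k where
  toFun := act L
  map_add' x y := by
    simp [act, matA, matB, matI, matJ, Matrix.mul_add, Matrix.add_mul]
  map_smul' c x := by
    simp [act, matA, matB, matI, matJ]

theorem isSymplecticIso_of_isCoord {τ : ℂ} {π : NReg k τ → CoordQuot k}
    (hπ : Function.Bijective π)
    (h : ∀ (x : regLevel k τ) (y : coordReg k),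
      π (Quotient.mk _ x) = Quotient.mk _ y ↔ IsCoord τ x.1 y.1) :
    IsSymplecticIso (orbitRel (regLevel k τ)) (permRel k) omega omegaCoord π := by
  refine ⟨isAlgIso_of_isCoord hπ h, fun x y hxy => ?_⟩
  obtain ⟨L, hL⟩ := ((h x y).1 hxy).exists_act_sec x.2 y.2
  have han := analyticAt_sec τ y.2
  set T := LinearMap.toContinuousLinearMap (actLin (k := k) L) with hT
  have hTa : ∀ v, T v = act L v := fun v => rfl
  refine ⟨fun z => T (sec τ z), (T.analyticAt _).comp han, hL, ?_, fun w w' => ?_⟩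
  · filter_upwards [isOpen_coordReg.mem_nhds y.2] with z hz
    have hm := sec_mem_regLevel hz τ
    exact ⟨⟨act_mem_level hm.1 L, hm.2.act L⟩, hz, (h _ _).2 ((isCoord_sec hz τ).act L)⟩
  · have hf : fderiv ℂ (fun z => T (sec τ z)) y = T.comp (fderiv ℂ (sec τ) y) :=
      (T.hasFDerivAt.comp y.1 han.differentiableAt.hasFDerivAt).fderiv
    have hfw : ∀ w, fderiv ℂ (fun z => T (sec τ z)) y w = act L (fderiv ℂ (sec τ) y w) :=
      fun w => congrArg (fun S => S w) hf
    refine (congrArg₂ omega (hfw w) (hfw w')).trans ?_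
    rw [omega_act, omega_fderiv_sec τ y.2]

/-! ### Closed orbits -/

/-- A point in the closure of an orbit is related to the points of the orbit by a nonzero
intertwiner `(X, t)`: this is a closed condition, since `(X, t)` may be taken in the unit sphere. -/
theorem exists_intertwiner {x x' : Ambient k}
    (h : x' ∈ closure (Set.range fun L : GL (Fin k) ℂ => act L x)) :
    ∃ (X : Matrix (Fin k) (Fin k) ℂ) (t : ℂ), (X, t) ≠ 0 ∧ X * matA x = matA x' * X ∧
      X * matB x = matB x' * X ∧ X * matI x = t • matI x' ∧ t • matJ x = matJ x' * X := by
  let K := Metric.sphere (0 : Matrix (Fin k) (Fin k) ℂ × ℂ) 1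
  have : ProperSpace (Matrix (Fin k) (Fin k) ℂ × ℂ) := FiniteDimensional.proper ℂ _
  have hK : CompactSpace K := isCompact_iff_compactSpace.1 (isCompact_sphere _ _)
  let C : Set (K × Ambient k) := {p | p.1.1.1 * matA x = matA p.2 * p.1.1.1 ∧
    p.1.1.1 * matB x = matB p.2 * p.1.1.1 ∧ p.1.1.1 * matI x = p.1.1.2 • matI p.2 ∧
    p.1.1.2 • matJ x = matJ p.2 * p.1.1.1}
  have hC : IsClosed C := by
    refine IsClosed.inter ?_ (IsClosed.inter ?_ (IsClosed.inter ?_ ?_))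
    · exact isClosed_eq (by fun_prop) (by fun_prop)
    · exact isClosed_eq (by fun_prop) (by fun_prop)
    · exact isClosed_eq (by fun_prop) (by fun_prop)
    · exact isClosed_eq (by fun_prop) (by fun_prop)
  have hcl : IsClosed (Prod.snd '' C) := isClosedMap_snd_of_compactSpace _ hC
  have hsub : (Set.range fun L : GL (Fin k) ℂ => act L x) ⊆ Prod.snd '' C := by
    rintro _ ⟨L, rfl⟩
    set s : Matrix (Fin k) (Fin k) ℂ × ℂ := (L.val, 1) with hs
    have hs0 : ‖s‖ ≠ 0 := norm_ne_zero_iff.2 fun h => by simpa [hs] using congrArg Prod.snd h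
    set c : ℂ := ((‖s‖⁻¹ : ℝ) : ℂ) with hc
    have hcs : c • s ∈ K := by
      rw [mem_sphere_zero_iff_norm, norm_smul, hc, Complex.norm_real, norm_inv, norm_norm,
        inv_mul_cancel₀ hs0]
    refine ⟨(⟨c • s, hcs⟩, act L x), ⟨?_, ?_, ?_, ?_⟩, rfl⟩
    · change (c • L.val) * matA x = (L.val * matA x * L⁻¹.val) * (c • L.val)
      rw [Matrix.mul_smul, Matrix.mul_assoc _ L⁻¹.val, Units.inv_mul, Matrix.mul_one,
        Matrix.smul_mul]
    · change (c • L.val) * matB x = (L.val * matB x * L⁻¹.val) * (c • L.val)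
      rw [Matrix.mul_smul, Matrix.mul_assoc _ L⁻¹.val, Units.inv_mul, Matrix.mul_one,
        Matrix.smul_mul]
    · change (c • L.val) * matI x = (c * 1) • (L.val * matI x)
      rw [mul_one, Matrix.smul_mul]
    · change (c * 1) • matJ x = (matJ x * L⁻¹.val) * (c • L.val)
      rw [mul_one, Matrix.mul_smul, Matrix.mul_assoc, Units.inv_mul, Matrix.mul_one]
  obtain ⟨⟨⟨⟨X, t⟩, hXt⟩, z⟩, ⟨h1, h2, h3, h4⟩, rfl⟩ := closure_minimal hsub hcl h
  refine ⟨X, t, fun h0 => ?_, h1, h2, h3, h4⟩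
  simp [K, h0] at hXt

theorem isClosed_level (τ : ℂ) : IsClosed (level k τ) :=
  isClosed_eq (by fun_prop) continuous_const

/-- If two operators have commutator `τ ≠ 0` on an invariant subspace, the subspace vanishes, by
taking traces. -/
theorem eq_bot_of_comm_eq_smul {n : Type*} [Fintype n] [DecidableEq n] {A B : Matrix n n ℂ} {τ : ℂ}
    (hτ : τ ≠ 0) (S : Submodule ℂ (n → ℂ)) (hA : ∀ v ∈ S, A *ᵥ v ∈ S) (hB : ∀ v ∈ S, B *ᵥ v ∈ S)
    (h : ∀ v ∈ S, (A * B - B * A) *ᵥ v = τ • v) : S = ⊥ := by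
  set f : Module.End ℂ S := (Matrix.toLin' A).restrict (p := S) (q := S) hA
  set g : Module.End ℂ S := (Matrix.toLin' B).restrict (p := S) (q := S) hB
  have hfg : f * g - g * f = τ • 1 := by
    ext1 v
    apply Subtype.ext
    have := h v v.2
    rw [sub_mulVec, ← mulVec_mulVec, ← mulVec_mulVec] at this
    exact this
  have htr : τ * (Module.finrank ℂ S : ℂ) = 0 :=
    calc τ * (Module.finrank ℂ S : ℂ) = LinearMap.trace ℂ S (τ • (1 : Module.End ℂ S)) :=
          ((LinearMap.map_smul (LinearMap.trace ℂ S) τ (1 : Module.End ℂ S)).trans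
            (congrArg (τ * ·) (LinearMap.trace_one ℂ S))).symm
      _ = LinearMap.trace ℂ S (f * g - g * f) := by rw [hfg]
      _ = LinearMap.trace ℂ S (f * g) - LinearMap.trace ℂ S (g * f) :=
          LinearMap.map_sub (LinearMap.trace ℂ S) (f * g) (g * f)
      _ = 0 := sub_eq_zero.2 (LinearMap.trace_mul_comm ℂ f g)
  have h0 : Module.finrank ℂ S = 0 := by
    rcases mul_eq_zero.1 htr with h | h
    · exact absurd h hτ
    · exact_mod_cast h
  exact Submodule.finrank_eq_zero.1 h0

theorem det_sub_eq_of_mem_closure {x x' : Ambient k}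
    (h : x' ∈ closure (Set.range fun L : GL (Fin k) ℂ => act L x)) (c : ℂ) :
    (c • 1 - matA x').det = (c • 1 - matA x).det ∧
      (c • 1 - hatA x').det = (c • 1 - hatA x).det := by
  have hA : Continuous (hatA (k := k)) := (LinearMap.toContinuousLinearMap (hatALin k)).continuous
  have key : ∀ {n : Type} [Fintype n] [DecidableEq n] (L : GL n ℂ) (M : Matrix n n ℂ),
      (c • 1 - L.val * M * L⁻¹.val).det = (c • 1 - M).det := by
    intro n _ _ L M
    have : c • 1 - L.val * M * L⁻¹.val = L.val * (c • 1 - M) * L⁻¹.val := by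
      rw [Matrix.mul_sub, Matrix.sub_mul, Matrix.mul_smul, Matrix.mul_one, Matrix.smul_mul,
        Units.mul_inv]
    rw [this, coe_units_inv, det_conj (L.isUnit)]
  have hcl : IsClosed {z : Ambient k | (c • 1 - matA z).det = (c • 1 - matA x).det ∧
      (c • 1 - hatA z).det = (c • 1 - hatA x).det} :=
    (isClosed_eq (Continuous.matrix_det (by fun_prop)) continuous_const).inter
      (isClosed_eq (Continuous.matrix_det (continuous_const.sub hA)) continuous_const)
  refine closure_minimal ?_ hcl h
  rintro _ ⟨L, rfl⟩
  exact ⟨key L (matA x), by rw [hatA_act, key]⟩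

theorem det_smul_one_sub_of_conj {n : Type*} [Fintype n] [DecidableEq n] {M : Matrix n n ℂ}
    {d : n → ℂ} {g : GL n ℂ} (h : g.val * M * g⁻¹.val = diagonal d) (c : ℂ) :
    (c • 1 - M).det = ∏ a, (c - d a) := by
  have h1 : diagonal (fun a => c - d a) = g.val * (c • 1 - M) * g⁻¹.val := by
    rw [Matrix.mul_sub, Matrix.sub_mul, h, Matrix.mul_smul, Matrix.mul_one, Matrix.smul_mul,
      Units.mul_inv]
    ext i j
    by_cases hij : i = j
    · subst hij; simp
    · simp [hij]
  rw [← det_diagonal, h1, coe_units_inv, det_conj g.isUnit]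

theorem det_smul_one_sub_eq_zero {n : Type*} [Fintype n] [DecidableEq n] {M : Matrix n n ℂ} {c : ℂ}
    {v : n → ℂ} (hv : v ≠ 0) (h : M *ᵥ v = c • v) : (c • 1 - M).det = 0 :=
  exists_mulVec_eq_zero_iff.1 ⟨v, hv, by rw [sub_mulVec, smul_mulVec, one_mulVec, h, sub_self]⟩

/-- Let `(X, t)` intertwine `x` with a point of the closure of its orbit. If `t ≠ 0`, then `X` is
invertible, as `j₂` would vanish on an eigenvector of `A` in its kernel. If `t = 0`, then `j` kills
the image of `X`, on which `[A, B] = τ`: this is impossible for `τ ≠ 0`, and in any case `A` and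
`hatA` have a common eigenvalue there. -/
theorem isClosed_orbit {τ : ℂ} {x : Ambient k} {y : CoordSpace k} (hx : x ∈ regLevel k τ)
    (hxy : IsCoord τ x y) (h : τ ≠ 0 ∨ ∀ a b, lam y a ≠ lamHat y b) :
    IsClosed (Set.range fun L : GL (Fin k) ℂ => act L x) := by
  refine isClosed_of_closure_subset fun x' hx' => ?_
  have hlev : x' ∈ level k τ := closure_minimal
    (by rintro _ ⟨L, rfl⟩; exact act_mem_level hx.1 L) (isClosed_level τ) hx'
  obtain ⟨X, t, hXt, hA, hB, hI, hJ⟩ := exists_intertwiner hx'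
  by_cases ht : t = 0
  · -- The image of `X` is an invariant subspace annihilated by `j`.
    exfalso
    subst ht
    have hJ0 : matJ x' * X = 0 := by rw [← hJ, zero_smul]
    have hX : X ≠ 0 := fun h0 => hXt (by rw [h0]; rfl)
    have hS : LinearMap.range X.mulVecLin ≠ ⊥ := by
      rw [Ne, LinearMap.range_eq_bot]
      intro h0
      refine hX (Matrix.ext_of_mulVec_single fun i => ?_)
      have h1 := LinearMap.congr_fun h0 (Pi.single i 1)
      rw [mulVecLin_apply] at h1
      rw [h1, zero_mulVec, LinearMap.zero_apply]
    have hSA : ∀ v ∈ LinearMap.range X.mulVecLin, matA x' *ᵥ v ∈ LinearMap.range X.mulVecLin := by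
      rintro _ ⟨w, rfl⟩
      exact ⟨matA x *ᵥ w, by simp [hA]⟩
    have hSB : ∀ v ∈ LinearMap.range X.mulVecLin, matB x' *ᵥ v ∈ LinearMap.range X.mulVecLin := by
      rintro _ ⟨w, rfl⟩
      exact ⟨matB x *ᵥ w, by simp [hB]⟩
    have hSJ : ∀ v ∈ LinearMap.range X.mulVecLin, matJ x' *ᵥ v = 0 := by
      rintro _ ⟨w, rfl⟩
      rw [mulVecLin_apply, mulVec_mulVec, hJ0, zero_mulVec]
    rcases h with hτ | hne
    · refine hS (eq_bot_of_comm_eq_smul hτ _ hSA hSB fun v hv => ?_)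
      have : matA x' * matB x' - matB x' * matA x' = τ • 1 + matI x' * matJ x' :=
        sub_eq_iff_eq_add.1 hlev
      rw [this, add_mulVec, ← mulVec_mulVec, hSJ v hv, mulVec_zero, add_zero, smul_mulVec,
        one_mulVec]
    · -- The characteristic polynomials of `A` and `hatA` are constant on the closure of the orbit.
      obtain ⟨c, v, hv, hv0, hev⟩ := exists_eigenvector_mem (matA x') _ hS hSA
      have hev' : hatA x' *ᵥ Sum.elim v 0 = c • (Sum.elim v 0 : Idx k → ℂ) := by
        rw [hatA_mulVec, hev]
        have h1 : matJ x' 1 ⬝ᵥ v = 0 := congrFun (hSJ v hv) 1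
        ext (i | i) <;> simp [h1]
      have hv0' : (Sum.elim v 0 : Idx k → ℂ) ≠ 0 := fun h0 =>
        hv0 (funext fun a => congrFun h0 (Sum.inl a))
      obtain ⟨h1, h2⟩ := det_sub_eq_of_mem_closure hx' c
      rw [det_smul_one_sub_eq_zero hv0 hev] at h1
      rw [det_smul_one_sub_eq_zero hv0' hev'] at h2
      obtain ⟨_, _, _, h, g, _, _, _, h3, -, h5, -⟩ := hxy
      rw [det_smul_one_sub_of_conj h3] at h1
      rw [det_smul_one_sub_of_conj h5] at h2
      obtain ⟨a, -, ha⟩ := Finset.prod_eq_zero_iff.1 h1.symm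
      obtain ⟨b, -, hb⟩ := Finset.prod_eq_zero_iff.1 h2.symm
      exact hne a b ((sub_eq_zero.1 ha).symm.trans (sub_eq_zero.1 hb))
  · -- The kernel of `X` is an invariant subspace annihilated by `j`.
    have hN := (isStronglySemisimple_hatA_iff.1 hx.2).1
    have hdet : X.det ≠ 0 := by
      intro h0
      obtain ⟨v, hv0, hv⟩ := exists_mulVec_eq_zero_iff.2 h0
      obtain ⟨c, w, hw, hw0, hev⟩ := exists_eigenvector_mem (matA x) (LinearMap.ker X.mulVecLin)
        ((Submodule.ne_bot_iff _).2 ⟨v, hv, hv0⟩) (by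
          intro w hw
          have hw' : X *ᵥ w = 0 := hw
          change X *ᵥ (matA x *ᵥ w) = 0
          rw [mulVec_mulVec, hA, ← mulVec_mulVec, hw', mulVec_zero])
      have hw' : X *ᵥ w = 0 := hw
      have h1 : t • (matJ x *ᵥ w) = 0 := by
        rw [← smul_mulVec, hJ, ← mulVec_mulVec, hw', mulVec_zero]
      exact hN c w hw0 hev (congrFun ((smul_eq_zero.1 h1).resolve_left ht) 1)
    have hdet' : (t⁻¹ • X).det ≠ 0 := by
      rw [det_smul]
      exact mul_ne_zero (pow_ne_zero _ (inv_ne_zero ht)) hdet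
    let L : GL (Fin k) ℂ := GeneralLinearGroup.mkOfDetNeZero _ hdet'
    have hL : L.val = t⁻¹ • X := rfl
    have cancel : ∀ {M M' : Matrix (Fin k) (Fin k) ℂ}, X * M = M' * X →
        L.val * M * L⁻¹.val = M' := by
      intro M M' h
      rw [hL, Matrix.smul_mul, h, ← Matrix.mul_smul, ← hL, Matrix.mul_assoc, Units.mul_inv,
        Matrix.mul_one]
    refine ⟨L, Prod.ext (Prod.ext (cancel hA) (Prod.ext (cancel hB) (Prod.ext ?_ ?_))) ?_⟩
    · change L.val * matI x = matI x'
      rw [hL, Matrix.smul_mul, hI, smul_smul, inv_mul_cancel₀ ht, one_smul]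
    · change matJ x * L⁻¹.val = matJ x'
      have h1 : matJ x = matJ x' * L.val := by
        rw [hL, Matrix.mul_smul, ← hJ, smul_smul, inv_mul_cancel₀ ht, one_smul]
      rw [h1, Matrix.mul_assoc, Units.mul_inv, Matrix.mul_one]
    · -- The action is trivial on the last two coordinates.
      have hz : IsClosed {z : Ambient k | z.2 = x.2} := isClosed_eq (by fun_prop) continuous_const
      exact (closure_minimal (by rintro _ ⟨M, rfl⟩; rfl) hz hx' : x'.2 = x.2).symm

/-- If `τ = 0` and `A`, `hatA` have a common eigenvalue `lam y a`, then row `a` of `i` vanishes, and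
so do the off-diagonal entries of row `a` of `B`. Hence a one-parameter subgroup moves the normal
form to a limit in which `j₂` has a zero entry, and this point lies outside the orbit. -/
theorem not_isClosed_orbit_sec {y : CoordSpace k} (hy : y ∈ coordReg k) {a : Fin k} {b : Idx k}
    (hab : lam y a = lamHat y b) :
    ¬ IsClosed (Set.range fun L : GL (Fin k) ℂ => act L (sec 0 y)) := by
  intro hcl
  set x := sec 0 y with hx
  have hA : matA x = diagonal (lam y) := matA_sec hy 0
  have hJ : ∀ c, matJ x 1 c = 1 := matJ_sec hy 0
  -- The common eigenvalue makes the factor `lamHat y b - lam y a` of `i₁` vanish; row `a` of the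
  -- moment map equation then gives the vanishing of `i₂` and of row `a` of `B`.
  have hI1 : matI x a 0 = 0 := by
    have : matI x a 0 = secA y (Sum.inl a) (Sum.inr ()) := by
      rw [← hatA_sec 0 y]; rfl
    rw [this, secA_inr hy a b, hab, sub_self, zero_mul]
  have hlev : ∀ c, (lam y a - lam y c) * matB x a c = matI x a 1 := by
    intro c
    have h := (sec_mem_regLevel hy 0).1
    have h1 : matA x * matB x - matB x * matA x - matI x * matJ x = (0 : ℂ) • 1 := h
    have h2 := congrFun (congrFun h1 a) c
    rw [hA, Matrix.sub_apply, Matrix.sub_apply, diagonal_mul, mul_diagonal, Matrix.mul_apply,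
      Fin.sum_univ_two, hI1, hJ] at h2
    simp only [zero_smul, Matrix.zero_apply] at h2
    linear_combination h2
  have hI2 : matI x a 1 = 0 := by rw [← hlev a, sub_self, zero_mul]
  have hB : ∀ c, c ≠ a → matB x a c = 0 := by
    intro c hc
    have h := hlev c
    rw [hI2] at h
    exact (mul_eq_zero.1 h).resolve_left (sub_ne_zero.2 fun h => hc (hy.1 h).symm)
  -- The curve `r ↦ diag(1, …, r⁻¹, …, 1) · x`, extended to `r = 0`.
  let γ : ℂ → Ambient k := fun r => ((matA x,
    of fun c c' => if c' = a ∧ c ≠ a then r * matB x c c' else matB x c c', matI x,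
    of fun d c => if c = a then r * matJ x d c else matJ x d c), x.2)
  have hγc : Continuous γ := by
    refine (continuous_const.prodMk (Continuous.prodMk ?_ (continuous_const.prodMk ?_))).prodMk
      continuous_const
    · refine continuous_matrix fun i j => ?_
      by_cases h : j = a ∧ i ≠ a
      · simp only [of_apply, if_pos h]; fun_prop
      · simp only [of_apply, if_neg h]; fun_prop
    · refine continuous_matrix fun i j => ?_
      by_cases h : j = a
      · simp only [of_apply, if_pos h]; fun_prop
      · simp only [of_apply, if_neg h]; fun_prop
  have hγ : ∀ r : ℂ, r ≠ 0 → γ r ∈ Set.range fun L : GL (Fin k) ℂ => act L x := by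
    intro r hr
    set d : Fin k → ℂ := Function.update 1 a r with hd
    have hd0 : ∀ c, d c ≠ 0 := fun c => by
      by_cases h : c = a
      · subst h; simpa [hd] using hr
      · simp [hd, h]
    let L : GL (Fin k) ℂ := ⟨diagonal d⁻¹, diagonal d, by
      rw [diagonal_mul_diagonal, ← diagonal_one]; congr 1; ext c; simp [hd0 c], by
      rw [diagonal_mul_diagonal, ← diagonal_one]; congr 1; ext c; simp [hd0 c]⟩
    refine ⟨L, ?_⟩
    change (((diagonal d⁻¹ * matA x * diagonal d, diagonal d⁻¹ * matB x * diagonal d,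
      diagonal d⁻¹ * matI x, matJ x * diagonal d), x.2) : Ambient k) = γ r
    have e1 : diagonal d⁻¹ * matA x * diagonal d = matA x := by
      rw [hA, diagonal_mul_diagonal, diagonal_mul_diagonal]
      congr 1; ext c
      rw [Pi.inv_apply, mul_right_comm, inv_mul_cancel₀ (hd0 c), one_mul]
    have e2 : diagonal d⁻¹ * matB x * diagonal d =
        of fun c c' => if c' = a ∧ c ≠ a then r * matB x c c' else matB x c c' := by
      ext c c'
      rw [mul_diagonal, diagonal_mul, of_apply, Pi.inv_apply]
      by_cases hc : c = a <;> by_cases hc' : c' = a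
      · subst hc hc'; simp [hd]; field_simp
      · subst hc; simp [hB c' hc', hc']
      · subst hc'; simp [hd, hc, mul_comm]
      · simp [hd, hc, hc']
    have e3 : diagonal d⁻¹ * matI x = matI x := by
      ext c c'
      rw [diagonal_mul, Pi.inv_apply]
      by_cases hc : c = a
      · subst hc
        have : matI x c c' = 0 := by fin_cases c' <;> assumption
        rw [this, mul_zero]
      · simp [hd, hc]
    have e4 : matJ x * diagonal d =
        of fun d c => if c = a then r * matJ x d c else matJ x d c := by
      ext c c'
      rw [mul_diagonal, of_apply]
      by_cases hc : c' = a
      · subst hc; simp [hd, mul_comm]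
      · simp [hd, hc]
    rw [e1, e2, e3, e4]
  have h0 : γ 0 ∈ Set.range fun L : GL (Fin k) ℂ => act L x := by
    have h1 : closure ({0}ᶜ : Set ℂ) ⊆ γ ⁻¹' Set.range fun L : GL (Fin k) ℂ => act L x :=
      closure_minimal (fun r hr => hγ r hr) (hcl.preimage hγc)
    rw [(dense_compl_singleton (0 : ℂ)).closure_eq] at h1
    exact h1 (Set.mem_univ 0)
  obtain ⟨L, hL⟩ := h0
  have hss := (sec_mem_regLevel hy 0).2.act L
  change IsStronglySemisimple (hatA ((fun L => act L x) L)) at hss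
  rw [hL, isStronglySemisimple_hatA_iff] at hss
  refine hss.1 (lam y a) (Pi.single a 1) (by simp) ?_ ?_
  · change matA x *ᵥ _ = _
    rw [hA, diagonal_mulVec_single, mul_one]
    ext c; simp [Pi.single_apply]
  · rw [dotProduct_single, mul_one]
    simp [γ, matJ]

theorem isClosed_orbit_iff {τ : ℂ} {x : Ambient k} {y : CoordSpace k} (hx : x ∈ regLevel k τ)
    (hy : y ∈ coordReg k) (hxy : IsCoord τ x y) :
    IsClosed (Set.range fun L : GL (Fin k) ℂ => act L x) ↔
      τ ≠ 0 ∨ ∀ a b, lam y a ≠ lamHat y b := by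
  refine ⟨fun hcl => ?_, isClosed_orbit hx hxy⟩
  by_contra! h
  obtain ⟨rfl, a, b, hab⟩ := h
  obtain ⟨L, rfl⟩ := hxy.exists_act_sec hx hy
  refine not_isClosed_orbit_sec hy hab ?_
  convert hcl using 1
  ext z
  constructor
  · rintro ⟨M, rfl⟩
    exact ⟨M * L⁻¹, by simp only [← act_mul, inv_mul_cancel_right]⟩
  · rintro ⟨M, rfl⟩
    exact ⟨M * L, by simp only [← act_mul]⟩

end Instanton

end

theorem mainTheorem4 (k : ℕ) (τ : ℂ) :
    IsOpen[QuotVar.zariskiQuot (Instanton.orbitRel (Instanton.level k τ))]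
      {q | ∃ x : Instanton.level k τ, Instanton.IsStronglySemisimple (Instanton.hatA x.1) ∧
        Quotient.mk _ x = q} ∧
    ∃ π : Instanton.NReg k τ → Instanton.CoordQuot k,
      (∀ (x : Instanton.regLevel k τ) (y : Instanton.coordReg k),
        π (Quotient.mk _ x) = Quotient.mk _ y ↔ Instanton.IsCoord τ x.1 y.1) ∧
      QuotVar.IsSymplecticIso (Instanton.orbitRel (Instanton.regLevel k τ)) (Instanton.permRel k)
        Instanton.omega Instanton.omegaCoord π ∧
      ∀ (x : Instanton.regLevel k τ) (y : Instanton.coordReg k),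
        π (Quotient.mk _ x) = Quotient.mk _ y →
          (IsClosed (Set.range fun L : GL (Fin k) ℂ => Instanton.act L x.1) ↔
            τ ≠ 0 ∨ ∀ a b, Instanton.lam y.1 a ≠ Instanton.lamHat y.1 b) := by
  obtain ⟨π, hbij, hπ⟩ := Instanton.exists_coordMap k τ
  exact ⟨Instanton.isOpen_stronglySemisimple k τ, π, hπ,
    Instanton.isSymplecticIso_of_isCoord hbij hπ, fun x y hxy =>
      Instanton.isClosed_orbit_iff x.2 y.2 ((hπ x y).1 hxy)⟩
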